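/- **Setting.** Let $n\ge 1$, $0<s<1$, $\delta>0$, $1<p<\infty$, and let $\Omega\subset\mathbb R^n$ be a bounded open set. Put $\Omega_\delta=\Omega+B(0,\delta)$ and $\Omega_{-\delta}=\{x\in\Omega:\operatorname{dist}(x,\partial\Omega)>\delta\}$, where $\delta$ is so small that $\Omega_{-\delta}\neq\emptyset$. Let $w_\delta\in C_c^\infty(B(0,\delta))$ be nonnegative, radial, radially non-increasing ($w_\delta(x_1)\ge w_\delta(x_2)$ if $|x_1|\le|x_2|$), with $0\le w_\delta\le a_0$ and $w_\delta=a_0$ on $B(0,b_0\delta)$ for some $a_0>0$, $0<b_0<1$. Let $$\gamma(t)=\frac{\pi^{n/2}2^{t}\,\Gamma(t/2)}{\Gamma((n-t)/2)},\qquad c_{n,s}=\frac{n-1+s}{\gamma(1-s)} .$$ For $u\in C_c^\infty(\mathbb R^n,\mathbb R^n)$ the nonlocal gradient is $$D^s_\delta u(x)=c_{n,s}\int_{B(x,\delta)}\frac{u(x)-u(y)}{|x-y|}\otimes\frac{x-y}{|x-y|}\,\frac{w_\delta(x-y)}{|x-y|^{n-1+s}}\,dy ,$$ and for a vector field $\psi$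 the nonlocal divergence is $$\operatorname{div}^s_\delta\psi(x)=c_{n,s}\int_{B(x,\delta)}\frac{\psi(x)-\psi(y)}{|x-y|}\cdot\frac{x-y}{|x-y|}\,\frac{w_\delta(x-y)}{|x-y|^{n-1+s}}\,dy$$ whenever this integral converges absolutely; the divergence of a matrix field is the vector of the divergences of its rows. If $u\in L^1(\Omega_\delta,\mathbb R^n)$ is the limit in $L^1(\Omega_\delta)$ of functions $u_j\in C_c^\infty(\mathbb R^n,\mathbb R^n)$ for which $D^s_\delta u_j$ converges to some $U$ in $L^1(\Omega)$, then $D^s_\delta u:=U$ (this does not depend on the sequence). Let $H^{s,p,\delta}(\Omega)$ be the closure of $C_c^\infty(\mathbb R^n,\mathbb R^n)$ under the norm $(\|u\|_{L^p(\Omega_\delta)}^p+\|D^s_\delta u\|_{L^p(\Omega)}^p)^{1/p}$, let $H^{s,p,\delta}_0(\Omega_{-\delta})$ be the closure of $C_c^\infty(\Omega_{-\delta},\mathbb R^n)$ in it, and for $g\in H^{s,p,\delta}(\Omega)$ let $H^{s,p,\delta}_g(\Omega_{-\delta})=g+H^{s,p,\delta}_0(\Omega_{-\delta})$. **Theorem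 (Euler–Lagrange equation).** Let $u_0\in H^{s,p,\delta}(\Omega)$ and let $W:\Omega\times\mathbb R^n\times\mathbb R^{n\times n}\to\mathbb R$ be such that $W(\cdot,y,F)$ is Lebesgue measurable for all $y,F$, and $W(x,\cdot,\cdot)$ is of class $C^1$ for a.e. $x\in\Omega$. Write $D_yW$, $D_FW$ for the partial gradients, $|\cdot|$ for the Euclidean (Frobenius) norms, and $S(x,y,F)=|W(x,y,F)|+|D_yW(x,y,F)|+|D_FW(x,y,F)|$. Assume that there are $c>0$ and $a\in L^1(\Omega)$ such that at least one of the following holds (each inequality for a.e. $x\in\Omega$ and all $y\in\mathbb R^n$, $F\in\mathbb R^{n\times n}$): - (c0) $S(x,y,F)\le a(x)+c(|y|^p+|F|^p)$; - (c1) $sp<n$, and for some $1\le r\le \frac{np}{n-sp}$ one has $u_0\in L^r(\Omega_\delta,\mathbb R^n)$ and $S(x,y,F)\le a(x)+c(|y|^r+|F|^p)$; - (c2) $sp=n$, and for some $1\le r<p'=\frac p{p-1}$ one has $\int_{\Omega_\delta}\exp(|u_0(x)|^r)\,dx<\infty$ and $S(x,y,F)\le a(x)+\exp(|y|^r)+c|F|^p$;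 - (c3) $sp>n$, $u_0\in L^\infty(\Omega_\delta,\mathbb R^n)$, and for some $f:[0,\infty)\to[0,\infty)$ mapping bounded sets to bounded sets, $S(x,y,F)\le a(x)+f(|y|)+c|F|^p$. Let $I(v)=\int_\Omega W(x,v(x),D^s_\delta v(x))\,dx$ and let $u$ be a minimizer of $I$ in $H^{s,p,\delta}_{u_0}(\Omega_{-\delta})$. Then for every $\varphi\in C_c^\infty(\Omega_{-\delta},\mathbb R^n)$ the following integrand is integrable and $$\int_\Omega\big[D_yW(x,u(x),D^s_\delta u(x))\cdot\varphi(x)+D_FW(x,u(x),D^s_\delta u(x))\cdot D^s_\delta\varphi(x)\big]\,dx=0 .$$ If, in addition, $D_FW(\cdot,u(\cdot),D^s_\delta u(\cdot))\in C^1(\overline{\Omega_{-\delta}},\mathbb R^{n\times n})$ (that is, on $\Omega_{-\delta}$ it agrees a.e. with a $C^1$ function which, together with its derivative, extends continuously to $\overline{\Omega_{-\delta}}$), then for a.e. $x\in\Omega_{-\delta}$ the integrals defining $\operatorname{div}^s_\delta D_FW(\cdot,u,D^s_\delta u)$ at $x$ converge absolutely and $$D_yW(x,u(x),D^s_\delta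 u(x))=\operatorname{div}^s_\delta D_FW(x,u(x),D^s_\delta u(x)).$$ -/

import Mathlib

open MeasureTheory Filter Topology
open scoped ContDiff NNReal ENNReal Pointwise

noncomputable section

namespace NonlocalEL

/-- Points and vectors of `ℝⁿ`, with the Euclidean norm. -/
abbrev Vec (n : ℕ) : Type := EuclideanSpace ℝ (Fin n)

/-- Real `n × n` matrices, with the Frobenius norm and the inner product `A · B = ∑ Aᵢⱼ Bᵢⱼ`. -/
abbrev Mat (n : ℕ) : Type := EuclideanSpace ℝ (Fin n × Fin n)

/-- The matrix `a ⊗ b`, with entries `aᵢ bⱼ`. -/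
def tensor {n : ℕ} (a b : Vec n) : Mat n := WithLp.toLp 2 fun ij => a ij.1 * b ij.2

/-- The `i`-th row of a matrix. -/
def row {n : ℕ} (F : Mat n) (i : Fin n) : Vec n := WithLp.toLp 2 fun j => F (i, j)

/-! ### Domains -/

/-- `Ω_δ = Ω + B(0, δ)`. -/
def outer {n : ℕ} (δ : ℝ) (Ω : Set (Vec n)) : Set (Vec n) := Ω + Metric.ball 0 δ

/-- `Ω_{-δ} = {x ∈ Ω : dist(x, ∂Ω) > δ}`. -/
def shrunk {n : ℕ} (δ : ℝ) (Ω : Set (Vec n)) : Set (Vec n) :=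
  {x | x ∈ Ω ∧ δ < Metric.infDist x (frontier Ω)}

/-- `φ ∈ C_c^∞(U, ℝⁿ)`, extended by zero to `ℝⁿ`. -/
structure IsTest {n : ℕ} (U : Set (Vec n)) (φ : Vec n → Vec n) : Prop where
  smooth : ContDiff ℝ ∞ φ
  compact : HasCompactSupport φ
  support : tsupport φ ⊆ U

/-! ### Kernel -/

/-- The assumptions on the cut-off function `w_δ`. -/
structure IsCutoff {n : ℕ} (δ : ℝ) (w : Vec n → ℝ) : Prop where
  radial : ∀ x y, ‖x‖ = ‖y‖ → w x = w y
  smooth : ContDiff ℝ ∞ w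
  compact : HasCompactSupport w
  support : tsupport w ⊆ Metric.ball 0 δ
  plateau : ∃ a₀ b₀ : ℝ, 0 < a₀ ∧ 0 < b₀ ∧ b₀ < 1 ∧ (∀ x, 0 ≤ w x ∧ w x ≤ a₀) ∧
    ∀ x ∈ Metric.ball (0 : Vec n) (b₀ * δ), w x = a₀
  decreasing : ∀ x y, ‖x‖ ≤ ‖y‖ → w y ≤ w x

/-- `γ(s) = π^{n/2} 2^s Γ(s/2) / Γ((n-s)/2)`. -/
def gammaConst (n : ℕ) (s : ℝ) : ℝ :=
  Real.pi ^ ((n : ℝ) / 2) * 2 ^ s * Real.Gamma (s / 2) / Real.Gamma (((n : ℝ) - s) / 2)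

/-- `c_{n,s} = (n - 1 + s) / γ(1 - s)`. -/
def cConst (n : ℕ) (s : ℝ) : ℝ := ((n : ℝ) - 1 + s) / gammaConst n (1 - s)

/-- `w_δ(z) / |z|^{n-1+s}`. -/
def kernel {n : ℕ} (s : ℝ) (w : Vec n → ℝ) (z : Vec n) : ℝ := w z / ‖z‖ ^ ((n : ℝ) - 1 + s)

/-! ### Nonlocal gradient and divergence given by the integral formulas -/

/-- The integrand of the nonlocal gradient of a vector field. -/
def gradIntegrand {n : ℕ} (s : ℝ) (w : Vec n → ℝ) (u : Vec n → Vec n) (x y : Vec n) : Mat n :=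
  kernel s w (x - y) • tensor (‖x - y‖⁻¹ • (u x - u y)) (‖x - y‖⁻¹ • (x - y))

/-- `D_δ^s u (x)` for smooth compactly supported `u : ℝⁿ → ℝⁿ`. -/
def smoothGrad {n : ℕ} (s δ : ℝ) (w : Vec n → ℝ) (u : Vec n → Vec n) (x : Vec n) : Mat n :=
  cConst n s • ∫ y in Metric.ball x δ, gradIntegrand s w u x y

/-- The integrand of the nonlocal divergence of a vector field. -/
def divIntegrand {n : ℕ} (s : ℝ) (w : Vec n → ℝ) (ψ : Vec n → Vec n) (x y : Vec n) : ℝ :=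
  inner ℝ (‖x - y‖⁻¹ • (ψ x - ψ y)) (‖x - y‖⁻¹ • (x - y)) * kernel s w (x - y)

/-- `div_δ^s ψ (x)` for a vector field `ψ`, whenever the integrand is integrable on `B(x, δ)`. -/
def nonlocalDiv {n : ℕ} (s δ : ℝ) (w : Vec n → ℝ) (ψ : Vec n → Vec n) (x : Vec n) : ℝ :=
  cConst n s * ∫ y in Metric.ball x δ, divIntegrand s w ψ x y

/-- The nonlocal divergence of a matrix field: the vector of the divergences of the rows. -/
def nonlocalMatDiv {n : ℕ} (s δ : ℝ) (w : Vec n → ℝ) (A : Vec n → Mat n) (x : Vec n) : Vec n :=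
  WithLp.toLp 2 fun i => nonlocalDiv s δ w (fun z => row (A z) i) x

/-! ### The nonlocal gradient of integrable functions -/

/-- `U` is a nonlocal gradient of `u ∈ L¹(Ω_δ, ℝⁿ)`: some sequence in `C_c^∞(ℝⁿ, ℝⁿ)` converges to
`u` in `L¹(Ω_δ)` while the nonlocal gradients converge to `U` in `L¹(Ω)`. -/
def IsNonlocalGrad {n : ℕ} (s δ : ℝ) (w : Vec n → ℝ) (Ω : Set (Vec n))
    (u : Vec n → Vec n) (U : Vec n → Mat n) : Prop :=
  IntegrableOn u (outer δ Ω) ∧ IntegrableOn U Ω ∧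
    ∃ v : ℕ → Vec n → Vec n, (∀ j, IsTest Set.univ (v j)) ∧
      Tendsto (fun j => eLpNorm (v j - u) 1 (volume.restrict (outer δ Ω))) atTop (𝓝 0) ∧
      Tendsto (fun j => eLpNorm (smoothGrad s δ w (v j) - U) 1 (volume.restrict Ω)) atTop (𝓝 0)

open Classical in
/-- `D_δ^s u`, determined almost everywhere in `Ω` (and set to zero if `u` has no nonlocal
gradient). -/
def nonlocalGrad {n : ℕ} (s δ : ℝ) (w : Vec n → ℝ) (Ω : Set (Vec n)) (u : Vec n → Vec n) :
    Vec n → Mat n :=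
  if h : ∃ U, IsNonlocalGrad s δ w Ω u U then h.choose else 0

/-! ### Function spaces -/

/-- The functions `v j ∈ C_c^∞(ℝⁿ, ℝⁿ)` converge to `u` in the norm
`(‖u‖_{L^p(Ω_δ)}^p + ‖D_δ^s u‖_{L^p(Ω)}^p)^{1/p}`. -/
def TendstoH {n : ℕ} (s p δ : ℝ) (w : Vec n → ℝ) (Ω : Set (Vec n))
    (v : ℕ → Vec n → Vec n) (u : Vec n → Vec n) : Prop :=
  Tendsto (fun j => eLpNorm (v j - u) (ENNReal.ofReal p) (volume.restrict (outer δ Ω)))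
      atTop (𝓝 0) ∧
    Tendsto (fun j => eLpNorm (smoothGrad s δ w (v j) - nonlocalGrad s δ w Ω u)
      (ENNReal.ofReal p) (volume.restrict Ω)) atTop (𝓝 0)

/-- `u ∈ H^{s,p,δ}(Ω, ℝⁿ)`, the closure of `C_c^∞(ℝⁿ, ℝⁿ)`. -/
def MemH {n : ℕ} (s p δ : ℝ) (w : Vec n → ℝ) (Ω : Set (Vec n)) (u : Vec n → Vec n) : Prop :=
  MemLp u (ENNReal.ofReal p) (volume.restrict (outer δ Ω)) ∧
    MemLp (nonlocalGrad s δ w Ω u) (ENNReal.ofReal p) (volume.restrict Ω) ∧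
    ∃ v : ℕ → Vec n → Vec n, (∀ j, IsTest Set.univ (v j)) ∧ TendstoH s p δ w Ω v u

/-- `u ∈ H_0^{s,p,δ}(Ω_{-δ}, ℝⁿ)`, the closure of `C_c^∞(Ω_{-δ}, ℝⁿ)` in `H^{s,p,δ}(Ω, ℝⁿ)`. -/
def MemH0 {n : ℕ} (s p δ : ℝ) (w : Vec n → ℝ) (Ω : Set (Vec n)) (u : Vec n → Vec n) : Prop :=
  MemH s p δ w Ω u ∧
    ∃ v : ℕ → Vec n → Vec n, (∀ j, IsTest (shrunk δ Ω) (v j)) ∧ TendstoH s p δ w Ω v u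

/-- `u ∈ H_g^{s,p,δ}(Ω_{-δ}, ℝⁿ) = g + H_0^{s,p,δ}(Ω_{-δ}, ℝⁿ)`. -/
def MemHAffine {n : ℕ} (s p δ : ℝ) (w : Vec n → ℝ) (Ω : Set (Vec n)) (g u : Vec n → Vec n) :
    Prop :=
  MemH0 s p δ w Ω (u - g)

/-- `f ∈ C¹(closure U)`: up to a null set of `U`, `f` is continuously differentiable in `U`, and
it and its derivative extend continuously to the closure of `U`. -/
def IsC1Closure {n : ℕ} (U : Set (Vec n)) (f : Vec n → Mat n) : Prop :=
  ∃ (g : Vec n → Mat n) (g' : Vec n → (Vec n →L[ℝ] Mat n)),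
    f =ᵐ[volume.restrict U] g ∧ ContinuousOn g (closure U) ∧ ContinuousOn g' (closure U) ∧
      ∀ x ∈ U, HasFDerivAt g (g' x) x

/-! ### The energy -/

/-- `D_y W (x, y, F)`. -/
def dY {n : ℕ} (W : Vec n → Vec n → Mat n → ℝ) (x y : Vec n) (F : Mat n) : Vec n :=
  gradient (fun y' => W x y' F) y

/-- `D_F W (x, y, F)`. -/
def dF {n : ℕ} (W : Vec n → Vec n → Mat n → ℝ) (x y : Vec n) (F : Mat n) : Mat n :=
  gradient (fun F' => W x y F') F

/-- `I(u) = ∫_Ω W(x, u(x), D_δ^s u(x)) dx`. -/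
def energy {n : ℕ} (s δ : ℝ) (w : Vec n → ℝ) (Ω : Set (Vec n))
    (W : Vec n → Vec n → Mat n → ℝ) (u : Vec n → Vec n) : ℝ :=
  ∫ x in Ω, W x (u x) (nonlocalGrad s δ w Ω u x)

/-- `u` minimizes `I` in `H_{u₀}^{s,p,δ}(Ω_{-δ}, ℝⁿ)`. -/
def IsMinimizer {n : ℕ} (s p δ : ℝ) (w : Vec n → ℝ) (Ω : Set (Vec n))
    (W : Vec n → Vec n → Mat n → ℝ) (u₀ u : Vec n → Vec n) : Prop :=
  MemHAffine s p δ w Ω u₀ u ∧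
    ∀ v, MemHAffine s p δ w Ω u₀ v → energy s δ w Ω W u ≤ energy s δ w Ω W v

/-- `|W| + |D_y W| + |D_F W| ≤ b(x, |y|, |F|)` for a.e. `x ∈ Ω` and all `y`, `F`. -/
def GrowthBound {n : ℕ} (Ω : Set (Vec n)) (W : Vec n → Vec n → Mat n → ℝ)
    (b : Vec n → ℝ≥0 → ℝ≥0 → ℝ) : Prop :=
  ∀ᵐ x ∂(volume.restrict Ω), ∀ y F,
    |W x y F| + ‖dY W x y F‖ + ‖dF W x y F‖ ≤ b x ‖y‖₊ ‖F‖₊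

/-- The growth conditions, with constant `c` and function `a`: at least one of the four holds. -/
def GrowthCondition {n : ℕ} (s p δ : ℝ) (Ω : Set (Vec n)) (W : Vec n → Vec n → Mat n → ℝ)
    (u₀ : Vec n → Vec n) (c : ℝ) (a : Vec n → ℝ) : Prop :=
  GrowthBound Ω W (fun x Y Z => a x + c * ((Y : ℝ) ^ p + (Z : ℝ) ^ p)) ∨
  (s * p < n ∧ ∃ r : ℝ, 1 ≤ r ∧ r ≤ n * p / (n - s * p) ∧
    MemLp u₀ (ENNReal.ofReal r) (volume.restrict (outer δ Ω)) ∧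
    GrowthBound Ω W (fun x Y Z => a x + c * ((Y : ℝ) ^ r + (Z : ℝ) ^ p))) ∨
  (s * p = n ∧ ∃ r : ℝ, 1 ≤ r ∧ r < p / (p - 1) ∧
    IntegrableOn (fun x => Real.exp (‖u₀ x‖ ^ r)) (outer δ Ω) ∧
    GrowthBound Ω W (fun x Y Z => a x + Real.exp ((Y : ℝ) ^ r) + c * (Z : ℝ) ^ p)) ∨
  (n < s * p ∧ MemLp u₀ ⊤ (volume.restrict (outer δ Ω)) ∧
    ∃ f : ℝ≥0 → ℝ≥0, (∀ B, Bornology.IsBounded B → Bornology.IsBounded (f '' B)) ∧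
      GrowthBound Ω W (fun x Y Z => a x + f Y + c * (Z : ℝ) ^ p))

end NonlocalEL

end

/-!
The weak equation is the statement that `t ↦ I(u + t φ)`, which is minimal at `t = 0`, has
derivative zero there, once the derivative may be taken under the integral sign
(`integral_dirDeriv_eq_zero`). Linearity of the nonlocal gradient on the closure of the test
functions rests on its uniqueness (`IsNonlocalGrad.ae_eq`), which follows by testing against smooth
functions with the nonlocal integration by parts `integral_mul_kdiff`: the kernel is odd, so
`∫ g D f = -∫ f D g` is Fubini and a translation.

The integrable bound needed for the differentiation (`exists_dominating`) splits `Ω`. Off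
`shrunk δ Ω` the competitors agree with `u₀`, whose integrability is assumed. On `shrunk δ Ω` it
comes from the Sobolev, Trudinger–Moser and Morrey embeddings of the nonlocal space in the cases
`sp < n`, `sp = n` and `sp > n` (`MemH.memLp_of_subcritical`, `MemH.lintegral_exp_lt_top`,
`MemH.exists_norm_le_of_supercritical`). They are reduced to Riesz potentials:

* For `f ∈ C_c^∞` and the full fractional gradient `D^s`, with kernel `h ‖h‖^{-(n+1+s)}`, one has
  `|f| ≤ C ‖·‖^{s-n} * |D^s f|` (`exists_abs_le_rieszPotential`). Up to a constant `f` is the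
  convolution of `D^s f` with `z ‖z‖^{-(n+1-s)}`; this is checked on the Fourier side, both kernels
  being superpositions of the functions `z e^{-t‖z‖²}`, whose transforms are explicit.
* If `χ` is a cut-off function supported in `Ω`, then `D^s (χ v)` is bounded by the truncated
  gradient of `v` on `Ω` plus the convolution of `|v|` on `Ω_δ` with an integrable kernel, because
  `w` is constant near the origin (`exists_localization`).
* A Riesz potential of `G ∈ L¹ ∩ Lᵖ` is bounded pointwise by a near part, controlled by a maximal
  function of `G`, and a far part, controlled by Hölder's inequality (`exists_potential_le`). The
  choice of the radius separating the two gives the three regimes, and Fatou's lemma transfers the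
  bounds to the closure.

For the strong form, the flux `D_F W` extended by zero is integrable, and continuously
differentiable near the support of a test function. Hence the integration by parts applies to it
(`integrable_prod_of_hasFDerivAt`), and the fundamental lemma of the calculus of variations yields
the equation almost everywhere (`IsC1Closure.ae_eq_nonlocalMatDiv`).
-/


namespace NonlocalEL

variable {n : ℕ}

/-! ### The vector kernel -/

/-- The odd vector kernel `w(h) h / |h|^{n+1+s}`, against which differences are integrated in the
nonlocal gradient and divergence. -/
noncomputable def vecKernel (s : ℝ) (w : Vec n → ℝ) (h : Vec n) : Vec n :=
  (w h * ‖h‖ ^ (-((n : ℝ) + 1 + s))) • h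

lemma kernel_mul_inv_sq (s : ℝ) (w : Vec n → ℝ) {h : Vec n} (hh : h ≠ 0) :
    kernel s w h * (‖h‖⁻¹ * ‖h‖⁻¹) = w h * ‖h‖ ^ (-((n : ℝ) + 1 + s)) := by
  have h0 : 0 < ‖h‖ := norm_pos_iff.2 hh
  have e : ‖h‖⁻¹ * ‖h‖⁻¹ = ‖h‖ ^ (-2 : ℝ) := by
    rw [Real.rpow_neg h0.le, ← mul_inv]
    congr 1
    rw [Real.rpow_two]; ring
  rw [e, kernel, div_eq_mul_inv, ← Real.rpow_neg h0.le, mul_assoc, ← Real.rpow_add h0]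
  congr 2; ring

lemma gradIntegrand_apply (s : ℝ) (w : Vec n → ℝ) (u : Vec n → Vec n) (x y : Vec n)
    (ij : Fin n × Fin n) :
    gradIntegrand s w u x y ij = (u x ij.1 - u y ij.1) * vecKernel s w (x - y) ij.2 := by
  by_cases hxy : x - y = 0
  · simp [gradIntegrand, tensor, vecKernel, hxy]
  · have := kernel_mul_inv_sq s w hxy
    simp only [gradIntegrand, tensor, vecKernel, PiLp.smul_apply, PiLp.sub_apply, smul_eq_mul]
    rw [← this]; ring

lemma divIntegrand_eq (s : ℝ) (w : Vec n → ℝ) (ψ : Vec n → Vec n) (x y : Vec n) :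
    divIntegrand s w ψ x y = ∑ j, (ψ x j - ψ y j) * vecKernel s w (x - y) j := by
  by_cases hxy : x - y = 0
  · simp [divIntegrand, vecKernel, hxy]
  · have := kernel_mul_inv_sq s w hxy
    simp only [divIntegrand, vecKernel, PiLp.smul_apply, PiLp.sub_apply, smul_eq_mul,
      inner_smul_left, inner_smul_right, PiLp.inner_apply]
    rw [← this, Finset.mul_sum, Finset.mul_sum, Finset.sum_mul]
    refine Finset.sum_congr rfl fun j _ => ?_
    simp
    ring

lemma norm_vecKernel (s : ℝ) (w : Vec n → ℝ) {h : Vec n} (hh : h ≠ 0) :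
    ‖vecKernel s w h‖ = |w h| * ‖h‖ ^ (-((n : ℝ) + s)) := by
  have h0 : 0 < ‖h‖ := norm_pos_iff.2 hh
  rw [vecKernel, norm_smul, norm_mul, Real.norm_eq_abs, Real.norm_eq_abs,
    abs_of_nonneg (Real.rpow_nonneg h0.le _), mul_assoc]
  nth_rewrite 2 [← Real.rpow_one ‖h‖]
  rw [← Real.rpow_add h0]
  congr 2; ring

lemma measurable_vecKernel (s : ℝ) {w : Vec n → ℝ} (hw : Measurable w) :
    Measurable (vecKernel s w) := by
  unfold vecKernel; fun_prop

lemma vecKernel_neg (s : ℝ) {w : Vec n → ℝ} (hw : ∀ h, w (-h) = w h) (h : Vec n) :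
    vecKernel s w (-h) = -vecKernel s w h := by
  simp [vecKernel, hw]

lemma IsCutoff.neg {δ : ℝ} {w : Vec n → ℝ} (hw : IsCutoff δ w) (h : Vec n) : w (-h) = w h :=
  hw.radial _ _ (norm_neg h)

lemma IsCutoff.eq_zero {δ : ℝ} {w : Vec n → ℝ} (hw : IsCutoff δ w) {h : Vec n} (hh : δ ≤ ‖h‖) :
    w h = 0 := by
  by_contra hne
  have := hw.support (subset_tsupport _ hne)
  rw [mem_ball_zero_iff] at this
  linarith

lemma vecKernel_eq_zero {s δ : ℝ} {w : Vec n → ℝ} (hw : IsCutoff δ w) {h : Vec n} (hh : δ ≤ ‖h‖) :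
    vecKernel s w h = 0 := by
  simp [vecKernel, hw.eq_zero hh]

/-! ### Differences integrated against an odd kernel -/

/-- `∫ (f(x) - f(x - h)) κ(h) dh`: the scalar building block of the nonlocal gradient and
divergence. -/
noncomputable def kdiff (κ : Vec n → ℝ) (f : Vec n → ℝ) (x : Vec n) : ℝ :=
  ∫ h, (f x - f (x - h)) * κ h

/-- Differences of `f` are controlled by `min (1, |h|)`, as for bounded Lipschitz functions. -/
def BddLip (L : ℝ) (f : Vec n → ℝ) : Prop := ∀ x h, |f x - f (x - h)| ≤ L * min 1 ‖h‖

/-- Odd kernels that are integrable against `min (1, |h|)`. -/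
structure IsLevyKernel (κ : Vec n → ℝ) : Prop where
  meas : Measurable κ
  odd : ∀ h, κ (-h) = -κ h
  int : Integrable fun h => min 1 ‖h‖ * |κ h|

lemma BddLip.nonneg {L : ℝ} {f : Vec n → ℝ} (hf : BddLip L f) (hn : 1 ≤ n) : 0 ≤ L := by
  have := hf 0 (EuclideanSpace.single ⟨0, hn⟩ 1)
  simp at this
  exact (abs_nonneg _).trans this

lemma BddLip.norm_mul_le {L : ℝ} {f : Vec n → ℝ} (hf : BddLip L f) (κ : Vec n → ℝ) (x h : Vec n) :
    ‖(f x - f (x - h)) * κ h‖ ≤ L * (min 1 ‖h‖ * |κ h|) := by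
  rw [norm_mul, ← mul_assoc]
  exact mul_le_mul_of_nonneg_right (hf x h) (norm_nonneg _)

lemma BddLip.integrable {L : ℝ} {f κ : Vec n → ℝ} (hf : BddLip L f) (hfm : Measurable f)
    (hκ : IsLevyKernel κ) (x : Vec n) : Integrable fun h => (f x - f (x - h)) * κ h := by
  have := hκ.meas
  refine (hκ.int.const_mul L).mono' (by fun_prop) (ae_of_all _ fun h => hf.norm_mul_le κ x h)

lemma BddLip.abs_kdiff_le {L : ℝ} {f κ : Vec n → ℝ} (hf : BddLip L f)
    (hκ : IsLevyKernel κ) (x : Vec n) : |kdiff κ f x| ≤ L * ∫ h, min 1 ‖h‖ * |κ h| := by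
  rw [← integral_const_mul]
  exact norm_integral_le_of_norm_le (hκ.int.const_mul L) (ae_of_all _ fun h => hf.norm_mul_le κ x h)

lemma stronglyMeasurable_kdiff {f κ : Vec n → ℝ} (hf : Measurable f) (hκ : Measurable κ) :
    StronglyMeasurable (kdiff κ f) := by
  refine StronglyMeasurable.integral_prod_right (f := fun x h => (f x - f (x - h)) * κ h) ?_
  exact Measurable.stronglyMeasurable (by unfold Function.uncurry; fun_prop)

lemma BddLip.integrable_prod {L : ℝ} {f κ g : Vec n → ℝ} (hf : BddLip L f) (hfm : Measurable f)
    (hκ : IsLevyKernel κ) (hg : Integrable g) :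
    Integrable (fun q : Vec n × Vec n => g q.1 * ((f q.1 - f (q.1 - q.2)) * κ q.2))
      (volume.prod volume) := by
  have := hκ.meas
  refine ((hg.norm.mul_prod (hκ.int.const_mul L))).mono' ?_ (ae_of_all _ fun q => ?_)
  · exact (hg.aestronglyMeasurable.comp_fst).mul
      (Measurable.aestronglyMeasurable (by fun_prop))
  · rw [norm_mul]
    exact mul_le_mul_of_nonneg_left (hf.norm_mul_le κ q.1 q.2) (norm_nonneg _)

/-- Nonlocal integration by parts. For fixed `h` the inner integrals in `x` are matched by a
translation, and the oddness of the kernel produces the sign. -/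
theorem integral_mul_kdiff {κ f g : Vec n → ℝ} (hκ : ∀ h, κ (-h) = -κ h)
    (hfg : Integrable fun x => f x * g x) (hgf : ∀ h, Integrable fun x => g x * f (x - h))
    (hfg' : ∀ h, Integrable fun x => f x * g (x - h))
    (h1 : Integrable (fun q : Vec n × Vec n => g q.1 * ((f q.1 - f (q.1 - q.2)) * κ q.2))
      (volume.prod volume))
    (h2 : Integrable (fun q : Vec n × Vec n => f q.1 * ((g q.1 - g (q.1 - q.2)) * κ q.2))
      (volume.prod volume)) :
    ∫ x, g x * kdiff κ f x = -∫ x, f x * kdiff κ g x := by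
  have key : ∀ h, ∫ x, g x * ((f x - f (x - h)) * κ h)
      = -∫ x, f x * ((g x - g (x - -h)) * κ (-h)) := by
    intro h
    have e1 : ∀ x, g x * ((f x - f (x - h)) * κ h) = (f x * g x - g x * f (x - h)) * κ h := by
      intro x; ring
    have e2 : ∀ x, f x * ((g x - g (x - -h)) * κ (-h))
        = (f x * g x - f x * g (x - -h)) * κ (-h) := by intro x; ring
    simp_rw [e1, e2]
    rw [integral_mul_const, integral_mul_const, integral_sub hfg (hgf h),
      integral_sub hfg (hfg' _), hκ]
    have : ∫ x, g x * f (x - h) = ∫ x, f x * g (x - -h) := by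
      rw [← integral_add_right_eq_self (fun x => g x * f (x - h)) h]
      refine integral_congr_ae (ae_of_all _ fun x => ?_)
      simp [mul_comm]
    rw [this]; ring
  simp only [kdiff, ← integral_const_mul]
  rw [integral_integral_swap (f := fun x h => g x * ((f x - f (x - h)) * κ h)) h1,
    integral_integral_swap (f := fun x h => f x * ((g x - g (x - h)) * κ h)) h2]
  simp_rw [key]
  rw [integral_neg, integral_neg_eq_self (fun h => ∫ x, f x * ((g x - g (x - h)) * κ h))]

lemma BddLip.integral_mul_kdiff {L L' : ℝ} {κ f g : Vec n → ℝ} (hκ : IsLevyKernel κ)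
    (hf : BddLip L f) (hg : BddLip L' g) (hfc : Continuous f) (hgc : Continuous g)
    (hfs : HasCompactSupport f) (hgs : HasCompactSupport g) :
    ∫ x, g x * kdiff κ f x = -∫ x, f x * kdiff κ g x := by
  have hfi := hfc.integrable_of_hasCompactSupport hfs (μ := volume)
  have hgi := hgc.integrable_of_hasCompactSupport hgs (μ := volume)
  refine NonlocalEL.integral_mul_kdiff hκ.odd ?_ (fun h => ?_) (fun h => ?_)
    (hf.integrable_prod hfc.measurable hκ hgi) (hg.integrable_prod hgc.measurable hκ hfi)
  · exact (hfc.mul hgc).integrable_of_hasCompactSupport hfs.mul_right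
  · exact (hgc.mul (by fun_prop)).integrable_of_hasCompactSupport hgs.mul_right
  · exact (hfc.mul (by fun_prop)).integrable_of_hasCompactSupport hfs.mul_right

/-- Smooth compactly supported functions are bounded and Lipschitz. -/
lemma exists_bddLip {f : Vec n → ℝ} (hf : ContDiff ℝ ∞ f) (hfs : HasCompactSupport f) :
    ∃ L, BddLip L f := by
  obtain ⟨C, hC⟩ := hf.lipschitzWith_of_hasCompactSupport hfs (by simp)
  obtain ⟨B, hB⟩ := hf.continuous.bounded_above_of_compact_support hfs
  refine ⟨max C (2 * B), fun x h => ?_⟩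
  rcases le_total 1 ‖h‖ with h1 | h1
  · rw [min_eq_left h1, mul_one]
    refine le_trans ?_ (le_max_right _ _)
    calc |f x - f (x - h)| ≤ |f x| + |f (x - h)| := abs_sub _ _
      _ ≤ 2 * B := by have := hB x; have := hB (x - h); simp only [Real.norm_eq_abs] at *; linarith
  · rw [min_eq_right h1]
    have := hC.dist_le_mul x (x - h)
    rw [dist_eq_norm, dist_eq_norm, Real.norm_eq_abs] at this
    simp only [sub_sub_cancel] at this
    exact this.trans (mul_le_mul_of_nonneg_right (le_max_left _ _) (norm_nonneg _))

/-! ### Integrability of the kernel -/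

lemma integrableOn_ball_rpow (hn : 1 ≤ n) {α : ℝ} (hα : α < n) (r : ℝ) :
    IntegrableOn (fun h : Vec n => ‖h‖ ^ (-α)) (Metric.ball 0 r) := by
  refine integrableOn_ball_of_norm_le_rpow (C := 1) (α := α) (by simpa using hn) (by simpa using hα)
    (ae_of_all _ fun x => ?_) (Measurable.aestronglyMeasurable (by fun_prop))
  rw [one_mul, Real.norm_of_nonneg (Real.rpow_nonneg (norm_nonneg _) _)]

lemma ae_ne_zero (hn : 1 ≤ n) : ∀ᵐ h : Vec n, h ≠ 0 := by
  have : Nonempty (Fin n) := ⟨⟨0, hn⟩⟩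
  have : Nontrivial (Vec n) := inferInstance
  rw [ae_iff]; simp

lemma IsCutoff.measurable {δ : ℝ} {w : Vec n → ℝ} (hw : IsCutoff δ w) : Measurable w :=
  hw.smooth.continuous.measurable

lemma integrable_norm_mul_vecKernel (hn : 1 ≤ n) {s δ : ℝ} (hs1 : s < 1) {w : Vec n → ℝ}
    (hw : IsCutoff δ w) : Integrable fun h => ‖h‖ * ‖vecKernel s w h‖ := by
  obtain ⟨a₀, b₀, ha, hb, hb1, hwa, hwb⟩ := hw.plateau
  have h1 := (integrableOn_ball_rpow hn (α := n - (1 - s)) (by linarith) δ).integrable_indicator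
    Metric.isOpen_ball.measurableSet
  have := measurable_vecKernel s hw.measurable
  refine (h1.const_mul a₀).mono' (Measurable.aestronglyMeasurable (by fun_prop)) ?_
  filter_upwards [ae_ne_zero hn] with h hh
  have h0 : 0 < ‖h‖ := norm_pos_iff.2 hh
  rw [Real.norm_of_nonneg (by positivity)]
  by_cases hδ : ‖h‖ < δ
  · rw [Set.indicator_of_mem (by simpa using hδ), norm_vecKernel s w hh, mul_left_comm]
    nth_rewrite 1 [← Real.rpow_one ‖h‖]
    rw [← Real.rpow_add h0, abs_of_nonneg (hwa h).1]
    have : (1 : ℝ) + -(n + s) = -(n - (1 - s)) := by ring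
    rw [this]
    exact mul_le_mul_of_nonneg_right (hwa h).2 (Real.rpow_nonneg h0.le _)
  · rw [vecKernel_eq_zero hw (not_lt.1 hδ), Set.indicator_of_notMem (by simpa using hδ)]
    simp

lemma isLevyKernel_vecKernel (hn : 1 ≤ n) {s δ : ℝ} (hs1 : s < 1) {w : Vec n → ℝ}
    (hw : IsCutoff δ w) (j : Fin n) : IsLevyKernel fun h => vecKernel s w h j := by
  have hk := measurable_vecKernel s hw.measurable
  have hm : Measurable fun h : Vec n => vecKernel s w h j :=
    ((EuclideanSpace.proj (𝕜 := ℝ) j).continuous.measurable).comp hk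
  refine ⟨hm, fun h => by rw [vecKernel_neg s hw.neg, PiLp.neg_apply], ?_⟩
  refine (integrable_norm_mul_vecKernel hn hs1 hw).mono'
    ((measurable_const.min measurable_norm).mul hm.abs).aestronglyMeasurable
    (ae_of_all _ fun h => ?_)
  have h1 : |vecKernel s w h j| ≤ ‖vecKernel s w h‖ := by
    simpa using PiLp.norm_apply_le (vecKernel s w h) j
  rw [norm_mul, Real.norm_eq_abs, Real.norm_eq_abs, abs_abs,
    abs_of_nonneg (le_min zero_le_one (norm_nonneg _))]
  exact mul_le_mul (min_le_right _ _) h1 (abs_nonneg _) (norm_nonneg _)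

/-! ### The nonlocal gradient of smooth functions, componentwise -/

lemma IsTest.comp {U : Set (Vec n)} {φ : Vec n → Vec n} (hφ : IsTest U φ) (i : Fin n) :
    ContDiff ℝ ∞ (fun x => φ x i) ∧ HasCompactSupport (fun x => φ x i) :=
  ⟨(contDiff_euclidean (n := ∞)).1 hφ.smooth i,
    hφ.compact.comp_left (g := fun v : Vec n => v i) (by simp)⟩

lemma integral_ball_eq_kdiff {κ f : Vec n → ℝ} {δ : ℝ} (hκ : ∀ h, δ ≤ ‖h‖ → κ h = 0) (x : Vec n) :
    ∫ y in Metric.ball x δ, (f x - f y) * κ (x - y) = kdiff κ f x := by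
  rw [setIntegral_eq_integral_of_forall_compl_eq_zero, kdiff,
    ← integral_sub_left_eq_self (fun h => (f x - f (x - h)) * κ h) volume x]
  · simp
  · intro y hy
    rw [hκ, mul_zero]
    rw [Metric.mem_ball, not_lt, dist_comm, dist_eq_norm] at hy
    exact hy

lemma integrable_gradIntegrand (hn : 1 ≤ n) {s δ : ℝ} (hs1 : s < 1) {w : Vec n → ℝ}
    (hw : IsCutoff δ w) {u : Vec n → Vec n} (hu : IsTest Set.univ u) (x : Vec n) :
    Integrable (gradIntegrand s w u x) := by
  refine Integrable.of_eval_piLp fun ij => ?_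
  simp_rw [gradIntegrand_apply]
  obtain ⟨L, hL⟩ := exists_bddLip (hu.comp ij.1).1 (hu.comp ij.1).2
  have := hL.integrable (hu.comp ij.1).1.continuous.measurable
    (isLevyKernel_vecKernel hn hs1 hw ij.2) x
  have h2 := this.comp_sub_left x
  simpa using h2

lemma smoothGrad_apply (hn : 1 ≤ n) {s δ : ℝ} (hs1 : s < 1) {w : Vec n → ℝ}
    (hw : IsCutoff δ w) {u : Vec n → Vec n} (hu : IsTest Set.univ u) (x : Vec n)
    (ij : Fin n × Fin n) : smoothGrad s δ w u x ij =
      cConst n s * kdiff (fun h => vecKernel s w h ij.2) (fun y => u y ij.1) x := by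
  have hi := (integrable_gradIntegrand hn hs1 hw hu x).integrableOn (s := Metric.ball x δ)
  rw [smoothGrad, PiLp.smul_apply, smul_eq_mul,
    ← integral_ball_eq_kdiff (δ := δ) (fun h hh => by simp [vecKernel_eq_zero hw hh])]
  congr 1
  rw [eval_integral_piLp fun i => hi.eval_piLp i]
  simp_rw [gradIntegrand_apply]

lemma gammaConst_pos {t : ℝ} (ht : 0 < t) (htn : t < n) : 0 < gammaConst n t := by
  unfold gammaConst
  have h1 := Real.Gamma_pos_of_pos (half_pos ht)
  have h2 := Real.Gamma_pos_of_pos (half_pos (sub_pos.2 htn))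
  have := Real.pi_pos
  positivity

lemma cConst_pos (hn : 1 ≤ n) {s : ℝ} (hs0 : 0 < s) (hs1 : s < 1) : 0 < cConst n s := by
  have h1 : (1 : ℝ) ≤ n := by exact_mod_cast hn
  exact div_pos (by linarith) (gammaConst_pos (by linarith) (by linarith))

end NonlocalEL

namespace NonlocalEL

variable {n : ℕ} {s p δ : ℝ} {w : Vec n → ℝ} {Ω : Set (Vec n)}

/-! ### Domains -/

lemma isOpen_outer (hΩ : IsOpen Ω) : IsOpen (outer δ Ω) := hΩ.add_right

lemma subset_outer (hδ : 0 < δ) : Ω ⊆ outer δ Ω := fun x hx =>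
  ⟨x, hx, 0, by simpa using hδ, add_zero x⟩

lemma add_mem_outer {x h : Vec n} (hx : x ∈ Ω) (hh : ‖h‖ < δ) : x + h ∈ outer δ Ω :=
  ⟨x, hx, h, by simpa using hh, rfl⟩

lemma sub_mem_outer {x h : Vec n} (hx : x ∈ Ω) (hh : ‖h‖ < δ) : x - h ∈ outer δ Ω := by
  rw [sub_eq_add_neg]; exact add_mem_outer hx (by simpa using hh)

lemma isBounded_outer (hΩ : Bornology.IsBounded Ω) : Bornology.IsBounded (outer δ Ω) :=
  hΩ.add Metric.isBounded_ball

lemma isFiniteMeasure_restrict (hΩ : Bornology.IsBounded Ω) :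
    IsFiniteMeasure (volume.restrict Ω) :=
  ⟨by rw [Measure.restrict_apply_univ]; exact hΩ.measure_lt_top⟩

lemma isOpen_shrunk (hΩ : IsOpen Ω) : IsOpen (shrunk δ Ω) :=
  hΩ.inter (isOpen_lt continuous_const (Metric.continuous_infDist_pt _))

lemma shrunk_subset : shrunk δ Ω ⊆ Ω := fun _ hx => hx.1

/-! ### The nonlocal gradient of smooth functions -/

lemma IsTest.univ {U : Set (Vec n)} {φ : Vec n → Vec n} (hφ : IsTest U φ) : IsTest Set.univ φ :=
  ⟨hφ.smooth, hφ.compact, Set.subset_univ _⟩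

lemma IsTest.add {U : Set (Vec n)} {φ ψ : Vec n → Vec n} (hφ : IsTest U φ) (hψ : IsTest U ψ) :
    IsTest U (φ + ψ) :=
  ⟨hφ.smooth.add hψ.smooth, hφ.compact.add hψ.compact,
    (tsupport_add φ ψ).trans (Set.union_subset hφ.support hψ.support)⟩

lemma IsTest.smul {U : Set (Vec n)} {φ : Vec n → Vec n} (hφ : IsTest U φ) (t : ℝ) :
    IsTest U (t • φ) :=
  ⟨contDiff_const.smul hφ.smooth, hφ.compact.smul_left (f := fun _ => t),
    (tsupport_smul_subset_right (fun _ => t) φ).trans hφ.support⟩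

lemma kdiff_const_mul (κ f : Vec n → ℝ) (t : ℝ) (x : Vec n) :
    kdiff κ (fun y => t * f y) x = t * kdiff κ f x := by
  simp only [kdiff, ← integral_const_mul]
  congr 1; ext h; ring

lemma smoothGrad_add (hn : 1 ≤ n) (hs1 : s < 1) (hw : IsCutoff δ w)
    {u v : Vec n → Vec n} (hu : IsTest Set.univ u) (hv : IsTest Set.univ v) :
    smoothGrad s δ w (u + v) = smoothGrad s δ w u + smoothGrad s δ w v := by
  funext x
  ext ij
  rw [Pi.add_apply, PiLp.add_apply, smoothGrad_apply hn hs1 hw (hu.add hv),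
    smoothGrad_apply hn hs1 hw hu, smoothGrad_apply hn hs1 hw hv, ← mul_add]
  congr 1
  obtain ⟨L, hL⟩ := exists_bddLip (hu.comp ij.1).1 (hu.comp ij.1).2
  obtain ⟨L', hL'⟩ := exists_bddLip (hv.comp ij.1).1 (hv.comp ij.1).2
  have hκ := isLevyKernel_vecKernel hn hs1 hw ij.2
  rw [kdiff, kdiff, kdiff, ← integral_add (hL.integrable (hu.comp ij.1).1.continuous.measurable hκ x)
    (hL'.integrable (hv.comp ij.1).1.continuous.measurable hκ x)]
  congr 1
  ext h
  simp only [Pi.add_apply, PiLp.add_apply]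
  ring

lemma smoothGrad_smul (hn : 1 ≤ n) (hs1 : s < 1) (hw : IsCutoff δ w)
    {u : Vec n → Vec n} (hu : IsTest Set.univ u) (t : ℝ) :
    smoothGrad s δ w (t • u) = t • smoothGrad s δ w u := by
  funext x
  ext ij
  rw [Pi.smul_apply, PiLp.smul_apply, smoothGrad_apply hn hs1 hw (hu.smul t),
    smoothGrad_apply hn hs1 hw hu, smul_eq_mul, mul_left_comm t]
  exact congrArg _ (kdiff_const_mul _ _ t x)

lemma measurable_smoothGrad (hn : 1 ≤ n) (hs1 : s < 1) (hw : IsCutoff δ w)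
    {u : Vec n → Vec n} (hu : IsTest Set.univ u) : Measurable (smoothGrad s δ w u) := by
  have : smoothGrad s δ w u = fun x => WithLp.toLp 2 fun ij : Fin n × Fin n =>
      cConst n s * kdiff (fun h => vecKernel s w h ij.2) (fun y => u y ij.1) x := by
    funext x; ext ij; exact smoothGrad_apply hn hs1 hw hu x ij
  rw [this]
  refine (WithLp.measurable_toLp 2 _).comp (measurable_pi_lambda _ fun ij => ?_)
  exact ((stronglyMeasurable_kdiff (hu.comp ij.1).1.continuous.measurable
    (isLevyKernel_vecKernel hn hs1 hw ij.2).meas).measurable).const_mul _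

lemma exists_norm_smoothGrad_le (hn : 1 ≤ n) (hs1 : s < 1) (hw : IsCutoff δ w)
    {u : Vec n → Vec n} (hu : IsTest Set.univ u) : ∃ C, ∀ x, ‖smoothGrad s δ w u x‖ ≤ C := by
  have key : ∀ ij : Fin n × Fin n, ∃ C, ∀ x, |smoothGrad s δ w u x ij| ≤ C := by
    intro ij
    obtain ⟨L, hL⟩ := exists_bddLip (hu.comp ij.1).1 (hu.comp ij.1).2
    refine ⟨|cConst n s| * (L * ∫ h, min 1 ‖h‖ * |vecKernel s w h ij.2|), fun x => ?_⟩
    rw [smoothGrad_apply hn hs1 hw hu, abs_mul]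
    exact mul_le_mul_of_nonneg_left
      (hL.abs_kdiff_le (isLevyKernel_vecKernel hn hs1 hw ij.2) x) (abs_nonneg _)
  choose C hC using key
  refine ⟨√(∑ ij, C ij ^ 2), fun x => ?_⟩
  rw [EuclideanSpace.norm_eq]
  refine Real.sqrt_le_sqrt (Finset.sum_le_sum fun ij _ => ?_)
  exact pow_le_pow_left₀ (norm_nonneg _) (hC ij x) 2

lemma memLp_smoothGrad (hn : 1 ≤ n) (hs1 : s < 1) (hw : IsCutoff δ w)
    (hΩb : Bornology.IsBounded Ω)
    {u : Vec n → Vec n} (hu : IsTest Set.univ u) (q : ℝ≥0∞) :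
    MemLp (smoothGrad s δ w u) q (volume.restrict Ω) := by
  have := isFiniteMeasure_restrict hΩb
  obtain ⟨C, hC⟩ := exists_norm_smoothGrad_le hn hs1 hw hu
  exact MemLp.of_bound (measurable_smoothGrad hn hs1 hw hu).aestronglyMeasurable C (ae_of_all _ hC)

lemma IsTest.memLp {U : Set (Vec n)} {φ : Vec n → Vec n} (hφ : IsTest U φ) (q : ℝ≥0∞)
    (μ : Measure (Vec n)) [IsFiniteMeasureOnCompacts μ] : MemLp φ q μ :=
  hφ.smooth.continuous.memLp_of_hasCompactSupport hφ.compact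

/-! ### Uniqueness of the nonlocal gradient -/

lemma tendsto_integral_mul_apply {ι : Type*} [Fintype ι] {μ : Measure (Vec n)}
    {F : ℕ → Vec n → EuclideanSpace ℝ ι} {G : Vec n → EuclideanSpace ℝ ι}
    (hF : ∀ k, Integrable (F k) μ) (hG : Integrable G μ)
    (hFG : Tendsto (fun k => eLpNorm (F k - G) 1 μ) atTop (𝓝 0))
    {b : Vec n → ℝ} (hb : Measurable b) {B : ℝ} (hB : ∀ x, |b x| ≤ B) (i : ι) :
    Tendsto (fun k => ∫ x, b x * F k x i ∂μ) atTop (𝓝 (∫ x, b x * G x i ∂μ)) := by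
  have hint : ∀ {H : Vec n → EuclideanSpace ℝ ι}, Integrable H μ →
      Integrable (fun x => b x * H x i) μ := fun hH =>
    (hH.eval_piLp i).bdd_mul hb.aestronglyMeasurable (ae_of_all _ fun x => hB x)
  refine tendsto_integral_of_L1 _ (hint hG).1 (Eventually.of_forall fun k => hint (hF k)) ?_
  have h2 : Tendsto (fun k => ENNReal.ofReal B * eLpNorm (F k - G) 1 μ) atTop (𝓝 0) := by
    simpa using ENNReal.Tendsto.const_mul hFG (Or.inr ENNReal.ofReal_ne_top)
  refine tendsto_of_tendsto_of_tendsto_of_le_of_le tendsto_const_nhds h2 (fun _ => zero_le)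
    fun k => ?_
  simp only
  rw [eLpNorm_one_eq_lintegral_enorm, ← lintegral_const_mul' _ _ ENNReal.ofReal_ne_top]
  refine lintegral_mono fun x => ?_
  rw [← mul_sub, enorm_mul]
  gcongr
  · rw [← ofReal_norm]; exact ENNReal.ofReal_le_ofReal (hB x)
  · rw [← ofReal_norm, ← ofReal_norm]
    apply ENNReal.ofReal_le_ofReal
    simpa using PiLp.norm_apply_le (F k x - G x) i

/-- Nonlocal gradients are nonlocal gradients in the sense of distributions. -/
lemma IsNonlocalGrad.integral_eq (hn : 1 ≤ n) (hs1 : s < 1) (hw : IsCutoff δ w)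
    (hΩb : Bornology.IsBounded Ω)
    {u : Vec n → Vec n} {U : Vec n → Mat n} (hU : IsNonlocalGrad s δ w Ω u U)
    {ψ : Vec n → ℝ} (hψ : ContDiff ℝ ∞ ψ) (hψc : HasCompactSupport ψ) (hψs : tsupport ψ ⊆ Ω)
    (ij : Fin n × Fin n) :
    ∫ x in Ω, ψ x * U x ij = ∫ x in outer δ Ω,
      (-cConst n s * kdiff (fun h => vecKernel s w h ij.2) ψ x) * u x ij.1 := by
  obtain ⟨hu, hUi, v, hv, hvu, hvU⟩ := hU
  obtain ⟨B, hB⟩ := hψ.continuous.bounded_above_of_compact_support hψc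
  obtain ⟨L, hL⟩ := exists_bddLip hψ hψc
  have hκ := isLevyKernel_vecKernel hn hs1 hw ij.2
  have l1 := tendsto_integral_mul_apply
    (fun k => memLp_one_iff_integrable.1 (memLp_smoothGrad hn hs1 hw hΩb (hv k) 1)) hUi hvU
    hψ.continuous.measurable hB ij
  have l2 := tendsto_integral_mul_apply
    (fun k => memLp_one_iff_integrable.1 ((hv k).memLp 1 (volume.restrict (outer δ Ω)))) hu hvu
    (b := fun x => -cConst n s * kdiff (fun h => vecKernel s w h ij.2) ψ x)
    ((stronglyMeasurable_kdiff hψ.continuous.measurable hκ.meas).measurable.const_mul _)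
    (B := |cConst n s| * (L * ∫ h, min 1 ‖h‖ * |vecKernel s w h ij.2|))
    (fun x => by
      rw [abs_mul, abs_neg]
      exact mul_le_mul_of_nonneg_left (hL.abs_kdiff_le hκ x) (abs_nonneg _)) ij.1
  refine tendsto_nhds_unique l1 (l2.congr fun k => ?_)
  obtain ⟨L', hL'⟩ := exists_bddLip ((hv k).comp ij.1).1 ((hv k).comp ij.1).2
  have e := BddLip.integral_mul_kdiff hκ hL' hL ((hv k).comp ij.1).1.continuous hψ.continuous
    ((hv k).comp ij.1).2 hψc
  have z : ∀ x, x ∉ Ω → ψ x = 0 := fun x hx =>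
    image_eq_zero_of_notMem_tsupport fun h => hx (hψs h)
  rw [setIntegral_eq_integral_of_forall_compl_eq_zero (s := outer δ Ω), Eq.comm,
    setIntegral_eq_integral_of_forall_compl_eq_zero (fun x hx => by rw [z x hx, zero_mul])]
  · simp_rw [smoothGrad_apply hn hs1 hw (hv k), mul_left_comm (ψ _), integral_const_mul, e,
      mul_assoc, integral_const_mul, neg_mul, mul_neg, mul_comm ((v k _).ofLp _)]
  · intro x hx
    have : kdiff (fun h => vecKernel s w h ij.2) ψ x = 0 := by
      rw [kdiff]
      refine integral_eq_zero_of_ae (ae_of_all _ fun h => ?_)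
      by_cases hh : δ ≤ ‖h‖
      · simp [vecKernel_eq_zero hw hh]
      · have hδ : 0 < δ := (norm_nonneg h).trans_lt (not_le.1 hh)
        have z1 := z x fun hx' => hx (subset_outer hδ hx')
        have z2 := z (x - h) fun hx' => hx (by simpa using add_mem_outer hx' (not_le.1 hh))
        simp [z1, z2]
    simp [this]

/-- The nonlocal gradient is unique: it is determined by its integrals against test functions. -/
lemma IsNonlocalGrad.ae_eq (hn : 1 ≤ n) (hs1 : s < 1) (hw : IsCutoff δ w) (hΩo : IsOpen Ω)
    (hΩb : Bornology.IsBounded Ω)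
    {u : Vec n → Vec n} {U U' : Vec n → Mat n} (hU : IsNonlocalGrad s δ w Ω u U)
    (hU' : IsNonlocalGrad s δ w Ω u U') : U =ᵐ[volume.restrict Ω] U' := by
  have key : ∀ ij : Fin n × Fin n, ∀ᵐ x ∂volume, x ∈ Ω → U x ij - U' x ij = 0 := by
    intro ij
    have i1 := hU.2.1.eval_piLp ij
    have i2 := hU'.2.1.eval_piLp ij
    refine hΩo.ae_eq_zero_of_integral_contDiff_smul_eq_zero
      (IntegrableOn.locallyIntegrableOn (i1.sub i2)) fun ψ hψ hψc hψs => ?_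
    obtain ⟨B, hB⟩ := hψ.continuous.bounded_above_of_compact_support hψc
    have z : ∀ x, x ∉ Ω → ψ x = 0 := fun x hx =>
      image_eq_zero_of_notMem_tsupport fun h => hx (hψs h)
    rw [← setIntegral_eq_integral_of_forall_compl_eq_zero (s := Ω)
      (fun x hx => by rw [z x hx, zero_smul])]
    simp only [smul_eq_mul, mul_sub]
    rw [integral_sub, hU.integral_eq hn hs1 hw hΩb hψ hψc hψs ij,
      hU'.integral_eq hn hs1 hw hΩb hψ hψc hψs ij, sub_self]
    · exact i1.bdd_mul hψ.continuous.aestronglyMeasurable (ae_of_all _ hB)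
    · exact i2.bdd_mul hψ.continuous.aestronglyMeasurable (ae_of_all _ hB)
  rw [EventuallyEq, ae_restrict_iff' hΩo.measurableSet]
  filter_upwards [ae_all_iff.2 key] with x hx hxΩ
  ext ij
  exact sub_eq_zero.1 (hx ij hxΩ)

lemma IsNonlocalGrad.isNonlocalGrad_nonlocalGrad {u : Vec n → Vec n} {U : Vec n → Mat n}
    (hU : IsNonlocalGrad s δ w Ω u U) : IsNonlocalGrad s δ w Ω u (nonlocalGrad s δ w Ω u) := by
  have h : ∃ U, IsNonlocalGrad s δ w Ω u U := ⟨U, hU⟩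
  rw [nonlocalGrad, dif_pos h]
  exact h.choose_spec

lemma IsNonlocalGrad.nonlocalGrad_ae_eq (hn : 1 ≤ n) (hs1 : s < 1) (hw : IsCutoff δ w)
    (hΩo : IsOpen Ω) (hΩb : Bornology.IsBounded Ω)
    {u : Vec n → Vec n} {U : Vec n → Mat n} (hU : IsNonlocalGrad s δ w Ω u U) :
    nonlocalGrad s δ w Ω u =ᵐ[volume.restrict Ω] U :=
  hU.isNonlocalGrad_nonlocalGrad.ae_eq hn hs1 hw hΩo hΩb hU

lemma tendsto_eLpNorm_add {F : Type*} [NormedAddCommGroup F] {q : ℝ≥0∞} (hq : 1 ≤ q)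
    {μ : Measure (Vec n)}
    {f f' : ℕ → Vec n → F} {g g' : Vec n → F} (hf : ∀ k, AEStronglyMeasurable (f k) μ)
    (hf' : ∀ k, AEStronglyMeasurable (f' k) μ) (hg : AEStronglyMeasurable g μ)
    (hg' : AEStronglyMeasurable g' μ)
    (h : Tendsto (fun k => eLpNorm (f k - g) q μ) atTop (𝓝 0))
    (h' : Tendsto (fun k => eLpNorm (f' k - g') q μ) atTop (𝓝 0)) :
    Tendsto (fun k => eLpNorm (f k + f' k - (g + g')) q μ) atTop (𝓝 0) := by
  have h2 := h.add h'
  rw [add_zero] at h2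
  refine tendsto_of_tendsto_of_tendsto_of_le_of_le tendsto_const_nhds h2 (fun _ => zero_le)
    fun k => ?_
  simp only
  rw [add_sub_add_comm]
  exact eLpNorm_add_le ((hf k).sub hg) ((hf' k).sub hg') hq

lemma IsNonlocalGrad.add (hn : 1 ≤ n) (hs1 : s < 1) (hw : IsCutoff δ w)
    {u u' : Vec n → Vec n} {U U' : Vec n → Mat n} (hU : IsNonlocalGrad s δ w Ω u U)
    (hU' : IsNonlocalGrad s δ w Ω u' U') : IsNonlocalGrad s δ w Ω (u + u') (U + U') := by
  obtain ⟨hu, hUi, v, hv, hvu, hvU⟩ := hU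
  obtain ⟨hu', hUi', v', hv', hvu', hvU'⟩ := hU'
  have hm : ∀ {v : ℕ → Vec n → Vec n}, (∀ k, IsTest Set.univ (v k)) → ∀ (μ : Measure (Vec n)) k,
      AEStronglyMeasurable (v k) μ := fun hv μ k => (hv k).smooth.continuous.aestronglyMeasurable
  refine ⟨hu.add hu', hUi.add hUi', fun k => v k + v' k, fun k => (hv k).add (hv' k),
    tendsto_eLpNorm_add le_rfl (hm hv _) (hm hv' _) hu.1 hu'.1 hvu hvu', ?_⟩
  simp_rw [smoothGrad_add hn hs1 hw (hv _) (hv' _)]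
  exact tendsto_eLpNorm_add le_rfl
    (fun k => (measurable_smoothGrad hn hs1 hw (hv k)).aestronglyMeasurable)
    (fun k => (measurable_smoothGrad hn hs1 hw (hv' k)).aestronglyMeasurable) hUi.1 hUi'.1 hvU hvU'

/-! ### The spaces `H` and `H₀` -/

lemma tendsto_eLpNorm_one {F : Type*} [NormedAddCommGroup F] (hp : 1 < p)
    {μ : Measure (Vec n)} [IsFiniteMeasure μ] {f : ℕ → Vec n → F}
    (hf : ∀ k, AEStronglyMeasurable (f k) μ)
    (h : Tendsto (fun k => eLpNorm (f k) (ENNReal.ofReal p) μ) atTop (𝓝 0)) :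
    Tendsto (fun k => eLpNorm (f k) 1 μ) atTop (𝓝 0) := by
  set C := μ Set.univ ^ (1 / (1 : ℝ≥0∞).toReal - 1 / (ENNReal.ofReal p).toReal) with hC
  have hCt : C ≠ ⊤ := by
    refine ENNReal.rpow_ne_top_of_nonneg ?_ (measure_ne_top _ _)
    rw [ENNReal.toReal_ofReal (by linarith), ENNReal.toReal_one, sub_nonneg]
    exact one_div_le_one_div_of_le one_pos hp.le
  have h2 : Tendsto (fun k => eLpNorm (f k) (ENNReal.ofReal p) μ * C) atTop (𝓝 0) := by
    simpa using ENNReal.Tendsto.mul_const h (Or.inr hCt)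
  refine tendsto_of_tendsto_of_tendsto_of_le_of_le tendsto_const_nhds h2 (fun _ => zero_le)
    fun k => ?_
  exact eLpNorm_le_eLpNorm_mul_rpow_measure_univ (by simpa using hp.le) (hf k)

lemma one_le_ofReal (hp : 1 < p) : 1 ≤ ENNReal.ofReal p := by simpa using hp.le

lemma MemH.isNonlocalGrad (hn : 1 ≤ n) (hs1 : s < 1) (hw : IsCutoff δ w)
    (hΩb : Bornology.IsBounded Ω) (hp : 1 < p) {u : Vec n → Vec n} (hu : MemH s p δ w Ω u) :
    IsNonlocalGrad s δ w Ω u (nonlocalGrad s δ w Ω u) := by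
  obtain ⟨h1, h2, v, hv, h3, h4⟩ := hu
  have := isFiniteMeasure_restrict hΩb
  have := isFiniteMeasure_restrict (isBounded_outer (δ := δ) hΩb)
  refine ⟨h1.integrable (one_le_ofReal hp), h2.integrable (one_le_ofReal hp), v, hv,
    tendsto_eLpNorm_one hp (fun k => ?_) h3, tendsto_eLpNorm_one hp (fun k => ?_) h4⟩
  · exact (hv k).smooth.continuous.aestronglyMeasurable.sub h1.1
  · exact (measurable_smoothGrad hn hs1 hw (hv k)).aestronglyMeasurable.sub h2.1

lemma MemH.nonlocalGrad_add (hn : 1 ≤ n) (hs1 : s < 1) (hw : IsCutoff δ w)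
    (hΩo : IsOpen Ω) (hΩb : Bornology.IsBounded Ω) (hp : 1 < p) {u u' : Vec n → Vec n}
    (hu : MemH s p δ w Ω u) (hu' : MemH s p δ w Ω u') :
    nonlocalGrad s δ w Ω (u + u') =ᵐ[volume.restrict Ω]
      nonlocalGrad s δ w Ω u + nonlocalGrad s δ w Ω u' :=
  ((hu.isNonlocalGrad hn hs1 hw hΩb hp).add hn hs1 hw
    (hu'.isNonlocalGrad hn hs1 hw hΩb hp)).nonlocalGrad_ae_eq hn hs1 hw hΩo hΩb

lemma MemH.tendstoH_add (hn : 1 ≤ n) (hs1 : s < 1) (hw : IsCutoff δ w)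
    (hΩo : IsOpen Ω) (hΩb : Bornology.IsBounded Ω) (hp : 1 < p) {u u' : Vec n → Vec n}
    (hu : MemH s p δ w Ω u) (hu' : MemH s p δ w Ω u') {v v' : ℕ → Vec n → Vec n}
    (hv : ∀ j, IsTest Set.univ (v j)) (hv' : ∀ j, IsTest Set.univ (v' j))
    (h : TendstoH s p δ w Ω v u) (h' : TendstoH s p δ w Ω v' u') :
    TendstoH s p δ w Ω (fun j => v j + v' j) (u + u') := by
  refine ⟨tendsto_eLpNorm_add (one_le_ofReal hp)
    (fun k => (hv k).smooth.continuous.aestronglyMeasurable)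
    (fun k => (hv' k).smooth.continuous.aestronglyMeasurable) hu.1.1 hu'.1.1 h.1 h'.1, ?_⟩
  have e := hu.nonlocalGrad_add hn hs1 hw hΩo hΩb hp hu'
  refine (tendsto_eLpNorm_add (one_le_ofReal hp)
    (fun k => (measurable_smoothGrad hn hs1 hw (hv k)).aestronglyMeasurable)
    (fun k => (measurable_smoothGrad hn hs1 hw (hv' k)).aestronglyMeasurable)
    hu.2.1.1 hu'.2.1.1 h.2 h'.2).congr fun k => ?_
  rw [smoothGrad_add hn hs1 hw (hv k) (hv' k)]
  refine eLpNorm_congr_ae ?_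
  filter_upwards [e] with x hx
  simp only [Pi.sub_apply, hx]

lemma MemH.add (hn : 1 ≤ n) (hs1 : s < 1) (hw : IsCutoff δ w)
    (hΩo : IsOpen Ω) (hΩb : Bornology.IsBounded Ω) (hp : 1 < p) {u u' : Vec n → Vec n}
    (hu : MemH s p δ w Ω u) (hu' : MemH s p δ w Ω u') : MemH s p δ w Ω (u + u') := by
  obtain ⟨v, hv, h⟩ := hu.2.2
  obtain ⟨v', hv', h'⟩ := hu'.2.2
  exact ⟨hu.1.add hu'.1,
    (hu.2.1.add hu'.2.1).ae_eq (hu.nonlocalGrad_add hn hs1 hw hΩo hΩb hp hu').symm,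
    fun j => v j + v' j, fun j => (hv j).add (hv' j),
    hu.tendstoH_add hn hs1 hw hΩo hΩb hp hu' hv hv' h h'⟩

lemma MemH0.add (hn : 1 ≤ n) (hs1 : s < 1) (hw : IsCutoff δ w)
    (hΩo : IsOpen Ω) (hΩb : Bornology.IsBounded Ω) (hp : 1 < p) {u u' : Vec n → Vec n}
    (hu : MemH0 s p δ w Ω u) (hu' : MemH0 s p δ w Ω u') : MemH0 s p δ w Ω (u + u') := by
  obtain ⟨v, hv, h⟩ := hu.2
  obtain ⟨v', hv', h'⟩ := hu'.2
  exact ⟨hu.1.add hn hs1 hw hΩo hΩb hp hu'.1, fun j => v j + v' j, fun j => (hv j).add (hv' j),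
    hu.1.tendstoH_add hn hs1 hw hΩo hΩb hp hu'.1 (fun j => (hv j).univ) (fun j => (hv' j).univ)
      h h'⟩

lemma IsTest.nonlocalGrad_ae_eq (hn : 1 ≤ n) (hs1 : s < 1) (hw : IsCutoff δ w)
    (hΩo : IsOpen Ω) (hΩb : Bornology.IsBounded Ω) {φ : Vec n → Vec n}
    (hφ : IsTest Set.univ φ) :
    nonlocalGrad s δ w Ω φ =ᵐ[volume.restrict Ω] smoothGrad s δ w φ := by
  have : IsNonlocalGrad s δ w Ω φ (smoothGrad s δ w φ) :=
    ⟨memLp_one_iff_integrable.1 (hφ.memLp 1 _),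
      memLp_one_iff_integrable.1 (memLp_smoothGrad hn hs1 hw hΩb hφ 1), fun _ => φ, fun _ => hφ,
      by simp, by simp⟩
  exact this.nonlocalGrad_ae_eq hn hs1 hw hΩo hΩb

lemma IsTest.memH0 (hn : 1 ≤ n) (hs1 : s < 1) (hw : IsCutoff δ w)
    (hΩo : IsOpen Ω) (hΩb : Bornology.IsBounded Ω) {φ : Vec n → Vec n}
    (hφ : IsTest (shrunk δ Ω) φ) : MemH0 s p δ w Ω φ := by
  have e := hφ.univ.nonlocalGrad_ae_eq hn hs1 hw hΩo hΩb
  have t : TendstoH s p δ w Ω (fun _ => φ) φ := by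
    refine ⟨by simp, ?_⟩
    have : eLpNorm (smoothGrad s δ w φ - nonlocalGrad s δ w Ω φ) (ENNReal.ofReal p)
        (volume.restrict Ω) = 0 := by
      rw [eLpNorm_congr_ae (g := 0), eLpNorm_zero]
      filter_upwards [e] with x hx
      simp [hx]
    simp [this]
  exact ⟨⟨hφ.memLp _ _, (memLp_smoothGrad hn hs1 hw hΩb hφ.univ _).ae_eq e.symm,
    fun _ => φ, fun _ => hφ.univ, t⟩, fun _ => φ, fun _ => hφ, t⟩

/-- Functions of `H₀` vanish outside `Ω_{-δ}`. -/
lemma MemH0.ae_eq_zero (hp : 1 < p) {u : Vec n → Vec n}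
    (hu : MemH0 s p δ w Ω u) :
    ∀ᵐ x ∂(volume.restrict (outer δ Ω)), x ∉ shrunk δ Ω → u x = 0 := by
  obtain ⟨⟨h1, -⟩, v, hv, h, -⟩ := hu
  obtain ⟨ns, -, hns⟩ := (tendstoInMeasure_of_tendsto_eLpNorm (by simpa using by linarith)
    (fun k => (hv k).smooth.continuous.aestronglyMeasurable) h1.1 h).exists_seq_tendsto_ae
  filter_upwards [hns] with x hx hxs
  refine tendsto_nhds_unique hx (tendsto_const_nhds.congr fun k => ?_)
  exact (image_eq_zero_of_notMem_tsupport fun h => hxs ((hv _).support h)).symm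

end NonlocalEL

namespace NonlocalEL

variable {n : ℕ}

/-! ### Gaussian integrals -/

/-- The plane wave `h ↦ exp(2πi ξ·h)`. -/
noncomputable def wave (ξ h : Vec n) : ℂ :=
  Complex.exp (((2 * Real.pi * inner ℝ h ξ : ℝ) : ℂ) * Complex.I)

lemma norm_wave (ξ h : Vec n) : ‖wave ξ h‖ = 1 := Complex.norm_exp_ofReal_mul_I _

lemma wave_add (ξ x h : Vec n) : wave ξ (x + h) = wave ξ x * wave ξ h := by
  rw [wave, wave, wave, ← Complex.exp_add, inner_add_left]
  congr 1; push_cast; ring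

lemma wave_sub (ξ x h : Vec n) : wave ξ (x - h) = wave ξ x * wave ξ (-h) := by
  rw [sub_eq_add_neg, wave_add]

@[fun_prop]
lemma continuous_wave : Continuous fun q : Vec n × Vec n => wave q.1 q.2 := by
  unfold wave; fun_prop

lemma continuous_wave_right (ξ : Vec n) : Continuous (wave ξ) := by
  unfold wave; fun_prop

lemma norm_one_sub_wave_le (ξ h : Vec n) :
    ‖1 - wave ξ h‖ ≤ (2 + 2 * Real.pi * ‖ξ‖) * min 1 ‖h‖ := by
  have hp := Real.pi_pos
  rcases le_total 1 ‖h‖ with h1 | h1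
  · rw [min_eq_left h1, mul_one]
    have : ‖1 - wave ξ h‖ ≤ 2 := by
      refine (norm_sub_le _ _).trans ?_
      rw [norm_wave, norm_one]; norm_num
    have : 0 ≤ 2 * Real.pi * ‖ξ‖ := by positivity
    linarith
  · rw [min_eq_right h1, norm_sub_rev, wave, mul_comm]
    refine (Real.norm_exp_I_mul_ofReal_sub_one_le).trans ?_
    rw [Real.norm_eq_abs, abs_mul, abs_of_pos (by positivity)]
    have := abs_real_inner_le_norm h ξ
    calc 2 * Real.pi * |inner ℝ h ξ| ≤ 2 * Real.pi * (‖h‖ * ‖ξ‖) := by gcongr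
      _ = (2 * Real.pi * ‖ξ‖) * ‖h‖ := by ring
      _ ≤ _ := by gcongr; linarith

lemma integrable_gaussian {b : ℝ} (hb : 0 < b) :
    Integrable fun h : Vec n => Real.exp (-b * ‖h‖ ^ 2) := by
  have := (GaussianFourier.integrable_cexp_neg_mul_sq_norm_add (b := (b : ℂ))
    (by simpa using hb) 0 (0 : Vec n)).norm
  refine this.congr (ae_of_all _ fun h => ?_)
  simp only [Complex.norm_exp]
  congr 1
  norm_cast
  simp

lemma integrable_norm_mul_gaussian {b : ℝ} (hb : 0 < b) :
    Integrable fun h : Vec n => ‖h‖ * Real.exp (-b * ‖h‖ ^ 2) := by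
  refine ((integrable_gaussian (n := n) (half_pos hb)).const_mul (1 + 2 / b)).mono'
    (Continuous.aestronglyMeasurable (by fun_prop)) (ae_of_all _ fun h => ?_)
  rw [Real.norm_of_nonneg (by positivity)]
  have h1 : ‖h‖ ≤ 1 + ‖h‖ ^ 2 := by nlinarith [sq_nonneg (‖h‖ - 1)]
  have h2 := Real.add_one_le_exp (b / 2 * ‖h‖ ^ 2)
  have h3 : 1 ≤ Real.exp (b / 2 * ‖h‖ ^ 2) := Real.one_le_exp (by positivity)
  have h4 : ‖h‖ ≤ (1 + 2 / b) * Real.exp (b / 2 * ‖h‖ ^ 2) := by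
    have : ‖h‖ ^ 2 = 2 / b * (b / 2 * ‖h‖ ^ 2) := by field_simp
    have h5 : 2 / b * (b / 2 * ‖h‖ ^ 2) ≤ 2 / b * Real.exp (b / 2 * ‖h‖ ^ 2) :=
      mul_le_mul_of_nonneg_left (by linarith) (by positivity)
    linarith
  calc ‖h‖ * Real.exp (-b * ‖h‖ ^ 2)
      ≤ (1 + 2 / b) * Real.exp (b / 2 * ‖h‖ ^ 2) * Real.exp (-b * ‖h‖ ^ 2) := by gcongr
    _ = _ := by rw [mul_assoc, ← Real.exp_add]; congr 2; ring

lemma integrable_apply_mul_gaussian {b : ℝ} (hb : 0 < b) (j : Fin n) :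
    Integrable fun h : Vec n => h j * Real.exp (-b * ‖h‖ ^ 2) := by
  refine (integrable_norm_mul_gaussian hb).mono' (Continuous.aestronglyMeasurable (by fun_prop))
    (ae_of_all _ fun h => ?_)
  rw [norm_mul, Real.norm_of_nonneg (Real.exp_pos _).le]
  exact mul_le_mul_of_nonneg_right (PiLp.norm_apply_le h j) (Real.exp_pos _).le

lemma integral_gaussian_mul_wave {b : ℝ} (hb : 0 < b) (ξ : Vec n) :
    ∫ h : Vec n, (Real.exp (-b * ‖h‖ ^ 2) : ℂ) * wave ξ (-h) =
      (((Real.pi / b) ^ ((n : ℝ) / 2) * Real.exp (-(Real.pi ^ 2 * ‖ξ‖ ^ 2) / b) : ℝ) : ℂ) := by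
  have := fourier_gaussian_innerProductSpace (V := Vec n) (b := (b : ℂ)) (by simpa using hb) ξ
  rw [Real.fourier_eq'] at this
  rw [show (∫ h : Vec n, (Real.exp (-b * ‖h‖ ^ 2) : ℂ) * wave ξ (-h)) =
    ∫ v : Vec n, Complex.exp (((-2 * Real.pi * inner ℝ v ξ : ℝ) : ℂ) * Complex.I) •
      Complex.exp (-(b : ℂ) * ‖v‖ ^ 2) from ?_, this]
  · rw [finrank_euclideanSpace_fin]
    push_cast
    rw [Complex.ofReal_cpow (by have := Real.pi_pos; positivity)]
    push_cast
    congr 2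
    ring
  · congr 1
    ext h
    rw [wave, smul_eq_mul, mul_comm, inner_neg_left]
    push_cast
    congr 2
    ring

/-- The Fourier transform of `h_j exp(-b |h|²)`. -/
lemma integral_apply_mul_gaussian_mul_wave {b : ℝ} (hb : 0 < b) (ξ : Vec n) (j : Fin n) :
    ∫ h : Vec n, ((h j * Real.exp (-b * ‖h‖ ^ 2) : ℝ) : ℂ) * wave ξ (-h) =
      -Complex.I * ((ξ j * ((Real.pi / b) ^ ((n : ℝ) / 2 + 1) *
        Real.exp (-(Real.pi ^ 2 * ‖ξ‖ ^ 2) / b)) : ℝ) : ℂ) := by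
  set g : Vec n → ℂ := fun h => (Real.exp (-b * ‖h‖ ^ 2) : ℂ) * wave ξ (-h) with hg
  have hd : ∀ h : Vec n, HasLineDerivAt ℝ g
      ((-2 * b : ℂ) * (((h j * Real.exp (-b * ‖h‖ ^ 2) : ℝ) : ℂ) * wave ξ (-h))
        - 2 * Real.pi * Complex.I * (ξ j) * g h) h (EuclideanSpace.single j 1) := by
    intro h
    have e1 : HasDerivAt (fun t : ℝ => ‖h + t • EuclideanSpace.single j (1 : ℝ)‖ ^ 2)
        (2 * h j) 0 := by
      have hc : HasDerivAt (fun t : ℝ => h + t • EuclideanSpace.single j (1 : ℝ))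
          (EuclideanSpace.single j (1 : ℝ)) 0 := by
        simpa using ((hasDerivAt_id (0 : ℝ)).smul_const (EuclideanSpace.single j (1 : ℝ))).const_add h
      have := hc.norm_sq
      simpa [EuclideanSpace.inner_single_right] using this
    have e2 : HasDerivAt (fun t : ℝ => inner ℝ (-(h + t • EuclideanSpace.single j (1 : ℝ))) ξ)
        (-(ξ j)) 0 := by
      have : (fun t : ℝ => inner ℝ (-(h + t • EuclideanSpace.single j (1 : ℝ))) ξ)
          = fun t : ℝ => -(inner ℝ h ξ) + -(t * ξ j) := by
        funext t
        simp [inner_add_left, inner_smul_left, EuclideanSpace.inner_single_left]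
        ring
      rw [this]
      simpa using ((hasDerivAt_id (0 : ℝ)).mul_const (ξ j)).neg.const_add (-(inner ℝ h ξ))
    have e3 := ((e1.const_mul (-b)).exp).ofReal_comp
    have e4 := (((e2.const_mul (2 * Real.pi)).ofReal_comp).mul_const Complex.I).cexp
    have e5 := e3.mul e4
    unfold HasLineDerivAt
    convert! e5 using 1
    simp only [hg, wave, zero_smul, add_zero]
    push_cast
    ring
  have i1 : Integrable g := by
    refine (integrable_gaussian (n := n) hb).mono'
      (Continuous.aestronglyMeasurable ?_) (ae_of_all _ fun h => ?_)
    · have := continuous_wave_right ξ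
      fun_prop
    · rw [norm_mul, norm_wave, mul_one, Complex.norm_real, Real.norm_of_nonneg (Real.exp_pos _).le]
  have i2 : Integrable fun h : Vec n => ((h j * Real.exp (-b * ‖h‖ ^ 2) : ℝ) : ℂ) * wave ξ (-h) := by
    refine (integrable_apply_mul_gaussian hb j).norm.mono'
      (Continuous.aestronglyMeasurable ?_) (ae_of_all _ fun h => ?_)
    · have := continuous_wave_right ξ
      fun_prop
    · rw [norm_mul, norm_wave, mul_one, Complex.norm_real]
  have key := integral_bilinear_hasLineDerivAt_right_eq_neg_left_of_integrable
    (μ := (volume : Measure (Vec n))) (f := fun _ => (1 : ℂ)) (f' := fun _ => 0) (g := g)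
    (B := ContinuousLinearMap.mul ℝ ℂ) (v := EuclideanSpace.single j (1 : ℝ))
    (g' := fun h => (-2 * b : ℂ) * (((h j * Real.exp (-b * ‖h‖ ^ 2) : ℝ) : ℂ) * wave ξ (-h))
        - 2 * Real.pi * Complex.I * (ξ j) * g h)
    (by simp)
    (((i2.const_mul (-2 * b : ℂ)).sub (i1.const_mul (2 * Real.pi * Complex.I * (ξ j)))).congr
      (ae_of_all _ fun h => by simp only [Pi.sub_apply, ContinuousLinearMap.mul_apply', one_mul]))
    (by simpa using i1)
    (fun x _ => by simpa using! (hasDerivAt_const (0 : ℝ) (1 : ℂ))) (fun x _ => hd x)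
  simp only [ContinuousLinearMap.mul_apply', one_mul, zero_mul, integral_zero, neg_zero] at key
  rw [integral_sub (i2.const_mul _) (i1.const_mul _), integral_const_mul, integral_const_mul,
    hg, integral_gaussian_mul_wave hb] at key
  have hb' : (b : ℂ) ≠ 0 := by exact_mod_cast hb.ne'
  have hpb : 0 < Real.pi / b := div_pos Real.pi_pos hb
  rw [Real.rpow_add_one hpb.ne']
  have : (-2 * b : ℂ) ≠ 0 := by simpa using hb.ne'
  refine mul_left_cancel₀ this ?_
  rw [sub_eq_zero.1 key]
  push_cast
  field_simp

/-! ### Riesz kernels as mixtures of Gaussians -/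

/-- A power of `A` as a superposition of exponentials; for `A = ‖h‖²` these are Gaussians. -/
lemma integral_gamma_mixture {c A : ℝ} (hc : 0 < c) (hA : 0 < A) :
    IntegrableOn (fun t : ℝ => t ^ (c - 1) * Real.exp (-(A * t))) (Set.Ioi 0) ∧
      ∫ t in Set.Ioi (0 : ℝ), t ^ (c - 1) * Real.exp (-(A * t)) = Real.Gamma c * A ^ (-c) := by
  constructor
  · have := integrableOn_rpow_mul_exp_neg_mul_rpow (p := 1) (s := c - 1) (b := A) (by linarith)
      one_pos hA
    simpa using this
  · rw [Real.integral_rpow_mul_exp_neg_mul_Ioi hc hA, one_div, Real.inv_rpow hA.le,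
      Real.rpow_neg hA.le, mul_comm]

/-- `integral_gamma_mixture` after the substitution `t ↦ 1/t`, as needed for the transforms of the
Gaussians. -/
lemma integral_gamma_mixture_inv {c A : ℝ} (hc : 0 < c) (hA : 0 < A) :
    IntegrableOn (fun t : ℝ => t ^ (-c - 1) * Real.exp (-A / t)) (Set.Ioi 0) ∧
      ∫ t in Set.Ioi (0 : ℝ), t ^ (-c - 1) * Real.exp (-A / t) = Real.Gamma c * A ^ (-c) := by
  obtain ⟨h1, h2⟩ := integral_gamma_mixture hc hA
  have e : ∀ t ∈ Set.Ioi (0 : ℝ), (|(-1 : ℝ)| * t ^ ((-1 : ℝ) - 1)) •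
      ((t ^ (-1 : ℝ)) ^ (c - 1) * Real.exp (-(A * t ^ (-1 : ℝ)))) =
      t ^ (-c - 1) * Real.exp (-A / t) := by
    intro t ht
    have ht : 0 < t := ht
    rw [← Real.rpow_mul ht.le, abs_neg, abs_one, one_mul, smul_eq_mul, ← mul_assoc,
      ← Real.rpow_add ht]
    congr 2
    · ring
    · rw [Real.rpow_neg_one]; ring
  constructor
  · rw [← integrableOn_Ioi_comp_rpow_iff _ (p := -1) (by norm_num)] at h1
    exact h1.congr_fun e measurableSet_Ioi
  · rw [← h2, ← integral_comp_rpow_Ioi (fun t : ℝ => t ^ (c - 1) * Real.exp (-(A * t)))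
      (p := -1) (by norm_num)]
    exact (setIntegral_congr_fun measurableSet_Ioi e).symm

/-- The `j`-th component of the kernel `h / |h|^{n+1+q}`. -/
noncomputable def riesz (q : ℝ) (j : Fin n) (h : Vec n) : ℝ := ‖h‖ ^ (-((n : ℝ) + 1 + q)) * h j

@[fun_prop]
lemma measurable_riesz (q : ℝ) (j : Fin n) : Measurable (riesz q j) := by
  unfold riesz; fun_prop

lemma riesz_neg (q : ℝ) (j : Fin n) (h : Vec n) : riesz q j (-h) = -riesz q j h := by
  simp [riesz]

lemma abs_riesz_le (q : ℝ) (j : Fin n) {h : Vec n} (hh : h ≠ 0) :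
    |riesz q j h| ≤ ‖h‖ ^ (-((n : ℝ) + q)) := by
  have h0 : 0 < ‖h‖ := norm_pos_iff.2 hh
  rw [riesz, abs_mul, abs_of_nonneg (Real.rpow_nonneg h0.le _)]
  calc ‖h‖ ^ (-((n : ℝ) + 1 + q)) * |h j| ≤ ‖h‖ ^ (-((n : ℝ) + 1 + q)) * ‖h‖ ^ (1 : ℝ) := by
        rw [Real.rpow_one]
        exact mul_le_mul_of_nonneg_left (PiLp.norm_apply_le h j) (Real.rpow_nonneg h0.le _)
    _ = _ := by rw [← Real.rpow_add h0]; congr 1; ring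

lemma riesz_eq_mixture {q : ℝ} (hq : -1 < q) (j : Fin n) {h : Vec n} (hh : h ≠ 0) :
    IntegrableOn (fun t : ℝ => t ^ (((n : ℝ) + 1 + q) / 2 - 1) *
        (h j * Real.exp (-t * ‖h‖ ^ 2))) (Set.Ioi 0) ∧
    ∫ t in Set.Ioi (0 : ℝ), t ^ (((n : ℝ) + 1 + q) / 2 - 1) * (h j * Real.exp (-t * ‖h‖ ^ 2)) =
      Real.Gamma (((n : ℝ) + 1 + q) / 2) * riesz q j h := by
  have h0 : 0 < ‖h‖ := norm_pos_iff.2 hh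
  have hn : (0 : ℝ) ≤ n := n.cast_nonneg
  obtain ⟨h1, h2⟩ := integral_gamma_mixture (c := ((n : ℝ) + 1 + q) / 2) (A := ‖h‖ ^ 2)
    (by linarith) (by positivity)
  have e : ∀ t : ℝ, t ^ (((n : ℝ) + 1 + q) / 2 - 1) * (h j * Real.exp (-t * ‖h‖ ^ 2)) =
      h j * (t ^ (((n : ℝ) + 1 + q) / 2 - 1) * Real.exp (-(‖h‖ ^ 2 * t))) := by
    intro t; rw [show -t * ‖h‖ ^ 2 = -(‖h‖ ^ 2 * t) by ring]; ring
  simp_rw [e]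
  refine ⟨h1.const_mul _, ?_⟩
  rw [integral_const_mul, h2, riesz, ← Real.rpow_natCast, ← Real.rpow_mul h0.le]
  rw [show ((2 : ℕ) : ℝ) * -(((n : ℝ) + 1 + q) / 2) = -((n : ℝ) + 1 + q) by push_cast; ring]
  ring

/-- The value of the mixture of the Fourier transforms of the Gaussians that make up a Riesz
kernel. -/
noncomputable def symbol (n : ℕ) (q : ℝ) (r : ℝ) : ℝ :=
  Real.pi ^ ((n : ℝ) / 2 + 1) * (Real.Gamma ((1 - q) / 2) * (Real.pi ^ 2 * r ^ 2) ^ (-((1 - q) / 2)))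

lemma symbol_eq_mixture {q : ℝ} (hq : q < 1) {r : ℝ} (hr : 0 < r) :
    IntegrableOn (fun t : ℝ => t ^ (((n : ℝ) + 1 + q) / 2 - 1) *
        ((Real.pi / t) ^ ((n : ℝ) / 2 + 1) * Real.exp (-(Real.pi ^ 2 * r ^ 2) / t))) (Set.Ioi 0) ∧
    ∫ t in Set.Ioi (0 : ℝ), t ^ (((n : ℝ) + 1 + q) / 2 - 1) *
        ((Real.pi / t) ^ ((n : ℝ) / 2 + 1) * Real.exp (-(Real.pi ^ 2 * r ^ 2) / t)) =
      symbol n q r := by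
  have hp := Real.pi_pos
  obtain ⟨h1, h2⟩ := integral_gamma_mixture_inv (c := (1 - q) / 2) (A := Real.pi ^ 2 * r ^ 2)
    (by linarith) (by positivity)
  have e : ∀ t ∈ Set.Ioi (0 : ℝ), Real.pi ^ ((n : ℝ) / 2 + 1) *
      (t ^ (-((1 - q) / 2) - 1) * Real.exp (-(Real.pi ^ 2 * r ^ 2) / t)) =
      t ^ (((n : ℝ) + 1 + q) / 2 - 1) *
        ((Real.pi / t) ^ ((n : ℝ) / 2 + 1) * Real.exp (-(Real.pi ^ 2 * r ^ 2) / t)) := by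
    intro t ht
    have ht : 0 < t := ht
    rw [Real.div_rpow hp.le ht.le, div_eq_mul_inv (Real.pi ^ _), ← Real.rpow_neg ht.le]
    rw [show -((1 - q) / 2) - 1 = (((n : ℝ) + 1 + q) / 2 - 1) + -((n : ℝ) / 2 + 1) by ring,
      Real.rpow_add ht]
    ring
  constructor
  · exact IntegrableOn.congr_fun (h1.const_mul _) e measurableSet_Ioi
  · rw [symbol, ← h2, ← integral_const_mul]
    exact (setIntegral_congr_fun measurableSet_Ioi e).symm

lemma symbol_pos (hr : 0 < r) {q : ℝ} (hq : q < 1) : 0 < symbol n q r := by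
  have hp := Real.pi_pos
  have := Real.Gamma_pos_of_pos (half_pos (sub_pos.2 hq))
  unfold symbol; positivity

/-- The symbols of the Riesz kernels of orders `s` and `-s` are inverse to each other, up to the
factor `|ξ|²` and a constant. -/
lemma symbol_mul_symbol (s : ℝ) {r : ℝ} (hr : 0 < r) :
    symbol n s r * (symbol n (-s) r * r ^ 2) = symbol n s 1 * symbol n (-s) 1 := by
  have hp := Real.pi_pos
  have e : ∀ x : ℝ, 0 < x → (Real.pi ^ 2 * x ^ 2) ^ (-((1 - s) / 2)) *
      (Real.pi ^ 2 * x ^ 2) ^ (-((1 - -s) / 2)) = (Real.pi ^ 2 * x ^ 2)⁻¹ := by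
    intro x hx
    rw [← Real.rpow_add (by positivity), ← Real.rpow_neg_one]
    congr 1; ring
  have e1 := e r hr
  have e2 := e 1 one_pos
  have e3 : (Real.pi ^ 2 * r ^ 2)⁻¹ * r ^ 2 = (Real.pi ^ 2 * 1 ^ 2)⁻¹ := by field_simp
  unfold symbol
  calc _ = (Real.pi ^ ((n : ℝ) / 2 + 1)) ^ 2 * Real.Gamma ((1 - s) / 2) *
        Real.Gamma ((1 - -s) / 2) * (((Real.pi ^ 2 * r ^ 2) ^ (-((1 - s) / 2)) *
      (Real.pi ^ 2 * r ^ 2) ^ (-((1 - -s) / 2))) * r ^ 2) := by ring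
    _ = (Real.pi ^ ((n : ℝ) / 2 + 1)) ^ 2 * Real.Gamma ((1 - s) / 2) *
        Real.Gamma ((1 - -s) / 2) * ((Real.pi ^ 2 * 1 ^ 2) ^ (-((1 - s) / 2)) *
      (Real.pi ^ 2 * 1 ^ 2) ^ (-((1 - -s) / 2))) := by rw [e1, e2, e3]
    _ = _ := by ring

end NonlocalEL

namespace NonlocalEL

variable {n : ℕ} {s : ℝ}

/-! ### The fractional fundamental theorem of calculus -/

lemma integrableOn_compl_ball_rpow {α : ℝ} (hα : (n : ℝ) < α) {r : ℝ} (hr : 0 < r) :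
    IntegrableOn (fun h : Vec n => ‖h‖ ^ (-α)) (Metric.ball 0 r)ᶜ := by
  have h1 : Integrable fun h : Vec n => (1 + ‖h‖) ^ (-α) :=
    integrable_one_add_norm (by simpa using hα)
  have hα0 : 0 < α := lt_of_le_of_lt n.cast_nonneg hα
  refine ((h1.const_mul ((r / (1 + r)) ^ (-α))).integrableOn).mono'
    (Measurable.aestronglyMeasurable (by fun_prop)) ?_
  filter_upwards [ae_restrict_mem Metric.isOpen_ball.measurableSet.compl] with h hh
  have hh : r ≤ ‖h‖ := by simpa using hh
  rw [Real.norm_of_nonneg (by positivity), ← Real.mul_rpow (by positivity) (by positivity)]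
  refine Real.rpow_le_rpow_of_nonpos (by positivity) ?_ (by linarith)
  rw [div_mul_eq_mul_div, div_le_iff₀ (by positivity)]
  nlinarith

lemma isLevyKernel_riesz (hn : 1 ≤ n) (hs0 : 0 < s) (hs1 : s < 1) (j : Fin n) :
    IsLevyKernel (riesz s j) := by
  refine ⟨measurable_riesz s j, riesz_neg s j, ?_⟩
  have h1 := (integrableOn_ball_rpow hn (α := n - (1 - s)) (by linarith) 1).integrable_indicator
    Metric.isOpen_ball.measurableSet
  have h2 := (integrableOn_compl_ball_rpow (n := n) (α := n + s) (by linarith)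
    one_pos).integrable_indicator Metric.isOpen_ball.measurableSet.compl
  refine (h1.add h2).mono' (Measurable.aestronglyMeasurable (by fun_prop)) ?_
  filter_upwards [ae_ne_zero hn] with h hh
  have h0 : 0 < ‖h‖ := norm_pos_iff.2 hh
  have hb := abs_riesz_le s j hh
  rw [Real.norm_of_nonneg (by positivity)]
  by_cases hlt : ‖h‖ < 1
  · rw [Pi.add_apply, Set.indicator_of_mem (by simpa using hlt),
      Set.indicator_of_notMem (by simpa using hlt), add_zero, min_eq_right hlt.le]
    refine (mul_le_mul_of_nonneg_left hb h0.le).trans_eq ?_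
    nth_rewrite 1 [← Real.rpow_one ‖h‖]
    rw [← Real.rpow_add h0]; congr 1; ring
  · have hle := not_lt.1 hlt
    rw [Pi.add_apply, Set.indicator_of_notMem (by simpa using hle),
      Set.indicator_of_mem (by simpa using hle), zero_add, min_eq_left hle, one_mul]
    exact hb

lemma integral_norm_mixture {q : ℝ} (hq : -1 < q) (j : Fin n) {h : Vec n} (hh : h ≠ 0) :
    ∫ t in Set.Ioi (0 : ℝ), ‖t ^ (((n : ℝ) + 1 + q) / 2 - 1) * (h j * Real.exp (-t * ‖h‖ ^ 2))‖ =
      Real.Gamma (((n : ℝ) + 1 + q) / 2) * |riesz q j h| := by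
  have e : ∀ t ∈ Set.Ioi (0 : ℝ),
      ‖t ^ (((n : ℝ) + 1 + q) / 2 - 1) * (h j * Real.exp (-t * ‖h‖ ^ 2))‖ =
      SignType.sign (h j) *
        (t ^ (((n : ℝ) + 1 + q) / 2 - 1) * (h j * Real.exp (-t * ‖h‖ ^ 2))) := by
    intro t ht
    rw [norm_mul, norm_mul, Real.norm_of_nonneg (Real.rpow_nonneg (le_of_lt ht) _),
      Real.norm_of_nonneg (Real.exp_pos _).le, Real.norm_eq_abs, ← sign_mul_self (h j)]
    ring
  rw [setIntegral_congr_fun measurableSet_Ioi e, integral_const_mul, (riesz_eq_mixture hq j hh).2,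
    riesz, abs_mul, abs_of_nonneg (Real.rpow_nonneg (norm_nonneg _) _), ← sign_mul_self (h j)]
  ring

/-- A Riesz kernel may be replaced by the mixture of Gaussians that it is, under the integral. -/
lemma integral_riesz_mul {q : ℝ} (hn : 1 ≤ n) (hq : -1 < q) (j : Fin n) {g : Vec n → ℂ}
    (hg : Measurable g) (hi : Integrable fun h => (riesz q j h : ℂ) * g h) :
    (Real.Gamma (((n : ℝ) + 1 + q) / 2) : ℂ) * ∫ h, (riesz q j h : ℂ) * g h =
      ∫ t in Set.Ioi (0 : ℝ), ((t ^ (((n : ℝ) + 1 + q) / 2 - 1) : ℝ) : ℂ) *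
        ∫ h : Vec n, ((h j * Real.exp (-t * ‖h‖ ^ 2) : ℝ) : ℂ) * g h := by
  have hint : Integrable (fun z : Vec n × ℝ =>
      ((z.2 ^ (((n : ℝ) + 1 + q) / 2 - 1) * (z.1 j * Real.exp (-z.2 * ‖z.1‖ ^ 2)) : ℝ) : ℂ) * g z.1)
      (volume.prod (volume.restrict (Set.Ioi 0))) := by
    rw [integrable_prod_iff (Measurable.aestronglyMeasurable (by fun_prop))]
    constructor
    · filter_upwards [ae_ne_zero hn] with h hh
      exact ((riesz_eq_mixture hq j hh).1.ofReal).mul_const _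
    · refine ((hi.norm.const_mul (Real.Gamma (((n : ℝ) + 1 + q) / 2)))).congr ?_
      filter_upwards [ae_ne_zero hn] with h hh
      simp_rw [norm_mul _ (g _), Complex.norm_real]
      rw [integral_mul_const, integral_norm_mixture hq j hh, Real.norm_eq_abs, mul_assoc]
  have sw := integral_integral_swap (f := fun (h : Vec n) (t : ℝ) =>
    ((t ^ (((n : ℝ) + 1 + q) / 2 - 1) * (h j * Real.exp (-t * ‖h‖ ^ 2)) : ℝ) : ℂ) * g h) hint
  calc _ = ∫ h : Vec n, ∫ t in Set.Ioi (0 : ℝ),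
        ((t ^ (((n : ℝ) + 1 + q) / 2 - 1) * (h j * Real.exp (-t * ‖h‖ ^ 2)) : ℝ) : ℂ) * g h := by
        rw [← integral_const_mul]
        refine integral_congr_ae ?_
        filter_upwards [ae_ne_zero hn] with h hh
        rw [integral_mul_const, integral_complex_ofReal, (riesz_eq_mixture hq j hh).2]
        push_cast; ring
    _ = _ := by
        rw [sw]
        refine integral_congr_ae (ae_of_all _ fun t => ?_)
        simp only
        rw [← integral_const_mul]
        refine integral_congr_ae (ae_of_all _ fun h => ?_)
        push_cast; ring

/-- The Fourier symbol of the fractional gradient. -/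
lemma integral_one_sub_wave_mul_riesz (hn : 1 ≤ n) (hs0 : 0 < s) (hs1 : s < 1) (j : Fin n)
    {ξ : Vec n} (hξ : ξ ≠ 0) :
    (Real.Gamma (((n : ℝ) + 1 + s) / 2) : ℂ) * ∫ h, (riesz s j h : ℂ) * (1 - wave ξ (-h)) =
      Complex.I * ((ξ j * symbol n s ‖ξ‖ : ℝ) : ℂ) := by
  have hw := continuous_wave_right ξ
  have hκ := isLevyKernel_riesz hn hs0 hs1 j
  have hi : Integrable fun h => (riesz s j h : ℂ) * (1 - wave ξ (-h)) := by
    refine (hκ.int.const_mul (2 + 2 * Real.pi * ‖ξ‖)).mono'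
      (Measurable.aestronglyMeasurable (by have := hw.measurable; fun_prop)) (ae_of_all _ fun h => ?_)
    rw [norm_mul, Complex.norm_real, Real.norm_eq_abs]
    have := norm_one_sub_wave_le ξ (-h)
    rw [norm_neg] at this
    calc _ ≤ |riesz s j h| * ((2 + 2 * Real.pi * ‖ξ‖) * min 1 ‖h‖) := by gcongr
      _ = _ := by ring
  rw [integral_riesz_mul hn (by linarith) j (by have := hw.measurable; fun_prop) hi]
  have inner : ∀ t ∈ Set.Ioi (0 : ℝ), ((t ^ (((n : ℝ) + 1 + s) / 2 - 1) : ℝ) : ℂ) *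
        ∫ h : Vec n, ((h j * Real.exp (-t * ‖h‖ ^ 2) : ℝ) : ℂ) * (1 - wave ξ (-h)) =
      Complex.I * (ξ j) * ((t ^ (((n : ℝ) + 1 + s) / 2 - 1) * ((Real.pi / t) ^ ((n : ℝ) / 2 + 1) *
        Real.exp (-(Real.pi ^ 2 * ‖ξ‖ ^ 2) / t)) : ℝ) : ℂ) := by
    intro t ht
    have ht : 0 < t := ht
    have h1 := integral_apply_mul_gaussian_mul_wave ht ξ j
    have h0 := integral_apply_mul_gaussian_mul_wave ht 0 j
    have i1 : ∀ ξ' : Vec n, Integrable fun h : Vec n =>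
        ((h j * Real.exp (-t * ‖h‖ ^ 2) : ℝ) : ℂ) * wave ξ' (-h) := fun ξ' => by
      have := (continuous_wave_right ξ').measurable
      refine (integrable_apply_mul_gaussian ht j).norm.mono'
        (Measurable.aestronglyMeasurable (by fun_prop)) (ae_of_all _ fun h => ?_)
      rw [norm_mul, norm_wave, mul_one, Complex.norm_real]
    have : ∀ h : Vec n, ((h j * Real.exp (-t * ‖h‖ ^ 2) : ℝ) : ℂ) * (1 - wave ξ (-h)) =
        ((h j * Real.exp (-t * ‖h‖ ^ 2) : ℝ) : ℂ) * wave 0 (-h) -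
          ((h j * Real.exp (-t * ‖h‖ ^ 2) : ℝ) : ℂ) * wave ξ (-h) := by
      intro h; simp [wave]; ring
    simp_rw [this]
    rw [integral_sub (i1 0) (i1 ξ), h0, h1]
    simp
    ring
  rw [setIntegral_congr_fun measurableSet_Ioi inner, integral_const_mul, integral_complex_ofReal,
    (symbol_eq_mixture hs1 (norm_pos_iff.2 hξ)).2]
  push_cast; ring

/-- Fourier inversion for test functions, with a transform that decays fast enough to be
integrated against the symbols below. -/
lemma exists_fourier_inversion {f : Vec n → ℝ} (hf : ContDiff ℝ ∞ f) (hfc : HasCompactSupport f) :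
    ∃ g : Vec n → ℂ, Measurable g ∧ Integrable g ∧ Integrable (fun ξ => (1 + ‖ξ‖) * ‖g ξ‖) ∧
      ∀ x, (f x : ℂ) = ∫ ξ, g ξ * wave ξ x := by
  have hF : HasCompactSupport fun x => (f x : ℂ) := hfc.comp_left (g := fun r : ℝ => (r : ℂ)) (by simp)
  set F : SchwartzMap (Vec n) ℂ := hF.toSchwartzMap (Complex.ofRealCLM.contDiff.comp hf) with hFd
  have hFx : ∀ x, F x = (f x : ℂ) := fun x => rfl
  refine ⟨FourierTransform.fourier F, (FourierTransform.fourier F).continuous.measurable,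
    (FourierTransform.fourier F).integrable, ?_, fun x => ?_⟩
  · have h0 := (FourierTransform.fourier F).integrable_pow_mul volume 0
    have h1 := (FourierTransform.fourier F).integrable_pow_mul volume 1
    refine (h0.add h1).congr (ae_of_all _ fun ξ => ?_)
    simp; ring
  · rw [← hFx, ← Continuous.fourierInv_fourier_eq F.continuous F.integrable
      (by rw [← SchwartzMap.fourier_coe]; exact (FourierTransform.fourier F).integrable),
      Real.fourierInv_eq']
    refine integral_congr_ae (ae_of_all _ fun ξ => ?_)
    simp only [wave, smul_eq_mul, SchwartzMap.fourier_coe, mul_comm]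
    rw [real_inner_comm]

lemma kdiff_eq_fourier {f κ : Vec n → ℝ} {g : Vec n → ℂ} (hκ : IsLevyKernel κ) (hg : Measurable g)
    (hgi : Integrable g) (hgi' : Integrable (fun ξ => (1 + ‖ξ‖) * ‖g ξ‖))
    (hfg : ∀ x, (f x : ℂ) = ∫ ξ, g ξ * wave ξ x) (y : Vec n) :
    (kdiff κ f y : ℂ) = ∫ ξ, g ξ * wave ξ y * ∫ h, (κ h : ℂ) * (1 - wave ξ (-h)) := by
  have hw := continuous_wave (n := n)
  have hw1 : ∀ x : Vec n, Integrable fun ξ => g ξ * wave ξ x := fun x => by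
    have : Continuous fun ξ : Vec n => wave ξ x := by fun_prop
    refine hgi.norm.mono' (Measurable.aestronglyMeasurable (by fun_prop)) (ae_of_all _ fun ξ => ?_)
    rw [norm_mul, norm_wave, mul_one]
  have e : ∀ h : Vec n, (((f y - f (y - h)) * κ h : ℝ) : ℂ) =
      ∫ ξ, g ξ * wave ξ y * ((κ h : ℂ) * (1 - wave ξ (-h))) := by
    intro h
    push_cast
    rw [hfg, hfg, ← integral_sub (hw1 _) (hw1 _), ← integral_mul_const]
    refine integral_congr_ae (ae_of_all _ fun ξ => ?_)
    simp only [wave_sub]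
    ring
  have hm := hκ.meas
  have hint : Integrable (fun z : Vec n × Vec n =>
      g z.2 * wave z.2 y * ((κ z.1 : ℂ) * (1 - wave z.2 (-z.1)))) (volume.prod volume) := by
    refine ((hκ.int.mul_prod hgi').const_mul (2 * Real.pi)).mono'
      (Measurable.aestronglyMeasurable ?_) (ae_of_all _ fun z => ?_)
    · have h1 : Continuous fun z : Vec n × Vec n => wave z.2 y := by fun_prop
      have h2 : Continuous fun z : Vec n × Vec n => wave z.2 (-z.1) := by fun_prop
      fun_prop
    · rw [norm_mul, norm_mul, norm_mul, norm_wave, Complex.norm_real, mul_one, Real.norm_eq_abs]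
      have h1 := norm_one_sub_wave_le z.2 (-z.1)
      rw [norm_neg] at h1
      have hp := Real.two_le_pi
      have h2 : 2 + 2 * Real.pi * ‖z.2‖ ≤ 2 * Real.pi * (1 + ‖z.2‖) := by linarith
      have h3 : (0 : ℝ) ≤ min 1 ‖z.1‖ := le_min zero_le_one (norm_nonneg _)
      calc ‖g z.2‖ * (|κ z.1| * ‖1 - wave z.2 (-z.1)‖)
          ≤ ‖g z.2‖ * (|κ z.1| * ((2 * Real.pi * (1 + ‖z.2‖)) * min 1 ‖z.1‖)) := by
            gcongr
            exact h1.trans (mul_le_mul_of_nonneg_right h2 h3)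
        _ = _ := by ring
  rw [kdiff, ← integral_complex_ofReal]
  simp_rw [e]
  rw [integral_integral_swap (f := fun h ξ => g ξ * wave ξ y * ((κ h : ℂ) * (1 - wave ξ (-h)))) hint]
  simp_rw [integral_const_mul]

lemma measurable_symbol (q : ℝ) : Measurable (symbol n q) := by
  unfold symbol; fun_prop

lemma integral_riesz_mul_kdiff_aux (hn : 1 ≤ n) (hs0 : 0 < s) (hs1 : s < 1) {f : Vec n → ℝ}
    (hf : ContDiff ℝ ∞ f) {g : Vec n → ℂ} (hg : Measurable g)
    (hgi : Integrable g) (hgi' : Integrable (fun ξ => (1 + ‖ξ‖) * ‖g ξ‖))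
    (hfg : ∀ x, (f x : ℂ) = ∫ ξ, g ξ * wave ξ x) (x : Vec n) (j : Fin n)
    (hi : Integrable fun z => riesz (-s) j z * kdiff (riesz s j) f (x - z)) :
    ((Real.Gamma (((n : ℝ) + 1 + s) / 2) * Real.Gamma (((n : ℝ) + 1 + -s) / 2) : ℝ) : ℂ) *
      ((∫ z, riesz (-s) j z * kdiff (riesz s j) f (x - z) : ℝ) : ℂ) =
    ∫ ξ, g ξ * wave ξ x * ((ξ j ^ 2 * symbol n s ‖ξ‖ * symbol n (-s) ‖ξ‖ : ℝ) : ℂ) := by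
  have hκ := isLevyKernel_riesz hn hs0 hs1 j
  have hdm := (stronglyMeasurable_kdiff hf.continuous.measurable hκ.meas).measurable
  have hw := continuous_wave (n := n)
  have hwx : Continuous fun ξ : Vec n => wave ξ x := by fun_prop
  set Gs := Real.Gamma (((n : ℝ) + 1 + s) / 2) with hGs
  set Gm := Real.Gamma (((n : ℝ) + 1 + -s) / 2) with hGm
  have hi' : Integrable fun z => (riesz (-s) j z : ℂ) * (kdiff (riesz s j) f (x - z) : ℂ) := by
    simpa using hi.ofReal (𝕜 := ℂ)
  have h1 := integral_riesz_mul hn (q := -s) (by linarith) j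
    (g := fun z => (kdiff (riesz s j) f (x - z) : ℂ)) (by fun_prop) hi'
  -- the Gaussian-weighted inner integrals, computed on the Fourier side
  have inner : ∀ t ∈ Set.Ioi (0 : ℝ), (Gs : ℂ) * (((t ^ (((n : ℝ) + 1 + -s) / 2 - 1) : ℝ) : ℂ) *
        ∫ z : Vec n, ((z j * Real.exp (-t * ‖z‖ ^ 2) : ℝ) : ℂ) * (kdiff (riesz s j) f (x - z) : ℂ)) =
      ∫ ξ : Vec n, g ξ * wave ξ x * ((ξ j ^ 2 * symbol n s ‖ξ‖ : ℝ) : ℂ) *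
        ((t ^ (((n : ℝ) + 1 + -s) / 2 - 1) * ((Real.pi / t) ^ ((n : ℝ) / 2 + 1) *
        Real.exp (-(Real.pi ^ 2 * ‖ξ‖ ^ 2) / t)) : ℝ) : ℂ) := by
    intro t ht
    have ht : 0 < t := ht
    set m : Vec n → ℂ := fun ξ => ∫ h, (riesz s j h : ℂ) * (1 - wave ξ (-h)) with hm
    have hmm : Measurable m := by
      refine (StronglyMeasurable.integral_prod_right
        (f := fun (ξ h : Vec n) => (riesz s j h : ℂ) * (1 - wave ξ (-h))) ?_).measurable
      refine Measurable.stronglyMeasurable ?_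
      have : Continuous fun z : Vec n × Vec n => wave z.1 (-z.2) := by fun_prop
      unfold Function.uncurry
      fun_prop
    have hmb : ∀ ξ, ‖m ξ‖ ≤ 2 * Real.pi * (1 + ‖ξ‖) * ∫ h : Vec n, min 1 ‖h‖ * |riesz s j h| := by
      intro ξ
      rw [← integral_const_mul]
      refine norm_integral_le_of_norm_le (hκ.int.const_mul _) (ae_of_all _ fun h => ?_)
      rw [norm_mul, Complex.norm_real, Real.norm_eq_abs]
      have h1 := norm_one_sub_wave_le ξ (-h)
      rw [norm_neg] at h1
      have hp := Real.two_le_pi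
      have h2 : 2 + 2 * Real.pi * ‖ξ‖ ≤ 2 * Real.pi * (1 + ‖ξ‖) := by linarith
      have h3 : (0 : ℝ) ≤ min 1 ‖h‖ := le_min zero_le_one (norm_nonneg _)
      calc |riesz s j h| * ‖1 - wave ξ (-h)‖
          ≤ |riesz s j h| * ((2 * Real.pi * (1 + ‖ξ‖)) * min 1 ‖h‖) := by
            gcongr
            exact h1.trans (mul_le_mul_of_nonneg_right h2 h3)
        _ = _ := by ring
    have hint : Integrable (fun z : Vec n × Vec n =>
        ((z.1 j * Real.exp (-t * ‖z.1‖ ^ 2) : ℝ) : ℂ) * (g z.2 * wave z.2 (x - z.1) * m z.2))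
        (volume.prod volume) := by
      refine (((integrable_apply_mul_gaussian ht j).norm.mul_prod hgi').const_mul
        (2 * Real.pi * ∫ h : Vec n, min 1 ‖h‖ * |riesz s j h|)).mono'
        (Measurable.aestronglyMeasurable ?_) (ae_of_all _ fun z => ?_)
      · have : Continuous fun z : Vec n × Vec n => wave z.2 (x - z.1) := by fun_prop
        fun_prop
      · rw [norm_mul, norm_mul, norm_mul, norm_wave, Complex.norm_real, mul_one]
        calc _ ≤ ‖z.1 j * Real.exp (-t * ‖z.1‖ ^ 2)‖ * (‖g z.2‖ *
              (2 * Real.pi * (1 + ‖z.2‖) * ∫ h : Vec n, min 1 ‖h‖ * |riesz s j h|)) := by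
              gcongr
              exact hmb _
          _ = _ := by ring
    have hkd : ∀ y, (kdiff (riesz s j) f y : ℂ) = ∫ ξ, g ξ * wave ξ y * m ξ :=
      kdiff_eq_fourier hκ hg hgi hgi' hfg
    simp_rw [hkd, ← integral_const_mul]
    rw [integral_integral_swap (f := fun (z ξ : Vec n) => (Gs : ℂ) *
      (((t ^ (((n : ℝ) + 1 + -s) / 2 - 1) : ℝ) : ℂ) *
      (((z j * Real.exp (-t * ‖z‖ ^ 2) : ℝ) : ℂ) * (g ξ * wave ξ (x - z) * m ξ))))
      ((hint.const_mul _).const_mul _)]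
    refine integral_congr_ae ?_
    filter_upwards [ae_ne_zero hn] with ξ hξ
    have e2 := integral_one_sub_wave_mul_riesz hn hs0 hs1 j hξ
    have e3 := integral_apply_mul_gaussian_mul_wave ht ξ j
    have : ∀ z : Vec n, (Gs : ℂ) * (((t ^ (((n : ℝ) + 1 + -s) / 2 - 1) : ℝ) : ℂ) *
      (((z j * Real.exp (-t * ‖z‖ ^ 2) : ℝ) : ℂ) * (g ξ * wave ξ (x - z) * m ξ))) =
      (((t ^ (((n : ℝ) + 1 + -s) / 2 - 1) : ℝ) : ℂ) * g ξ * wave ξ x * ((Gs : ℂ) * m ξ)) *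
        (((z j * Real.exp (-t * ‖z‖ ^ 2) : ℝ) : ℂ) * wave ξ (-z)) := by
      intro z; rw [wave_sub]; ring
    simp_rw [this]
    rw [integral_const_mul, e3, hm, hGs]
    simp only
    rw [e2]
    push_cast
    linear_combination (-(((t ^ (((n : ℝ) + 1 + -s) / 2 - 1) : ℝ) : ℂ)) * g ξ * wave ξ x * ξ j ^ 2 *
      symbol n s ‖ξ‖ * (((Real.pi / t) ^ ((n : ℝ) / 2 + 1) : ℝ) : ℂ) *
      Complex.exp (-(Real.pi ^ 2 * ‖ξ‖ ^ 2) / t)) * Complex.I_sq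
  have hsm := measurable_symbol (n := n) s
  have hint2 : Integrable (fun z : Vec n × ℝ => g z.1 * wave z.1 x *
        ((z.1 j ^ 2 * symbol n s ‖z.1‖ : ℝ) : ℂ) *
        ((z.2 ^ (((n : ℝ) + 1 + -s) / 2 - 1) * ((Real.pi / z.2) ^ ((n : ℝ) / 2 + 1) *
        Real.exp (-(Real.pi ^ 2 * ‖z.1‖ ^ 2) / z.2)) : ℝ) : ℂ))
      (volume.prod (volume.restrict (Set.Ioi 0))) := by
    rw [integrable_prod_iff (Measurable.aestronglyMeasurable (by fun_prop))]
    constructor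
    · filter_upwards [ae_ne_zero hn] with ξ hξ
      exact ((symbol_eq_mixture (n := n) (q := -s) (by linarith) (norm_pos_iff.2 hξ)).1.ofReal).const_mul _
    · refine (hgi.norm.const_mul (symbol n s 1 * symbol n (-s) 1)).mono'
        (AEStronglyMeasurable.integral_prod_right' (f := fun z : Vec n × ℝ => ‖g z.1 * wave z.1 x *
        ((z.1 j ^ 2 * symbol n s ‖z.1‖ : ℝ) : ℂ) *
        ((z.2 ^ (((n : ℝ) + 1 + -s) / 2 - 1) * ((Real.pi / z.2) ^ ((n : ℝ) / 2 + 1) *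
        Real.exp (-(Real.pi ^ 2 * ‖z.1‖ ^ 2) / z.2)) : ℝ) : ℂ)‖)
          (Measurable.aestronglyMeasurable (by fun_prop))) ?_
      filter_upwards [ae_ne_zero hn] with ξ hξ
      have h0 : 0 < ‖ξ‖ := norm_pos_iff.2 hξ
      have hs := symbol_pos (n := n) h0 hs1
      have hs' := symbol_pos (n := n) h0 (q := -s) (by linarith)
      simp_rw [norm_mul _ (((_ : ℝ) : ℂ)), norm_mul, norm_wave, Complex.norm_real, mul_one]
      rw [integral_const_mul]
      have : ∫ t in Set.Ioi (0 : ℝ), ‖t ^ (((n : ℝ) + 1 + -s) / 2 - 1) *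
          ((Real.pi / t) ^ ((n : ℝ) / 2 + 1) * Real.exp (-(Real.pi ^ 2 * ‖ξ‖ ^ 2) / t))‖
          = symbol n (-s) ‖ξ‖ := by
        rw [← (symbol_eq_mixture (n := n) (q := -s) (by linarith) h0).2]
        refine setIntegral_congr_fun measurableSet_Ioi fun t ht => ?_
        have ht : 0 < t := ht
        have := Real.pi_pos
        rw [norm_mul, norm_mul, Real.norm_of_nonneg (by positivity), Real.norm_of_nonneg (by positivity),
          Real.norm_of_nonneg (by positivity)]
      rw [this, Real.norm_of_nonneg (by positivity), ← symbol_mul_symbol s h0, norm_mul, norm_pow,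
        Real.norm_of_nonneg hs.le, Real.norm_eq_abs]
      have hj : |ξ j| ^ 2 ≤ ‖ξ‖ ^ 2 := pow_le_pow_left₀ (abs_nonneg _) (PiLp.norm_apply_le ξ j) 2
      calc _ = |ξ j| ^ 2 * (‖g ξ‖ * symbol n s ‖ξ‖ * symbol n (-s) ‖ξ‖) := by ring
        _ ≤ ‖ξ‖ ^ 2 * (‖g ξ‖ * symbol n s ‖ξ‖ * symbol n (-s) ‖ξ‖) := by gcongr
        _ = _ := by ring
  have : ((∫ z, riesz (-s) j z * kdiff (riesz s j) f (x - z) : ℝ) : ℂ) =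
      ∫ z, (riesz (-s) j z : ℂ) * (kdiff (riesz s j) f (x - z) : ℂ) := by
    rw [← integral_complex_ofReal]; push_cast; rfl
  rw [this]
  push_cast
  rw [mul_assoc, h1, ← integral_const_mul, setIntegral_congr_fun measurableSet_Ioi inner,
    ← integral_integral_swap hint2]
  refine integral_congr_ae ?_
  filter_upwards [ae_ne_zero hn] with ξ hξ
  rw [integral_const_mul, integral_complex_ofReal,
    (symbol_eq_mixture (n := n) (q := -s) (by linarith) (norm_pos_iff.2 hξ)).2]
  push_cast
  ring

/-- Fractional fundamental theorem of calculus: a test function is a constant times the Riesz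
potential of its fractional gradient. -/
theorem sum_integral_riesz_mul_kdiff (hn : 1 ≤ n) (hs0 : 0 < s) (hs1 : s < 1) {f : Vec n → ℝ}
    (hf : ContDiff ℝ ∞ f) (hfc : HasCompactSupport f) (x : Vec n)
    (hi : ∀ j, Integrable fun z => riesz (-s) j z * kdiff (riesz s j) f (x - z)) :
    (Real.Gamma (((n : ℝ) + 1 + s) / 2) * Real.Gamma (((n : ℝ) + 1 + -s) / 2)) *
      ∑ j, ∫ z, riesz (-s) j z * kdiff (riesz s j) f (x - z) =
    symbol n s 1 * symbol n (-s) 1 * f x := by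
  obtain ⟨g, hg, hgi, hgi', hfg⟩ := exists_fourier_inversion hf hfc
  have hw := continuous_wave (n := n)
  have hwx : Continuous fun ξ : Vec n => wave ξ x := by fun_prop
  have hsm := measurable_symbol (n := n) s
  have hsm' := measurable_symbol (n := n) (-s)
  rw [← Complex.ofReal_inj]
  push_cast
  rw [Finset.mul_sum]
  have e := fun j => integral_riesz_mul_kdiff_aux hn hs0 hs1 hf hg hgi hgi' hfg x j (hi j)
  push_cast at e
  rw [Finset.sum_congr rfl fun j _ => e j, ← integral_finsetSum, hfg, ← integral_const_mul]
  · refine integral_congr_ae ?_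
    filter_upwards [ae_ne_zero hn] with ξ hξ
    have h1 := symbol_mul_symbol (n := n) s (norm_pos_iff.2 hξ)
    rw [EuclideanSpace.norm_sq_eq] at h1
    have h2 : (symbol n s ‖ξ‖ : ℂ) * ((symbol n (-s) ‖ξ‖ : ℂ) * ∑ j, (ξ j : ℂ) ^ 2) =
        symbol n s 1 * symbol n (-s) 1 := by
      rw [← Complex.ofReal_mul (symbol n s 1), ← h1]
      push_cast
      congr 3
      ext j
      rw [Real.norm_eq_abs, ← Complex.ofReal_pow, ← Complex.ofReal_pow, sq_abs]
    rw [← h2, Finset.mul_sum, Finset.mul_sum, Finset.sum_mul]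
    refine Finset.sum_congr rfl fun j _ => by ring
  · intro j _
    refine (hgi.norm.const_mul (symbol n s 1 * symbol n (-s) 1)).mono'
      (Measurable.aestronglyMeasurable (by fun_prop)) ?_
    filter_upwards [ae_ne_zero hn] with ξ hξ
    have h0 : 0 < ‖ξ‖ := norm_pos_iff.2 hξ
    have hs := symbol_pos (n := n) h0 hs1
    have hs' := symbol_pos (n := n) h0 (q := -s) (by linarith)
    simp only [norm_mul, norm_wave, norm_pow, Complex.norm_real, mul_one]
    rw [← symbol_mul_symbol s h0, Real.norm_of_nonneg hs.le, Real.norm_of_nonneg hs'.le]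
    have hj : ‖ξ j‖ ^ 2 ≤ ‖ξ‖ ^ 2 := pow_le_pow_left₀ (abs_nonneg _) (PiLp.norm_apply_le ξ j) 2
    calc _ = ‖ξ j‖ ^ 2 * (‖g ξ‖ * symbol n s ‖ξ‖ * symbol n (-s) ‖ξ‖) := by ring
      _ ≤ ‖ξ‖ ^ 2 * (‖g ξ‖ * symbol n s ‖ξ‖ * symbol n (-s) ‖ξ‖) := by gcongr
      _ = _ := by ring

/-- Test functions are bounded pointwise by the Riesz potential of their fractional gradient. -/
theorem exists_abs_le_rieszPotential (hn : 1 ≤ n) (hs0 : 0 < s) (hs1 : s < 1) :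
    ∃ C : ℝ≥0, ∀ f : Vec n → ℝ, ContDiff ℝ ∞ f → HasCompactSupport f → ∀ x,
      ‖f x‖ₑ ≤ C * ∑ j, ∫⁻ z : Vec n, ENNReal.ofReal (‖z‖ ^ (-((n : ℝ) - s))) *
        ‖kdiff (riesz s j) f (x - z)‖ₑ := by
  set A := Real.Gamma (((n : ℝ) + 1 + s) / 2) * Real.Gamma (((n : ℝ) + 1 + -s) / 2) with hA
  set B := symbol n s 1 * symbol n (-s) 1 with hB
  have hn' : (0 : ℝ) ≤ n := n.cast_nonneg
  have hA0 : 0 < A := mul_pos (Real.Gamma_pos_of_pos (by linarith))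
    (Real.Gamma_pos_of_pos (by linarith))
  have hB0 : 0 < B := mul_pos (symbol_pos one_pos hs1) (symbol_pos one_pos (by linarith))
  refine ⟨(A / B).toNNReal, fun f hf hfc x => ?_⟩
  have hle : ∀ j, ∫⁻ z, ‖riesz (-s) j z * kdiff (riesz s j) f (x - z)‖ₑ ≤
      ∫⁻ z : Vec n, ENNReal.ofReal (‖z‖ ^ (-((n : ℝ) - s))) * ‖kdiff (riesz s j) f (x - z)‖ₑ := by
    intro j
    refine lintegral_mono_ae ?_
    filter_upwards [ae_ne_zero hn] with z hz
    rw [enorm_mul]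
    gcongr
    rw [← ofReal_norm]
    exact ENNReal.ofReal_le_ofReal (by simpa [sub_eq_add_neg] using abs_riesz_le (-s) j hz)
  have hAB : ((A / B).toNNReal : ℝ≥0∞) = ENNReal.ofReal (A / B) := rfl
  by_cases hfin : ∀ j, ∫⁻ z, ‖riesz (-s) j z * kdiff (riesz s j) f (x - z)‖ₑ < ⊤
  · have hi : ∀ j, Integrable fun z => riesz (-s) j z * kdiff (riesz s j) f (x - z) := by
      intro j
      have := (stronglyMeasurable_kdiff hf.continuous.measurable (measurable_riesz s j)).measurable
      exact ⟨Measurable.aestronglyMeasurable (by fun_prop), hfin j⟩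
    have key := sum_integral_riesz_mul_kdiff hn hs0 hs1 hf hfc x hi
    have : f x = (A / B) * ∑ j, ∫ z, riesz (-s) j z * kdiff (riesz s j) f (x - z) := by
      rw [div_mul_eq_mul_div, eq_div_iff hB0.ne', key, hB]; ring
    rw [this, enorm_mul, hAB, Real.enorm_of_nonneg (by positivity)]
    gcongr
    refine (enorm_sum_le _ _).trans (Finset.sum_le_sum fun j _ => ?_)
    exact (enorm_integral_le_lintegral_enorm _).trans (hle j)
  · push Not at hfin
    obtain ⟨j, hj⟩ := hfin
    have : ∑ j, ∫⁻ z : Vec n, ENNReal.ofReal (‖z‖ ^ (-((n : ℝ) - s))) *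
        ‖kdiff (riesz s j) f (x - z)‖ₑ = ⊤ :=
      top_le_iff.1 ((hj.trans (hle j)).trans
        (Finset.single_le_sum (f := fun j => ∫⁻ z : Vec n, ENNReal.ofReal (‖z‖ ^ (-((n : ℝ) - s))) *
        ‖kdiff (riesz s j) f (x - z)‖ₑ) (fun _ _ => zero_le) (Finset.mem_univ j)))
    rw [this, hAB, ENNReal.mul_top (by simpa using div_pos hA0 hB0)]
    exact le_top

end NonlocalEL

namespace NonlocalEL

variable {n : ℕ} {s p : ℝ}

/-! ### The maximal function -/

/-- The maximal function over closed balls of the dyadic radii `1, 1/2, 1/4, …`. Small radii are all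
that the local part of a Riesz potential needs, and countably many of them make measurability
immediate. -/
noncomputable def dyadicMax (G : Vec n → ℝ≥0∞) (x : Vec n) : ℝ≥0∞ :=
  ⨆ i : ℕ, (volume (Metric.closedBall (0 : Vec n) ((1 / 2) ^ i)))⁻¹ *
    ∫⁻ z in Metric.closedBall 0 ((1 / 2) ^ i), G (x - z)

lemma measurable_dyadicMax {G : Vec n → ℝ≥0∞} (hG : Measurable G) : Measurable (dyadicMax G) := by
  refine Measurable.iSup fun i => Measurable.const_mul ?_ _
  exact Measurable.lintegral_prod_right' (f := fun z : Vec n × Vec n => G (z.1 - z.2)) (by fun_prop)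

lemma lintegral_closedBall_sub (G : Vec n → ℝ≥0∞) (x : Vec n) (r : ℝ) :
    ∫⁻ z in Metric.closedBall 0 r, G (x - z) = ∫⁻ y in Metric.closedBall x r, G y := by
  rw [← lintegral_indicator Metric.isClosed_closedBall.measurableSet,
    ← lintegral_indicator Metric.isClosed_closedBall.measurableSet,
    ← lintegral_sub_left_eq_self _ x]
  refine lintegral_congr fun y => ?_
  simp only [Set.indicator, mem_closedBall_iff_norm, sub_sub_cancel, sub_zero, norm_sub_rev x y]

lemma volume_closedBall_mul (x : Vec n) {r c : ℝ} (hr : 0 ≤ r) (hc : 0 ≤ c) :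
    volume (Metric.closedBall x (c * r)) =
      ENNReal.ofReal (c ^ n) * volume (Metric.closedBall (0 : Vec n) r) := by
  have := Measure.addHaar_closedBall_mul (volume : Measure (Vec n)) x hc hr
  rwa [finrank_euclideanSpace_fin] at this

/-- The weak `(1, 1)` inequality. -/
lemma volume_lt_dyadicMax_le (G : Vec n → ℝ≥0∞) {t : ℝ≥0∞} (ht : t ≠ 0) (ht' : t ≠ ⊤) :
    volume {x | t < dyadicMax G x} ≤ ENNReal.ofReal (5 ^ n) * t⁻¹ * ∫⁻ x, G x := by
  set A := {x | t < dyadicMax G x} with hA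
  have hex : ∀ x, ∃ i : ℕ, x ∈ A → t * volume (Metric.closedBall x ((1 / 2) ^ i)) ≤
      ∫⁻ y in Metric.closedBall x ((1 / 2) ^ i), G y := by
    intro x
    by_cases hx : x ∈ A
    · obtain ⟨i, hi⟩ := lt_iSup_iff.1 (show t < dyadicMax G x from hx)
      refine ⟨i, fun _ => ?_⟩
      have hpos : (0 : ℝ) < (1 / 2) ^ i := by positivity
      rw [lintegral_closedBall_sub] at hi
      have h1 : volume (Metric.closedBall (0 : Vec n) ((1 / 2) ^ i)) ≠ 0 :=
        (Metric.measure_closedBall_pos _ _ hpos).ne'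
      have h2 : volume (Metric.closedBall (0 : Vec n) ((1 / 2) ^ i)) ≠ ⊤ :=
        measure_closedBall_lt_top.ne
      rw [Measure.addHaar_closedBall_center, mul_comm]
      calc _ ≤ volume (Metric.closedBall (0 : Vec n) ((1 / 2) ^ i)) *
            ((volume (Metric.closedBall (0 : Vec n) ((1 / 2) ^ i)))⁻¹ *
              ∫⁻ y in Metric.closedBall x ((1 / 2) ^ i), G y) := by gcongr
        _ = _ := by rw [← mul_assoc, ENNReal.mul_inv_cancel h1 h2, one_mul]
    · exact ⟨0, fun h => absurd h hx⟩
  choose i hi using hex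
  obtain ⟨u, huA, hud, huc⟩ := Vitali.exists_disjoint_subfamily_covering_enlargement_closedBall A
    (fun x => x) (fun x => ((1 : ℝ) / 2) ^ i x) 1 (fun x _ => pow_le_one₀ (by norm_num) (by norm_num))
    5 (by norm_num)
  have hucount : u.Countable := by
    refine hud.countable_of_nonempty_interior fun x _ => ?_
    exact ⟨x, mem_interior_iff_mem_nhds.2 (Metric.closedBall_mem_nhds x (by positivity))⟩
  have := hucount.to_subtype
  have hcov : A ⊆ ⋃ b ∈ u, Metric.closedBall b (5 * (1 / 2) ^ i b) := by
    intro x hx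
    obtain ⟨b, hb, hsub⟩ := huc x hx
    exact Set.mem_biUnion hb (hsub (Metric.mem_closedBall_self (by positivity)))
  calc volume A ≤ volume (⋃ b ∈ u, Metric.closedBall b (5 * (1 / 2) ^ i b)) := measure_mono hcov
    _ ≤ ∑' b : u, volume (Metric.closedBall (b : Vec n) (5 * (1 / 2) ^ i b)) :=
        measure_biUnion_le _ hucount _
    _ ≤ ∑' b : u, ENNReal.ofReal (5 ^ n) * t⁻¹ *
          ∫⁻ y in Metric.closedBall (b : Vec n) ((1 / 2) ^ i b), G y := by
        refine ENNReal.tsum_le_tsum fun b => ?_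
        rw [volume_closedBall_mul _ (by positivity) (by norm_num), mul_assoc]
        gcongr
        rw [← ENNReal.div_eq_inv_mul, ENNReal.le_div_iff_mul_le (Or.inl ht) (Or.inl ht'), mul_comm,
          ← Measure.addHaar_closedBall_center volume (b : Vec n)]
        exact hi b (huA b.2)
    _ = ENNReal.ofReal (5 ^ n) * t⁻¹ *
          ∫⁻ y in ⋃ b ∈ u, Metric.closedBall b ((1 / 2) ^ i b), G y := by
        rw [ENNReal.tsum_mul_left, lintegral_biUnion hucount
          (fun b _ => Metric.isClosed_closedBall.measurableSet) hud]
    _ ≤ _ := by gcongr; exact Measure.restrict_le_self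

lemma ae_dyadicMax_lt_top {G : Vec n → ℝ≥0∞} (hG1 : ∫⁻ x, G x ≠ ⊤) :
    ∀ᵐ x, dyadicMax G x < ⊤ := by
  rw [ae_iff]
  have h : ∀ k : ℕ, volume {x | ¬ dyadicMax G x < ⊤} ≤
      ENNReal.ofReal (5 ^ n) * (∫⁻ x, G x) * ((k : ℝ≥0∞) + 1)⁻¹ := by
    intro k
    have := volume_lt_dyadicMax_le G (t := (k : ℝ≥0∞) + 1) (by simp) (by simp)
    rw [mul_right_comm] at this
    refine le_trans (measure_mono fun x hx => ?_) this
    have : dyadicMax G x = ⊤ := by simpa using hx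
    simp only [Set.mem_ofPred_eq, this]
    exact ENNReal.add_lt_top.2 ⟨by simp, by simp⟩
  have hlim : Tendsto (fun k : ℕ => ENNReal.ofReal (5 ^ n) * (∫⁻ x, G x) * ((k : ℝ≥0∞) + 1)⁻¹)
      atTop (𝓝 0) := by
    have h1 : Tendsto (fun k : ℕ => ((k : ℝ≥0∞) + 1)⁻¹) atTop (𝓝 0) := by
      have := (tendsto_add_atTop_iff_nat 1).2 ENNReal.tendsto_inv_nat_nhds_zero
      simpa using this
    have := ENNReal.Tendsto.const_mul h1
      (Or.inr (ENNReal.mul_ne_top (ENNReal.ofReal_ne_top (r := 5 ^ n)) hG1))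
    rwa [mul_zero] at this
  exact le_antisymm (ge_of_tendsto' hlim h) zero_le

/-- The part of `G` below the level `t/2` contributes at most `t/2` to the maximal function. -/
lemma volume_lt_dyadicMax_le_truncated {G : Vec n → ℝ≥0∞} (hG : Measurable G) {t : ℝ} (ht : 0 < t) :
    volume {x | ENNReal.ofReal t < dyadicMax G x} ≤
      ENNReal.ofReal (5 ^ n * 2 / t) * ∫⁻ x in {x | ENNReal.ofReal t < 2 * G x}, G x := by
  set S := {x | ENNReal.ofReal t < 2 * G x} with hS
  have hSm : MeasurableSet S := measurableSet_lt measurable_const (hG.const_mul 2)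
  have hsub : {x | ENNReal.ofReal t < dyadicMax G x} ⊆
      {x | ENNReal.ofReal (t / 2) < dyadicMax (S.indicator G) x} := by
    intro x hx
    obtain ⟨i, hi⟩ := lt_iSup_iff.1 (show ENNReal.ofReal t < dyadicMax G x from hx)
    set B := Metric.closedBall (0 : Vec n) ((1 / 2) ^ i) with hB
    have hpos : (0 : ℝ) < (1 / 2) ^ i := by positivity
    have h1 : volume B ≠ 0 := (Metric.measure_closedBall_pos _ _ hpos).ne'
    have h2 : volume B ≠ ⊤ := measure_closedBall_lt_top.ne
    have hle : ∀ y, G y ≤ S.indicator G y + ENNReal.ofReal (t / 2) := by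
      intro y
      by_cases hy : y ∈ S
      · rw [Set.indicator_of_mem hy]; exact le_self_add
      · rw [Set.indicator_of_notMem hy, zero_add]
        have : 2 * G y ≤ ENNReal.ofReal t := not_lt.1 hy
        rw [ENNReal.ofReal_div_of_pos two_pos, ENNReal.le_div_iff_mul_le (by simp) (by simp), mul_comm]
        simpa using this
    have h3 : (volume B)⁻¹ * ∫⁻ z in B, G (x - z) ≤
        (volume B)⁻¹ * (∫⁻ z in B, S.indicator G (x - z)) + ENNReal.ofReal (t / 2) := by
      calc _ ≤ (volume B)⁻¹ * ∫⁻ z in B, (S.indicator G (x - z) + ENNReal.ofReal (t / 2)) := by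
            gcongr; exact hle _
        _ = _ := by
            rw [lintegral_add_right _ measurable_const, setLIntegral_const, mul_add,
              mul_comm (ENNReal.ofReal _), ← mul_assoc, ENNReal.inv_mul_cancel h1 h2, one_mul]
    have h4 : ENNReal.ofReal (t / 2) + ENNReal.ofReal (t / 2) = ENNReal.ofReal t := by
      rw [← ENNReal.ofReal_add (by positivity) (by positivity), add_halves]
    have h5 := hi.trans_le h3
    rw [← h4] at h5
    have h6 := lt_of_add_lt_add_right h5
    exact h6.trans_le (le_iSup (fun i : ℕ => (volume (Metric.closedBall (0 : Vec n) ((1 / 2) ^ i)))⁻¹ *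
      ∫⁻ z in Metric.closedBall 0 ((1 / 2) ^ i), S.indicator G (x - z)) i)
  have hw := volume_lt_dyadicMax_le (S.indicator G) (t := ENNReal.ofReal (t / 2))
    (by simpa using ht) ENNReal.ofReal_ne_top
  rw [lintegral_indicator hSm] at hw
  refine (measure_mono hsub).trans (hw.trans_eq ?_)
  rw [← ENNReal.ofReal_inv_of_pos (by positivity), ← ENNReal.ofReal_mul (by positivity)]
  congr 2
  field_simp

/-- The strong `(p, p)` inequality, obtained from the weak inequality for truncations by
integrating over the levels. -/
theorem exists_lintegral_dyadicMax_rpow_le (n : ℕ) (hp : 1 < p) :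
    ∃ C : ℝ≥0, ∀ G : Vec n → ℝ≥0∞, Measurable G → ∫⁻ x, G x ≠ ⊤ →
      ∫⁻ x, dyadicMax G x ^ p ≤ C * ∫⁻ x, G x ^ p := by
  have hp0 : 0 < p := by linarith
  have hp1 : 0 < p - 1 := by linarith
  refine ⟨(p * (5 ^ n * 2) * (p - 1)⁻¹ * 2 ^ (p - 1)).toNNReal, fun G hG hG1 => ?_⟩
  have hM := measurable_dyadicMax hG
  have hMfin := ae_dyadicMax_lt_top hG1
  have hGfin : ∀ᵐ x, G x < ⊤ := ae_lt_top hG hG1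
  set μ := (volume : Measure (Vec n)).withDensity G with hμ
  have l1 := lintegral_rpow_eq_lintegral_meas_lt_mul (volume : Measure (Vec n))
    (f := fun x => (dyadicMax G x).toReal) (ae_of_all _ fun x => ENNReal.toReal_nonneg)
    hM.ennreal_toReal.aemeasurable hp0
  have l2 := lintegral_rpow_eq_lintegral_meas_lt_mul μ
    (f := fun x => (2 * G x).toReal) (ae_of_all _ fun x => ENNReal.toReal_nonneg)
    (hG.const_mul 2).ennreal_toReal.aemeasurable hp1
  have e1 : ∫⁻ x, dyadicMax G x ^ p = ∫⁻ x, ENNReal.ofReal ((dyadicMax G x).toReal ^ p) := by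
    refine lintegral_congr_ae ?_
    filter_upwards [hMfin] with x hx
    rw [← ENNReal.ofReal_rpow_of_nonneg ENNReal.toReal_nonneg hp0.le, ENNReal.ofReal_toReal hx.ne]
  have e2 : ∫⁻ x, ENNReal.ofReal ((2 * G x).toReal ^ (p - 1)) ∂μ =
      ENNReal.ofReal (2 ^ (p - 1)) * ∫⁻ x, G x ^ p := by
    rw [hμ, lintegral_withDensity_eq_lintegral_mul _ hG (by fun_prop),
      ← lintegral_const_mul _ (hG.pow_const p)]
    refine lintegral_congr_ae ?_
    filter_upwards [hGfin] with x hx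
    have h2 : 2 * G x ≠ ⊤ := ENNReal.mul_ne_top (by simp) hx.ne
    rw [Pi.mul_apply, ← ENNReal.ofReal_rpow_of_nonneg ENNReal.toReal_nonneg hp1.le,
      ENNReal.ofReal_toReal h2, ENNReal.mul_rpow_of_nonneg _ _ hp1.le,
      ← ENNReal.ofReal_rpow_of_pos two_pos, mul_left_comm]
    congr 1
    · simp
    · nth_rewrite 1 [← ENNReal.rpow_one (G x)]
      rw [← ENNReal.rpow_add_of_nonneg _ _ zero_le_one hp1.le]
      congr 1; ring
  have hle : ∫⁻ t in Set.Ioi (0 : ℝ), volume {x | t < (dyadicMax G x).toReal} *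
        ENNReal.ofReal (t ^ (p - 1)) ≤
      ENNReal.ofReal (5 ^ n * 2) * ∫⁻ t in Set.Ioi (0 : ℝ), μ {x | t < (2 * G x).toReal} *
        ENNReal.ofReal (t ^ (p - 1 - 1)) := by
    rw [← lintegral_const_mul' _ _ ENNReal.ofReal_ne_top]
    refine setLIntegral_mono' measurableSet_Ioi fun t ht => ?_
    have ht : 0 < t := ht
    have s1 : volume {x | t < (dyadicMax G x).toReal} ≤
        volume {x | ENNReal.ofReal t < dyadicMax G x} := by
      refine measure_mono fun x hx => ?_
      have hx : t < (dyadicMax G x).toReal := hx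
      by_cases h : dyadicMax G x = ⊤
      · simp [h]
      · exact (ENNReal.ofReal_lt_iff_lt_toReal ht.le h).2 hx
    have s2 : ∫⁻ x in {x | ENNReal.ofReal t < 2 * G x}, G x = μ {x | t < (2 * G x).toReal} := by
      have hSm : MeasurableSet {x | t < (2 * G x).toReal} :=
        measurableSet_lt measurable_const (hG.const_mul 2).ennreal_toReal
      rw [hμ, withDensity_apply _ hSm]
      refine setLIntegral_congr ?_
      filter_upwards [hGfin] with x hx
      have h2 : 2 * G x ≠ ⊤ := ENNReal.mul_ne_top (by simp) hx.ne
      exact propext (ENNReal.ofReal_lt_iff_lt_toReal ht.le h2)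
    calc _ ≤ (ENNReal.ofReal (5 ^ n * 2 / t) * μ {x | t < (2 * G x).toReal}) *
          ENNReal.ofReal (t ^ (p - 1)) := by
          gcongr
          exact s1.trans ((volume_lt_dyadicMax_le_truncated hG ht).trans_eq (by rw [s2]))
      _ = ENNReal.ofReal (5 ^ n * 2 / t * t ^ (p - 1)) * μ {x | t < (2 * G x).toReal} := by
          rw [ENNReal.ofReal_mul (by positivity)]; ring
      _ = _ := by
          rw [div_mul_eq_mul_div, mul_div_assoc, ← Real.rpow_sub_one ht.ne',
            ENNReal.ofReal_mul (by positivity)]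
          ring
  have l2' : ∫⁻ t in Set.Ioi (0 : ℝ), μ {x | t < (2 * G x).toReal} *
        ENNReal.ofReal (t ^ (p - 1 - 1)) =
      ENNReal.ofReal (p - 1)⁻¹ * (ENNReal.ofReal (2 ^ (p - 1)) * ∫⁻ x, G x ^ p) := by
    rw [← e2, l2, ← mul_assoc, ← ENNReal.ofReal_mul (by positivity), inv_mul_cancel₀ hp1.ne']
    simp
  rw [e1, l1]
  calc _ ≤ ENNReal.ofReal p * (ENNReal.ofReal (5 ^ n * 2) *
        (ENNReal.ofReal (p - 1)⁻¹ * (ENNReal.ofReal (2 ^ (p - 1)) * ∫⁻ x, G x ^ p))) := by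
        rw [← l2']; gcongr
    _ = _ := by
        have : ((p * (5 ^ n * 2) * (p - 1)⁻¹ * 2 ^ (p - 1)).toNNReal : ℝ≥0∞) =
            ENNReal.ofReal p * ENNReal.ofReal (5 ^ n * 2) * ENNReal.ofReal (p - 1)⁻¹ *
              ENNReal.ofReal (2 ^ (p - 1)) := by
          rw [← ENNReal.ofReal_mul (by positivity), ← ENNReal.ofReal_mul (by positivity),
            ← ENNReal.ofReal_mul (by positivity)]
          rfl
        rw [this]
        ring

/-! ### Young's inequality for an integrable kernel -/

lemma lintegral_lintegral_mul_sub (K G : Vec n → ℝ≥0∞) (hK : Measurable K) (hG : Measurable G) :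
    ∫⁻ x, ∫⁻ z, K z * G (x - z) = (∫⁻ z, K z) * ∫⁻ x, G x := by
  rw [lintegral_lintegral_swap (Measurable.aemeasurable (by fun_prop))]
  rw [← lintegral_mul_const _ hK]
  refine lintegral_congr fun z => ?_
  rw [lintegral_const_mul _ (by fun_prop), lintegral_sub_right_eq_self]

lemma holderConjugate_conj (hp : 1 < p) : (p / (p - 1)).HolderConjugate p := by
  have := (Real.HolderConjugate.conjExponent hp).symm
  rwa [Real.conjExponent] at this

lemma lintegral_rpow_lintegral_mul_sub_le (hp : 1 < p) (K G : Vec n → ℝ≥0∞) (hK : Measurable K)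
    (hG : Measurable G) :
    ∫⁻ x, (∫⁻ z, K z * G (x - z)) ^ p ≤ (∫⁻ z, K z) ^ p * ∫⁻ x, G x ^ p := by
  have hp0 : 0 < p := by linarith
  have hp1 : 0 < p - 1 := by linarith
  have hq := holderConjugate_conj hp
  have hpt : ∀ x, (∫⁻ z, K z * G (x - z)) ^ p ≤
      (∫⁻ z, K z) ^ (p - 1) * ∫⁻ z, K z * G (x - z) ^ p := by
    intro x
    have h := ENNReal.lintegral_mul_le_Lp_mul_Lq (volume : Measure (Vec n)) hq
      (f := fun z => K z ^ (1 / (p / (p - 1)))) (g := fun z => K z ^ (1 / p) * G (x - z))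
      (Measurable.aemeasurable (by fun_prop)) (Measurable.aemeasurable (by fun_prop))
    have e1 : ∀ z, K z ^ (1 / (p / (p - 1))) * (K z ^ (1 / p) * G (x - z)) = K z * G (x - z) := by
      intro z
      rw [← mul_assoc, ← ENNReal.rpow_add_of_nonneg _ _ (by positivity) (by positivity)]
      rw [show 1 / (p / (p - 1)) + 1 / p = 1 by field_simp; ring, ENNReal.rpow_one]
    have e2 : ∀ z, (K z ^ (1 / (p / (p - 1)))) ^ (p / (p - 1)) = K z := by
      intro z
      rw [← ENNReal.rpow_mul, one_div_mul_cancel (by positivity), ENNReal.rpow_one]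
    have e3 : ∀ z, (K z ^ (1 / p) * G (x - z)) ^ p = K z * G (x - z) ^ p := by
      intro z
      rw [ENNReal.mul_rpow_of_nonneg _ _ hp0.le, ← ENNReal.rpow_mul, one_div_mul_cancel hp0.ne',
        ENNReal.rpow_one]
    simp only [Pi.mul_apply, e1, e2, e3] at h
    calc _ ≤ ((∫⁻ z, K z) ^ (1 / (p / (p - 1))) * (∫⁻ z, K z * G (x - z) ^ p) ^ (1 / p)) ^ p := by
          gcongr
      _ = _ := by
          rw [ENNReal.mul_rpow_of_nonneg _ _ hp0.le, ← ENNReal.rpow_mul, ← ENNReal.rpow_mul,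
            one_div_mul_cancel hp0.ne', ENNReal.rpow_one]
          congr 2
          field_simp
  calc _ ≤ ∫⁻ x, (∫⁻ z, K z) ^ (p - 1) * ∫⁻ z, K z * G (x - z) ^ p := lintegral_mono hpt
    _ = (∫⁻ z, K z) ^ (p - 1) * ((∫⁻ z, K z) * ∫⁻ x, G x ^ p) := by
        rw [lintegral_const_mul, lintegral_lintegral_mul_sub K (fun x => G x ^ p) hK (by fun_prop)]
        exact Measurable.lintegral_prod_right' (f := fun z : Vec n × Vec n =>
          K z.2 * G (z.1 - z.2) ^ p) (by fun_prop)
    _ = _ := by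
        rw [← mul_assoc]
        congr 1
        nth_rewrite 2 [← ENNReal.rpow_one (∫⁻ z, K z)]
        rw [← ENNReal.rpow_add_of_nonneg _ _ hp1.le zero_le_one]
        congr 1; ring

end NonlocalEL

namespace NonlocalEL

variable {n : ℕ} {s p : ℝ}

/-! ### Riesz potentials -/

/-- The Riesz potential of order `s` (without its normalising constant). -/
noncomputable def potential (s : ℝ) (G : Vec n → ℝ≥0∞) (x : Vec n) : ℝ≥0∞ :=
  ∫⁻ z : Vec n, ENNReal.ofReal (‖z‖ ^ (-((n : ℝ) - s))) * G (x - z)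

lemma lintegral_closedBall_le_dyadicMax (G : Vec n → ℝ≥0∞) (x : Vec n) {r : ℝ} (hr : 0 < r)
    (hr1 : r ≤ 1) : ∫⁻ z in Metric.closedBall 0 r, G (x - z) ≤
      ENNReal.ofReal ((2 * r) ^ n) * volume (Metric.closedBall (0 : Vec n) 1) * dyadicMax G x := by
  obtain ⟨i, hi1, hi2⟩ := exists_nat_pow_near_of_lt_one hr hr1 (by norm_num : (0 : ℝ) < 1 / 2)
    (by norm_num)
  set B := Metric.closedBall (0 : Vec n) ((1 / 2) ^ i) with hB
  have hpos : (0 : ℝ) < (1 / 2) ^ i := by positivity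
  have h1 : volume B ≠ 0 := (Metric.measure_closedBall_pos _ _ hpos).ne'
  have h2 : volume B ≠ ⊤ := measure_closedBall_lt_top.ne
  have h3 : volume B = ENNReal.ofReal (((1 / 2) ^ i) ^ n) * volume (Metric.closedBall (0 : Vec n) 1) := by
    have := volume_closedBall_mul (0 : Vec n) zero_le_one hpos.le
    rwa [mul_one] at this
  calc ∫⁻ z in Metric.closedBall 0 r, G (x - z) ≤ ∫⁻ z in B, G (x - z) :=
        lintegral_mono_set (Metric.closedBall_subset_closedBall hi2)
    _ = volume B * ((volume B)⁻¹ * ∫⁻ z in B, G (x - z)) := by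
        rw [← mul_assoc, ENNReal.mul_inv_cancel h1 h2, one_mul]
    _ ≤ volume B * dyadicMax G x := by
        gcongr
        exact le_iSup (fun i : ℕ => (volume (Metric.closedBall (0 : Vec n) ((1 / 2) ^ i)))⁻¹ *
          ∫⁻ z in Metric.closedBall 0 ((1 / 2) ^ i), G (x - z)) i
    _ ≤ _ := by
        rw [h3]
        gcongr
        rw [pow_succ] at hi1
        linarith

/-- The near part of the potential is controlled by the maximal function (sum over dyadic
shells). -/
lemma exists_near_le (hn : 1 ≤ n) (hs0 : 0 < s) (hs1 : s < 1) :
    ∃ C : ℝ≥0, ∀ G : Vec n → ℝ≥0∞, Measurable G → ∀ x (ρ : ℝ), 0 < ρ → ρ ≤ 1 →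
      ∫⁻ z in Metric.closedBall (0 : Vec n) ρ, ENNReal.ofReal (‖z‖ ^ (-((n : ℝ) - s))) * G (x - z) ≤
        C * ENNReal.ofReal (ρ ^ s) * dyadicMax G x := by
  have hn1 : (1 : ℝ) ≤ n := by exact_mod_cast hn
  set q : ℝ := (1 / 2) ^ s with hq
  have hq0 : 0 < q := by positivity
  have hq1 : q < 1 := Real.rpow_lt_one (by norm_num) (by norm_num) hs0
  set D : ℝ≥0∞ := ENNReal.ofReal (2 ^ ((n : ℝ) - s) * 2 ^ n * (1 - q)⁻¹) *
    volume (Metric.closedBall (0 : Vec n) 1) with hD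
  have hDt : D ≠ ⊤ := ENNReal.mul_ne_top ENNReal.ofReal_ne_top measure_closedBall_lt_top.ne
  refine ⟨D.toNNReal, fun G hG x ρ hρ hρ1 => ?_⟩
  rw [ENNReal.coe_toNNReal hDt]
  set y : ℕ → ℝ := fun k => ρ * (1 / 2) ^ k with hy
  have hy0 : ∀ k, 0 < y k := fun k => by positivity
  have hyρ : ∀ k, y k ≤ ρ := fun k =>
    mul_le_of_le_one_right hρ.le (pow_le_one₀ (by norm_num) (by norm_num))
  have hpt : ∀ z : Vec n, z ≠ 0 → z ∈ Metric.closedBall (0 : Vec n) ρ →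
      ENNReal.ofReal (‖z‖ ^ (-((n : ℝ) - s))) * G (x - z) ≤
      ∑' k, ENNReal.ofReal ((y k / 2) ^ (-((n : ℝ) - s))) *
        (Metric.closedBall (0 : Vec n) (y k)).indicator (fun z => G (x - z)) z := by
    intro z hz hzρ
    have hz0 : 0 < ‖z‖ := norm_pos_iff.2 hz
    have hzρ : ‖z‖ ≤ ρ := by simpa using hzρ
    obtain ⟨k, hk1, hk2⟩ := exists_nat_pow_near_of_lt_one (div_pos hz0 hρ)
      ((div_le_one hρ).2 hzρ) (by norm_num : (0 : ℝ) < 1 / 2) (by norm_num)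
    refine le_trans ?_ (ENNReal.le_tsum k)
    rw [Set.indicator_of_mem]
    · gcongr ENNReal.ofReal ?_ * _
      refine Real.rpow_le_rpow_of_nonpos (by have := hy0 k; positivity) ?_ (by linarith)
      rw [lt_div_iff₀ hρ, pow_succ] at hk1
      simp only [hy]; linarith
    · rw [div_le_iff₀ hρ] at hk2
      rw [mem_closedBall_zero_iff]; simp only [hy]; linarith
  have hval : ∀ k, ENNReal.ofReal ((y k / 2) ^ (-((n : ℝ) - s))) * ENNReal.ofReal ((2 * y k) ^ n) =
      ENNReal.ofReal (2 ^ ((n : ℝ) - s) * 2 ^ n * ρ ^ s) * ENNReal.ofReal q ^ k := by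
    intro k
    rw [← ENNReal.ofReal_mul (Real.rpow_nonneg (by have := hy0 k; positivity) _),
      ← ENNReal.ofReal_pow hq0.le, ← ENNReal.ofReal_mul (by positivity)]
    congr 1
    have e1 : (y k / 2) ^ (-((n : ℝ) - s)) = y k ^ (-((n : ℝ) - s)) * 2 ^ ((n : ℝ) - s) := by
      rw [Real.div_rpow (hy0 k).le (by norm_num), div_eq_mul_inv, ← Real.rpow_neg (by norm_num),
        neg_neg]
    have e2 : y k ^ (-((n : ℝ) - s)) * y k ^ n = y k ^ s := by
      rw [← Real.rpow_natCast, ← Real.rpow_add (hy0 k)]; congr 1; ring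
    have e3 : y k ^ s = ρ ^ s * q ^ k := by
      simp only [hy, hq]
      rw [Real.mul_rpow hρ.le (by positivity), ← Real.rpow_natCast, ← Real.rpow_natCast,
        ← Real.rpow_mul (by norm_num), ← Real.rpow_mul (by norm_num), mul_comm (k : ℝ)]
    rw [e1, mul_pow]
    calc _ = (y k ^ (-((n : ℝ) - s)) * y k ^ n) * (2 ^ ((n : ℝ) - s) * 2 ^ n) := by ring
      _ = _ := by rw [e2, e3]; ring
  calc _ ≤ ∫⁻ z in Metric.closedBall (0 : Vec n) ρ,
        ∑' k, ENNReal.ofReal ((y k / 2) ^ (-((n : ℝ) - s))) *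
        (Metric.closedBall (0 : Vec n) (y k)).indicator (fun z => G (x - z)) z := by
        refine lintegral_mono_ae ?_
        filter_upwards [ae_restrict_mem Metric.isClosed_closedBall.measurableSet,
          ae_restrict_of_ae (ae_ne_zero hn)] with z hz hz0 using hpt z hz0 hz
    _ ≤ ∫⁻ z, ∑' k, ENNReal.ofReal ((y k / 2) ^ (-((n : ℝ) - s))) *
        (Metric.closedBall (0 : Vec n) (y k)).indicator (fun z => G (x - z)) z :=
        lintegral_mono' Measure.restrict_le_self le_rfl
    _ = ∑' k, ENNReal.ofReal ((y k / 2) ^ (-((n : ℝ) - s))) *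
          ∫⁻ z in Metric.closedBall (0 : Vec n) (y k), G (x - z) := by
        rw [lintegral_tsum]
        · refine tsum_congr fun k => ?_
          rw [lintegral_const_mul' _ _ ENNReal.ofReal_ne_top,
            lintegral_indicator Metric.isClosed_closedBall.measurableSet]
        · intro k
          refine Measurable.aemeasurable (Measurable.const_mul ?_ _)
          exact Measurable.indicator (by fun_prop) Metric.isClosed_closedBall.measurableSet
    _ ≤ ∑' k, ENNReal.ofReal ((y k / 2) ^ (-((n : ℝ) - s))) *
          (ENNReal.ofReal ((2 * y k) ^ n) * volume (Metric.closedBall (0 : Vec n) 1) *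
            dyadicMax G x) := by
        refine ENNReal.tsum_le_tsum fun k => ?_
        gcongr
        exact lintegral_closedBall_le_dyadicMax G x (hy0 k) ((hyρ k).trans hρ1)
    _ = ENNReal.ofReal (2 ^ ((n : ℝ) - s) * 2 ^ n * ρ ^ s) * (∑' k : ℕ, ENNReal.ofReal q ^ k) *
          (volume (Metric.closedBall (0 : Vec n) 1) * dyadicMax G x) := by
        rw [← ENNReal.tsum_mul_left, ← ENNReal.tsum_mul_right]
        refine tsum_congr fun k => ?_
        rw [← hval]; ring
    _ = _ := by
        rw [ENNReal.tsum_geometric, ← ENNReal.ofReal_one, ← ENNReal.ofReal_sub _ hq0.le,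
          ← ENNReal.ofReal_inv_of_pos (by linarith), hD,
          ENNReal.ofReal_mul (q := ρ ^ s) (by positivity),
          ENNReal.ofReal_mul (q := (1 - q)⁻¹) (by positivity)]
        ring

/-- Hölder's inequality for the part of the potential coming from a set `S`. -/
lemma setLIntegral_rpow_mul_le (hp : 1 < p) {G : Vec n → ℝ≥0∞} (hG : Measurable G) (x : Vec n)
    (S : Set (Vec n)) :
    ∫⁻ z in S, ENNReal.ofReal (‖z‖ ^ (-((n : ℝ) - s))) * G (x - z) ≤
      (∫⁻ z in S, ENNReal.ofReal (‖z‖ ^ (-(((n : ℝ) - s) * p / (p - 1))))) ^ ((p - 1) / p) *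
        (∫⁻ z, G z ^ p) ^ (1 / p) := by
  have hp0 : 0 < p := by linarith
  have hp1 : 0 < p - 1 := by linarith
  have h := ENNReal.lintegral_mul_le_Lp_mul_Lq (volume.restrict S) (holderConjugate_conj hp)
    (f := fun z => ENNReal.ofReal (‖z‖ ^ (-((n : ℝ) - s)))) (g := fun z => G (x - z))
    (Measurable.aemeasurable (by fun_prop)) (Measurable.aemeasurable (by fun_prop))
  have e : ∀ z : Vec n, ENNReal.ofReal (‖z‖ ^ (-((n : ℝ) - s))) ^ (p / (p - 1)) =
      ENNReal.ofReal (‖z‖ ^ (-(((n : ℝ) - s) * p / (p - 1)))) := by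
    intro z
    rw [ENNReal.ofReal_rpow_of_nonneg (Real.rpow_nonneg (norm_nonneg _) _) (by positivity),
      ← Real.rpow_mul (norm_nonneg _)]
    congr 2; ring
  simp only [Pi.mul_apply, e] at h
  refine h.trans ?_
  rw [one_div_div]
  refine mul_le_mul' le_rfl (ENNReal.rpow_le_rpow ?_ (by positivity))
  calc _ ≤ ∫⁻ z, G (x - z) ^ p := lintegral_mono' Measure.restrict_le_self le_rfl
    _ = _ := lintegral_sub_left_eq_self (fun z => G z ^ p) x

lemma setLIntegral_tail_le (hn : 1 ≤ n) (hs1 : s < 1) {G : Vec n → ℝ≥0∞}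
    (x : Vec n) : ∫⁻ z in (Metric.closedBall (0 : Vec n) 1)ᶜ,
      ENNReal.ofReal (‖z‖ ^ (-((n : ℝ) - s))) * G (x - z) ≤ ∫⁻ z, G z := by
  have hn1 : (1 : ℝ) ≤ n := by exact_mod_cast hn
  calc _ ≤ ∫⁻ z in (Metric.closedBall (0 : Vec n) 1)ᶜ, G (x - z) := by
        refine setLIntegral_mono' Metric.isClosed_closedBall.measurableSet.compl fun z hz => ?_
        have hz : 1 < ‖z‖ := by simpa using hz
        refine mul_le_of_le_one_left zero_le ?_
        rw [← ENNReal.ofReal_one]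
        exact ENNReal.ofReal_le_ofReal (Real.rpow_le_one_of_one_le_of_nonpos hz.le (by linarith))
    _ ≤ ∫⁻ z, G (x - z) := lintegral_mono' Measure.restrict_le_self le_rfl
    _ = _ := lintegral_sub_left_eq_self G x

/-- Hedberg's splitting of the potential at the radius `ρ`. -/
lemma exists_potential_le (hn : 1 ≤ n) (hs0 : 0 < s) (hs1 : s < 1) (hp : 1 < p) :
    ∃ C : ℝ≥0, ∀ G : Vec n → ℝ≥0∞, Measurable G → ∀ x (ρ : ℝ), 0 < ρ → ρ ≤ 1 →
      potential s G x ≤ C * ENNReal.ofReal (ρ ^ s) * dyadicMax G x +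
        (∫⁻ z in Metric.closedBall (0 : Vec n) 1 \ Metric.closedBall 0 ρ,
          ENNReal.ofReal (‖z‖ ^ (-(((n : ℝ) - s) * p / (p - 1))))) ^ ((p - 1) / p) *
          (∫⁻ z, G z ^ p) ^ (1 / p) + ∫⁻ z, G z := by
  obtain ⟨C, hC⟩ := exists_near_le hn hs0 hs1
  refine ⟨C, fun G hG x ρ hρ hρ1 => ?_⟩
  rw [potential, ← lintegral_add_compl _ (Metric.isClosed_closedBall (x := (0 : Vec n))
    (ε := 1)).measurableSet]
  refine add_le_add ?_ (setLIntegral_tail_le hn hs1 x)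
  have hsub := Metric.closedBall_subset_closedBall (x := (0 : Vec n)) hρ1
  rw [← lintegral_inter_add_sdiff _ (Metric.closedBall (0 : Vec n) 1)
    (Metric.isClosed_closedBall (x := (0 : Vec n)) (ε := ρ)).measurableSet,
    Set.inter_eq_self_of_subset_right hsub]
  exact add_le_add (hC G hG x ρ hρ hρ1) (setLIntegral_rpow_mul_le hp hG x _)

lemma setLIntegral_annulus (hn : 1 ≤ n) (q : ℝ) {ρ : ℝ} (hρ : 0 < ρ) (hρ1 : ρ ≤ 1) :
    ∫⁻ z in Metric.closedBall (0 : Vec n) 1 \ Metric.closedBall 0 ρ, ENNReal.ofReal (‖z‖ ^ (-q)) =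
      ENNReal.ofReal (n * volume.real (Metric.ball (0 : Vec n) 1) *
        ∫ y in ρ..1, y ^ ((n : ℝ) - 1 - q)) := by
  have : Nonempty (Fin n) := ⟨⟨0, hn⟩⟩
  have : Nontrivial (Vec n) := inferInstance
  set f : ℝ → ℝ := (Set.Ioc ρ 1).indicator fun y => y ^ (-q) with hf
  have hS : MeasurableSet (Metric.closedBall (0 : Vec n) 1 \ Metric.closedBall 0 ρ) :=
    Metric.isClosed_closedBall.measurableSet.diff Metric.isClosed_closedBall.measurableSet
  have hind : ∀ z : Vec n, (Metric.closedBall (0 : Vec n) 1 \ Metric.closedBall 0 ρ).indicator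
      (fun z => ENNReal.ofReal (‖z‖ ^ (-q))) z = ENNReal.ofReal (f ‖z‖) := by
    intro z
    by_cases hz : ‖z‖ ∈ Set.Ioc ρ 1
    · rw [hf, Set.indicator_of_mem hz, Set.indicator_of_mem]
      simpa [and_comm] using hz
    · rw [hf, Set.indicator_of_notMem hz, Set.indicator_of_notMem, ENNReal.ofReal_zero]
      simpa [and_comm] using hz
  have hfm : Measurable f := by
    refine Measurable.indicator (by fun_prop) measurableSet_Ioc
  have hfb : ∀ y, ‖f y‖ ≤ (Set.Iic (1 : ℝ)).indicator (fun _ => max 1 (ρ ^ (-q))) y := by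
    intro y
    by_cases hy : y ∈ Set.Ioc ρ 1
    · have hy0 : 0 < y := hρ.trans hy.1
      rw [hf, Set.indicator_of_mem hy, Set.indicator_of_mem (by exact hy.2),
        Real.norm_of_nonneg (by positivity)]
      rcases le_total q 0 with hq | hq
      · exact (Real.rpow_le_one hy0.le hy.2 (by linarith)).trans (le_max_left _ _)
      · exact (Real.rpow_le_rpow_of_nonpos hρ hy.1.le (by linarith)).trans (le_max_right _ _)
    · rw [hf, Set.indicator_of_notMem hy, norm_zero]
      exact Set.indicator_nonneg (fun _ _ => by positivity) _
  have hint : Integrable fun z : Vec n => f ‖z‖ := by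
    have h1 : Integrable ((Metric.closedBall (0 : Vec n) 1).indicator
        fun _ => max 1 (ρ ^ (-q))) :=
      (integrable_indicator_iff Metric.isClosed_closedBall.measurableSet).2
        (integrableOn_const measure_closedBall_lt_top.ne)
    refine h1.mono' (hfm.comp measurable_norm).aestronglyMeasurable (ae_of_all _ fun z => ?_)
    refine (hfb ‖z‖).trans_eq ?_
    simp [Set.indicator]
  have hf0 : ∀ y, 0 ≤ f y := by
    intro y
    by_cases hy : y ∈ Set.Ioc ρ 1
    · have hy0 : 0 < y := hρ.trans hy.1
      rw [hf, Set.indicator_of_mem hy]; positivity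
    · rw [hf, Set.indicator_of_notMem hy]
  rw [← lintegral_indicator hS, lintegral_congr hind,
    ← ofReal_integral_eq_lintegral_ofReal hint (ae_of_all _ fun z => hf0 _),
    integral_fun_norm_addHaar, finrank_euclideanSpace_fin, nsmul_eq_mul, smul_eq_mul, ← mul_assoc,
    intervalIntegral.integral_of_le hρ1]
  congr 2
  have : ∀ y, y ^ (n - 1) • f y = (Set.Ioc ρ 1).indicator (fun y => y ^ ((n : ℝ) - 1 - q)) y := by
    intro y
    by_cases hy : y ∈ Set.Ioc ρ 1
    · have hy0 : 0 < y := hρ.trans hy.1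
      rw [hf, Set.indicator_of_mem hy, Set.indicator_of_mem hy, smul_eq_mul, ← Real.rpow_natCast,
        ← Real.rpow_add hy0, Nat.cast_sub hn]
      congr 1; push_cast; ring
    · rw [hf, Set.indicator_of_notMem hy, Set.indicator_of_notMem hy, smul_zero]
  simp_rw [this]
  rw [setIntegral_indicator measurableSet_Ioc]
  congr 2
  ext y
  simp only [Set.mem_inter_iff, Set.mem_Ioi, Set.mem_Ioc]
  exact ⟨fun h => h.2, fun h => ⟨hρ.trans h.1, h⟩⟩

end NonlocalEL

namespace NonlocalEL

variable {n : ℕ} {s p : ℝ}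

/-! ### Integrability of Riesz potentials: the three regimes -/

/-- The supercritical case `sp > n`: potentials are bounded. -/
lemma exists_enorm_le_of_supercritical (hn : 1 ≤ n) (hs1 : s < 1) (hp : 1 < p)
    (hsp : (n : ℝ) < s * p) (C N : ℝ≥0) :
    ∃ N' : ℝ≥0, ∀ G : Vec n → ℝ≥0∞, Measurable G → ∫⁻ x, G x ≤ N → ∫⁻ x, G x ^ p ≤ N →
      ∀ f : Vec n → ℝ, (∀ x, ‖f x‖ₑ ≤ C * potential s G x) → ∀ x, ‖f x‖ₑ ≤ N' := by
  have hp0 : 0 < p := by linarith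
  have hp1 : 0 < p - 1 := by linarith
  have hq : ((n : ℝ) - s) * p / (p - 1) < n := by
    rw [div_lt_iff₀ hp1]; nlinarith
  set J := ∫⁻ z in Metric.closedBall (0 : Vec n) 1,
    ENNReal.ofReal (‖z‖ ^ (-(((n : ℝ) - s) * p / (p - 1)))) with hJ
  have hJt : J ≠ ⊤ := by
    have h1 := ((integrableOn_ball_rpow hn hq 2).mono_set
      (Metric.closedBall_subset_ball (x := (0 : Vec n)) (by norm_num : (1 : ℝ) < 2)))
    have h2 := h1.lintegral_lt_top
    exact h2.ne
  set D : ℝ≥0∞ := C * (J ^ ((p - 1) / p) * (N : ℝ≥0∞) ^ (1 / p) + N) with hD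
  have hDt : D ≠ ⊤ := by
    refine ENNReal.mul_ne_top ENNReal.coe_ne_top (ENNReal.add_ne_top.2 ⟨ENNReal.mul_ne_top ?_ ?_, ?_⟩)
    · exact ENNReal.rpow_ne_top_of_nonneg (by positivity) hJt
    · exact ENNReal.rpow_ne_top_of_nonneg (by positivity) ENNReal.coe_ne_top
    · exact ENNReal.coe_ne_top
  refine ⟨D.toNNReal, fun G hG h1 hGp f hf x => ?_⟩
  rw [ENNReal.coe_toNNReal hDt]
  refine (hf x).trans ?_
  rw [hD, potential, ← lintegral_add_compl _ (Metric.isClosed_closedBall (x := (0 : Vec n))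
    (ε := 1)).measurableSet]
  gcongr
  · refine (setLIntegral_rpow_mul_le hp hG x _).trans ?_
    gcongr
  · exact (setLIntegral_tail_le hn hs1 x).trans h1

lemma lintegral_one_add_dyadicMax_rpow_le (n : ℕ) (hp : 1 < p) (N : ℝ≥0) {A : Set (Vec n)}
    (hA : volume A ≠ ⊤) : ∃ N' : ℝ≥0, ∀ G : Vec n → ℝ≥0∞, Measurable G → ∫⁻ x, G x ≤ N →
      ∫⁻ x, G x ^ p ≤ N → ∫⁻ x in A, (1 + dyadicMax G x) ^ p ≤ N' := by
  obtain ⟨C, hC⟩ := exists_lintegral_dyadicMax_rpow_le n hp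
  set D : ℝ≥0∞ := 2 ^ (p - 1) * (volume A + C * N) with hD
  have hDt : D ≠ ⊤ := ENNReal.mul_ne_top (ENNReal.rpow_ne_top_of_nonneg (by linarith) (by simp))
    (ENNReal.add_ne_top.2 ⟨hA, ENNReal.mul_ne_top ENNReal.coe_ne_top ENNReal.coe_ne_top⟩)
  refine ⟨D.toNNReal, fun G hG h1 hGp => ?_⟩
  rw [ENNReal.coe_toNNReal hDt]
  calc _ ≤ ∫⁻ x in A, 2 ^ (p - 1) * (1 + dyadicMax G x ^ p) := by
        refine lintegral_mono fun x => ?_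
        have := ENNReal.rpow_add_le_mul_rpow_add_rpow 1 (dyadicMax G x) hp.le
        rwa [ENNReal.one_rpow] at this
    _ = 2 ^ (p - 1) * (volume A + ∫⁻ x in A, dyadicMax G x ^ p) := by
        rw [lintegral_const_mul' _ _ (ENNReal.rpow_ne_top_of_nonneg (by linarith) (by simp)),
          lintegral_add_left measurable_const, setLIntegral_const, one_mul]
    _ ≤ _ := by
        rw [hD]
        gcongr
        calc _ ≤ ∫⁻ x, dyadicMax G x ^ p := lintegral_mono' Measure.restrict_le_self le_rfl
          _ ≤ C * ∫⁻ x, G x ^ p := hC G hG (ne_top_of_le_ne_top ENNReal.coe_ne_top h1)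
          _ ≤ _ := by gcongr

lemma ofReal_toReal_one_add {M : ℝ≥0∞} (hM : M < ⊤) : ENNReal.ofReal (1 + M.toReal) = 1 + M := by
  rw [ENNReal.ofReal_add zero_le_one ENNReal.toReal_nonneg, ENNReal.ofReal_one,
    ENNReal.ofReal_toReal hM.ne]

/-- The subcritical case `sp < n`: potentials are integrable to the critical Sobolev exponent. -/
lemma exists_lintegral_le_of_subcritical (hn : 1 ≤ n) (hs0 : 0 < s) (hs1 : s < 1) (hp : 1 < p)
    (hsp : s * p < n) (C N : ℝ≥0) {A : Set (Vec n)} (hA : volume A ≠ ⊤) :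
    ∃ N' : ℝ≥0, ∀ G : Vec n → ℝ≥0∞, Measurable G → ∫⁻ x, G x ≤ N → ∫⁻ x, G x ^ p ≤ N →
      ∀ f : Vec n → ℝ, (∀ x, ‖f x‖ₑ ≤ C * potential s G x) →
        ∫⁻ x in A, ‖f x‖ₑ ^ (n * p / (n - s * p)) ≤ N' := by
  have hp0 : 0 < p := by linarith
  have hp1 : 0 < p - 1 := by linarith
  have hn0 : (0 : ℝ) < n := by exact_mod_cast hn
  have hnsp : 0 < (n : ℝ) - s * p := by linarith
  obtain ⟨C₁, hC₁⟩ := exists_potential_le hn hs0 hs1 hp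
  obtain ⟨N₁, hN₁⟩ := lintegral_one_add_dyadicMax_rpow_le n hp N hA
  set β : ℝ := ((n : ℝ) - s * p) / (p - 1) with hβ
  have hβ0 : 0 < β := div_pos hnsp hp1
  set r : ℝ := n * p / (n - s * p) with hr
  have hr0 : 0 < r := by positivity
  set c : ℝ := n * volume.real (Metric.ball (0 : Vec n) 1) / β with hc
  have hc0 : 0 ≤ c := by positivity
  set D : ℝ≥0∞ := C * (C₁ + ENNReal.ofReal c ^ ((p - 1) / p) * (N : ℝ≥0∞) ^ (1 / p) + N) with hD
  have hDt : D ≠ ⊤ := by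
    refine ENNReal.mul_ne_top ENNReal.coe_ne_top (ENNReal.add_ne_top.2 ⟨ENNReal.add_ne_top.2
      ⟨ENNReal.coe_ne_top, ENNReal.mul_ne_top ?_ ?_⟩, ENNReal.coe_ne_top⟩)
    · exact ENNReal.rpow_ne_top_of_nonneg (by positivity) ENNReal.ofReal_ne_top
    · exact ENNReal.rpow_ne_top_of_nonneg (by positivity) ENNReal.coe_ne_top
  refine ⟨(D ^ r * N₁).toNNReal, fun G hG h1 hGp f hf => ?_⟩
  rw [ENNReal.coe_toNNReal (ENNReal.mul_ne_top (ENNReal.rpow_ne_top_of_nonneg hr0.le hDt)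
    ENNReal.coe_ne_top)]
  have hfin := ae_dyadicMax_lt_top (n := n) (G := G) (ne_top_of_le_ne_top ENNReal.coe_ne_top h1)
  have hpt : ∀ᵐ x, ‖f x‖ₑ ^ r ≤ D ^ r * (1 + dyadicMax G x) ^ p := by
    filter_upwards [hfin] with x hx
    set m : ℝ := 1 + (dyadicMax G x).toReal with hm
    have hm1 : 1 ≤ m := le_add_of_nonneg_right ENNReal.toReal_nonneg
    have hm0 : 0 < m := by linarith
    have hmE : ENNReal.ofReal m = 1 + dyadicMax G x := ofReal_toReal_one_add hx
    -- the radius that balances the near and the far part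
    set ρ : ℝ := m ^ (-(p / n)) with hρ
    have hρ0 : 0 < ρ := Real.rpow_pos_of_pos hm0 _
    have hρ1 : ρ ≤ 1 := Real.rpow_le_one_of_one_le_of_nonpos hm1 (by
      have : 0 < p / n := by positivity
      linarith)
    set θ : ℝ := 1 - s * p / n with hθ
    have hθ0 : 0 ≤ θ := by
      rw [hθ, sub_nonneg, div_le_one hn0]; exact hsp.le
    have near : ENNReal.ofReal (ρ ^ s) * dyadicMax G x ≤ ENNReal.ofReal (m ^ θ) := by
      calc _ ≤ ENNReal.ofReal (ρ ^ s) * ENNReal.ofReal m := by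
            gcongr; rw [hmE]; exact le_add_self
        _ = _ := by
            rw [← ENNReal.ofReal_mul (by positivity), hρ, ← Real.rpow_mul hm0.le]
            nth_rewrite 2 [← Real.rpow_one m]
            rw [← Real.rpow_add hm0]
            congr 2; rw [hθ]; ring
    have far : (∫⁻ z in Metric.closedBall (0 : Vec n) 1 \ Metric.closedBall 0 ρ,
          ENNReal.ofReal (‖z‖ ^ (-(((n : ℝ) - s) * p / (p - 1))))) ^ ((p - 1) / p) ≤
        ENNReal.ofReal c ^ ((p - 1) / p) * ENNReal.ofReal (m ^ θ) := by
      rw [setLIntegral_annulus hn _ hρ0 hρ1]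
      have e1 : (n : ℝ) - 1 - ((n : ℝ) - s) * p / (p - 1) = -β - 1 := by
        rw [hβ]; field_simp; ring
      have e2 : ∫ y in ρ..1, y ^ (-β - 1) ≤ ρ ^ (-β) / β := by
        rw [integral_rpow (Or.inr ⟨by linarith, by
          rw [Set.uIcc_of_le hρ1]; exact fun h => absurd h.1 (not_le.2 hρ0)⟩)]
        rw [sub_add_cancel, Real.one_rpow, div_neg, ← neg_div, neg_sub]
        gcongr; linarith
      have e3 : ρ ^ (-β) = m ^ (p * β / n) := by
        rw [hρ, ← Real.rpow_mul hm0.le]; congr 1; ring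
      calc _ ≤ (ENNReal.ofReal (c * m ^ (p * β / n))) ^ ((p - 1) / p) := by
            refine ENNReal.rpow_le_rpow (ENNReal.ofReal_le_ofReal ?_) (by positivity)
            rw [e1, ← e3]
            calc _ ≤ n * volume.real (Metric.ball (0 : Vec n) 1) * (ρ ^ (-β) / β) :=
                  mul_le_mul_of_nonneg_left e2 (by positivity)
              _ = c * ρ ^ (-β) := by rw [hc]; ring
        _ = _ := by
            rw [ENNReal.ofReal_mul hc0, ENNReal.mul_rpow_of_nonneg _ _ (by positivity),
              ENNReal.ofReal_rpow_of_pos (Real.rpow_pos_of_pos hm0 _), ← Real.rpow_mul hm0.le]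
            congr 3
            rw [hβ, hθ]; field_simp
    have hone : (1 : ℝ≥0∞) ≤ ENNReal.ofReal (m ^ θ) := by
      rw [← ENNReal.ofReal_one]
      exact ENNReal.ofReal_le_ofReal (Real.one_le_rpow hm1 hθ0)
    have tot : ‖f x‖ₑ ≤ D * ENNReal.ofReal (m ^ θ) := by
      calc ‖f x‖ₑ ≤ C * potential s G x := hf x
        _ ≤ C * (C₁ * ENNReal.ofReal (m ^ θ) +
              ENNReal.ofReal c ^ ((p - 1) / p) * ENNReal.ofReal (m ^ θ) * (N : ℝ≥0∞) ^ (1 / p) +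
              N * ENNReal.ofReal (m ^ θ)) := by
            gcongr
            refine (hC₁ G hG x ρ hρ0 hρ1).trans ?_
            gcongr ?_ + ?_ + ?_
            · rw [mul_assoc]; gcongr
            · gcongr
            · exact h1.trans (le_mul_of_one_le_right zero_le hone)
        _ = _ := by rw [hD]; ring
    calc _ ≤ (D * ENNReal.ofReal (m ^ θ)) ^ r := by gcongr
      _ = _ := by
          rw [ENNReal.mul_rpow_of_nonneg _ _ hr0.le,
            ENNReal.ofReal_rpow_of_pos (Real.rpow_pos_of_pos hm0 _), ← Real.rpow_mul hm0.le, ← hmE,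
            ENNReal.ofReal_rpow_of_pos hm0]
          congr 3
          rw [hθ, hr]; field_simp
  calc _ ≤ ∫⁻ x in A, D ^ r * (1 + dyadicMax G x) ^ p := lintegral_mono_ae (ae_restrict_of_ae hpt)
    _ = D ^ r * ∫⁻ x in A, (1 + dyadicMax G x) ^ p :=
        lintegral_const_mul' _ _ (ENNReal.rpow_ne_top_of_nonneg hr0.le hDt)
    _ ≤ _ := by gcongr; exact hN₁ G hG h1 hGp

/-- A power less than one of `y` is absorbed by `y`. -/
lemma exists_rpow_le_add (K k : ℝ) (hK : 0 ≤ K) (hk : 0 ≤ k) {r θ : ℝ} (hr : 0 < r) (hθ : 0 < θ)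
    (hrθ : r * θ < 1) :
    ∃ B : ℝ, ∀ y t : ℝ, 0 ≤ y → 0 ≤ t → t ≤ K * (1 + y ^ θ) → k * t ^ r ≤ y + B := by
  set a : ℝ := k * (2 * K) ^ r with ha
  have ha0 : 0 ≤ a := by positivity
  set η : ℝ := θ * r with hη
  have hη0 : 0 < η := by positivity
  have hη1 : 0 < 1 - η := by rw [hη]; linarith
  set Y : ℝ := max 1 (a ^ (1 / (1 - η))) with hY
  have hY1 : 1 ≤ Y := le_max_left _ _
  refine ⟨a * Y ^ η, fun y t hy ht hty => ?_⟩
  have hYη : 1 ≤ Y ^ η := Real.one_le_rpow hY1 hη0.le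
  have h1 : k * t ^ r ≤ a * max 1 (y ^ η) := by
    have h2 : t ≤ 2 * K * max 1 (y ^ θ) := by
      have := le_max_left (1 : ℝ) (y ^ θ)
      have := le_max_right (1 : ℝ) (y ^ θ)
      nlinarith
    have h3 : (max 1 (y ^ θ)) ^ r ≤ max 1 (y ^ η) := by
      rcases le_total (1 : ℝ) (y ^ θ) with h | h
      · rw [max_eq_right h, ← Real.rpow_mul hy]; exact le_max_right _ _
      · rw [max_eq_left h, Real.one_rpow]; exact le_max_left _ _
    calc k * t ^ r ≤ k * (2 * K * max 1 (y ^ θ)) ^ r := by gcongr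
      _ = a * (max 1 (y ^ θ)) ^ r := by rw [Real.mul_rpow (by positivity) (by positivity)]; ring
      _ ≤ _ := by gcongr
  refine h1.trans ?_
  rcases le_total y Y with h | h
  · have : max 1 (y ^ η) ≤ Y ^ η := max_le hYη (Real.rpow_le_rpow hy h hη0.le)
    have := mul_le_mul_of_nonneg_left this ha0
    linarith
  · have hy1 : 1 ≤ y := hY1.trans h
    have hy0 : 0 < y := by linarith
    have h4 : a ≤ y ^ (1 - η) := by
      calc a = (a ^ (1 / (1 - η))) ^ (1 - η) := by
            rw [← Real.rpow_mul ha0, one_div_mul_cancel hη1.ne', Real.rpow_one]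
        _ ≤ y ^ (1 - η) := Real.rpow_le_rpow (Real.rpow_nonneg ha0 _)
            ((le_max_right _ _).trans h) hη1.le
    rw [max_eq_right (Real.one_le_rpow hy1 hη0.le)]
    have h5 : a * y ^ η ≤ y := by
      calc a * y ^ η ≤ y ^ (1 - η) * y ^ η := by gcongr
        _ = y := by rw [← Real.rpow_add hy0]; simp
    have : 0 ≤ a * Y ^ η := by positivity
    linarith

/-- The critical case `sp = n`: potentials are exponentially integrable (Trudinger). -/
lemma exists_lintegral_le_of_critical (hn : 1 ≤ n) (hs0 : 0 < s) (hs1 : s < 1) (hp : 1 < p)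
    (hsp : s * p = n) (C N : ℝ≥0) {A : Set (Vec n)} (hA : volume A ≠ ⊤) {k r : ℝ} (hk : 0 ≤ k)
    (hr : 0 < r) (hrp : r < p / (p - 1)) :
    ∃ N' : ℝ≥0, ∀ G : Vec n → ℝ≥0∞, Measurable G → ∫⁻ x, G x ≤ N → ∫⁻ x, G x ^ p ≤ N →
      ∀ f : Vec n → ℝ, (∀ x, ‖f x‖ₑ ≤ C * potential s G x) →
        ∫⁻ x in A, ENNReal.ofReal (Real.exp (k * |f x| ^ r)) ≤ N' := by
  have hp0 : 0 < p := by linarith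
  have hp1 : 0 < p - 1 := by linarith
  have hn0 : (0 : ℝ) < n := by exact_mod_cast hn
  obtain ⟨C₁, hC₁⟩ := exists_potential_le hn hs0 hs1 hp
  obtain ⟨N₁, hN₁⟩ := lintegral_one_add_dyadicMax_rpow_le n hp N hA
  set θ : ℝ := (p - 1) / p with hθ
  have hθ0 : 0 < θ := by positivity
  have hrθ : r * θ < 1 := by
    rw [hθ]; rw [lt_div_iff₀ hp1] at hrp
    rw [mul_div_assoc', div_lt_one hp0]; exact hrp
  set c : ℝ := n * volume.real (Metric.ball (0 : Vec n) 1) / s with hc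
  have hc0 : 0 ≤ c := by positivity
  set K : ℝ := C * (C₁ + c ^ θ * (N : ℝ) ^ (1 / p) + N) with hK
  have hK0 : 0 ≤ K := by positivity
  obtain ⟨B, hB⟩ := exists_rpow_le_add K k hK0 hk hr hθ0 hrθ
  refine ⟨(Real.exp B).toNNReal * N₁, fun G hG h1 hGp f hf => ?_⟩
  have hfin := ae_dyadicMax_lt_top (n := n) (G := G) (ne_top_of_le_ne_top ENNReal.coe_ne_top h1)
  have hpt : ∀ᵐ x, ENNReal.ofReal (Real.exp (k * |f x| ^ r)) ≤
      ENNReal.ofReal (Real.exp B) * (1 + dyadicMax G x) ^ p := by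
    filter_upwards [hfin] with x hx
    set m : ℝ := 1 + (dyadicMax G x).toReal with hm
    have hm1 : 1 ≤ m := le_add_of_nonneg_right ENNReal.toReal_nonneg
    have hm0 : 0 < m := by linarith
    have hlog : 0 ≤ Real.log m := Real.log_nonneg hm1
    have hmE : ENNReal.ofReal m = 1 + dyadicMax G x := ofReal_toReal_one_add hx
    -- the radius for which the near part is bounded
    set ρ : ℝ := m ^ (-(1 / s)) with hρ
    have hρ0 : 0 < ρ := Real.rpow_pos_of_pos hm0 _
    have hρ1 : ρ ≤ 1 := Real.rpow_le_one_of_one_le_of_nonpos hm1 (by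
      have : 0 < 1 / s := by positivity
      linarith)
    have near : ENNReal.ofReal (ρ ^ s) * dyadicMax G x ≤ 1 := by
      calc _ ≤ ENNReal.ofReal (ρ ^ s) * ENNReal.ofReal m := by
            gcongr; rw [hmE]; exact le_add_self
        _ = 1 := by
            rw [← ENNReal.ofReal_mul (by positivity), hρ, ← Real.rpow_mul hm0.le]
            rw [show -(1 / s) * s = -1 by field_simp, Real.rpow_neg_one, inv_mul_cancel₀ hm0.ne']
            simp
    have far : (∫⁻ z in Metric.closedBall (0 : Vec n) 1 \ Metric.closedBall 0 ρ,
          ENNReal.ofReal (‖z‖ ^ (-(((n : ℝ) - s) * p / (p - 1))))) ^ ((p - 1) / p) =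
        ENNReal.ofReal (c ^ θ * Real.log m ^ θ) := by
      rw [setLIntegral_annulus hn _ hρ0 hρ1]
      have e1 : (n : ℝ) - 1 - ((n : ℝ) - s) * p / (p - 1) = -1 := by
        rw [← hsp]; field_simp; ring
      have e2 : ∫ y in ρ..1, y ^ (-1 : ℝ) = Real.log m / s := by
        simp_rw [Real.rpow_neg_one]
        rw [integral_inv_of_pos hρ0 one_pos, Real.log_div one_ne_zero hρ0.ne', hρ,
          Real.log_rpow hm0, Real.log_one]
        ring
      rw [e1, e2, ENNReal.ofReal_rpow_of_nonneg (by positivity) (by positivity),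
        ← Real.mul_rpow hc0 hlog]
      congr 2
      rw [hc]; ring
    have hbound : |f x| ≤ K * (1 + Real.log m ^ θ) := by
      have hE : ‖f x‖ₑ ≤ ENNReal.ofReal (C * (C₁ + c ^ θ * Real.log m ^ θ * (N : ℝ) ^ (1 / p) + N)) := by
        refine (hf x).trans ?_
        rw [ENNReal.ofReal_mul C.coe_nonneg, ENNReal.ofReal_add (by positivity) (by positivity),
          ENNReal.ofReal_add (by positivity) (by positivity), ENNReal.ofReal_coe_nnreal,
          ENNReal.ofReal_coe_nnreal, ENNReal.ofReal_coe_nnreal, ENNReal.ofReal_mul (by positivity),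
          ← ENNReal.ofReal_rpow_of_nonneg N.coe_nonneg (by positivity), ENNReal.ofReal_coe_nnreal]
        gcongr
        refine (hC₁ G hG x ρ hρ0 hρ1).trans ?_
        gcongr ?_ + ?_ + ?_
        · rw [mul_assoc]
          exact mul_le_of_le_one_right zero_le near
        · rw [far]; gcongr
      rw [← ofReal_norm, ENNReal.ofReal_le_ofReal_iff (by positivity), Real.norm_eq_abs] at hE
      refine hE.trans ?_
      rw [hK, mul_assoc (C : ℝ)]
      refine mul_le_mul_of_nonneg_left ?_ C.coe_nonneg
      have hl : 0 ≤ Real.log m ^ θ := by positivity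
      have h2 : 0 ≤ c ^ θ * (N : ℝ) ^ (1 / p) := by positivity
      have h3 : 0 ≤ ((C₁ : ℝ) + N) * Real.log m ^ θ := by positivity
      nlinarith
    have hfinal := hB (Real.log m) |f x| hlog (abs_nonneg _) hbound
    calc _ ≤ ENNReal.ofReal (Real.exp B * m) := by
          refine ENNReal.ofReal_le_ofReal ((Real.exp_le_exp.2 hfinal).trans_eq ?_)
          rw [Real.exp_add, Real.exp_log hm0, mul_comm]
      _ = ENNReal.ofReal (Real.exp B) * (1 + dyadicMax G x) := by
          rw [ENNReal.ofReal_mul (Real.exp_pos _).le, hmE]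
      _ ≤ _ := by
          gcongr
          nth_rewrite 1 [← ENNReal.rpow_one (1 + dyadicMax G x)]
          exact ENNReal.rpow_le_rpow_of_exponent_le le_self_add hp.le
  calc _ ≤ ∫⁻ x in A, ENNReal.ofReal (Real.exp B) * (1 + dyadicMax G x) ^ p :=
        lintegral_mono_ae (ae_restrict_of_ae hpt)
    _ = ENNReal.ofReal (Real.exp B) * ∫⁻ x in A, (1 + dyadicMax G x) ^ p :=
        lintegral_const_mul' _ _ ENNReal.ofReal_ne_top
    _ ≤ _ := by
        push_cast
        exact mul_le_mul' le_rfl (hN₁ G hG h1 hGp)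

end NonlocalEL

namespace NonlocalEL

variable {n : ℕ} {s p δ : ℝ} {w : Vec n → ℝ} {Ω : Set (Vec n)}

/-! ### Localisation -/

/-- A smooth cut-off function vanishing outside `Ω` and equal to one on `shrunk δ Ω`. -/
lemma exists_cutoff (hδ : 0 < δ) (hΩo : IsOpen Ω) (hΩb : Bornology.IsBounded Ω) :
    ∃ χ : Vec n → ℝ, ContDiff ℝ ∞ χ ∧ HasCompactSupport χ ∧ (∀ x, x ∉ Ω → χ x = 0) ∧
      (∀ x ∈ shrunk δ Ω, χ x = 1) ∧ ∀ x, |χ x| ≤ 1 := by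
  set K : Set (Vec n) := closure Ω ∩ {x | δ ≤ Metric.infDist x (frontier Ω)} with hK
  have hKc : IsClosed K :=
    isClosed_closure.inter (isClosed_le continuous_const (Metric.continuous_infDist_pt _))
  have hd : Disjoint Ωᶜ K := by
    refine Set.disjoint_left.2 fun x hx hxK => ?_
    have : x ∈ frontier Ω := by
      rw [hΩo.frontier_eq]; exact ⟨hxK.1, hx⟩
    have h2 : δ ≤ Metric.infDist x (frontier Ω) := hxK.2
    rw [Metric.infDist_zero_of_mem this] at h2
    linarith
  obtain ⟨χ, hχ, hr, h0, h1⟩ := exists_contMDiff_zero_iff_one_iff_of_isClosed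
    (modelWithCornersSelf ℝ (Vec n)) (n := (⊤ : ℕ∞)) hΩo.isClosed_compl hKc hd
  refine ⟨χ, contMDiff_iff_contDiff.1 hχ, ?_, fun x hx => (h0 x).1 hx,
    fun x hx => (h1 x).1 ⟨subset_closure hx.1, hx.2.le⟩, fun x => ?_⟩
  · refine HasCompactSupport.intro hΩb.isCompact_closure fun x hx => (h0 x).1 fun hx' => ?_
    exact hx (subset_closure hx')
  · have := hr ⟨x, rfl⟩
    rw [abs_le]; constructor <;> linarith [this.1, this.2]

/-- Replacing the truncated kernel by the full Riesz kernel costs an integrable kernel. -/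
lemma integrable_sub_mul_riesz (hs0 : 0 < s) (hδ : 0 < δ) (hw : IsCutoff δ w) {a₀ b₀ : ℝ}
    (hb : 0 < b₀) (hwa : ∀ x, 0 ≤ w x ∧ w x ≤ a₀)
    (hwb : ∀ x ∈ Metric.ball (0 : Vec n) (b₀ * δ), w x = a₀) (j : Fin n) :
    Integrable fun h => (a₀ - w h) * riesz s j h := by
  have h2 := (integrableOn_compl_ball_rpow (n := n) (α := n + s) (by linarith)
    (mul_pos hb hδ)).integrable_indicator Metric.isOpen_ball.measurableSet.compl
  have := hw.measurable
  refine (h2.const_mul a₀).mono' (Measurable.aestronglyMeasurable (by fun_prop))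
    (ae_of_all _ fun h => ?_)
  by_cases hh : h ∈ Metric.ball (0 : Vec n) (b₀ * δ)
  · simp [hwb h hh, hh]
  · have h0 : h ≠ 0 := by
      rintro rfl
      exact hh (Metric.mem_ball_self (mul_pos hb hδ))
    rw [Set.indicator_of_mem hh, norm_mul, Real.norm_eq_abs, Real.norm_eq_abs,
      abs_of_nonneg (sub_nonneg.2 (hwa h).2)]
    exact mul_le_mul (by linarith [(hwa h).1]) (abs_riesz_le s j h0) (abs_nonneg _)
      (by linarith [(hwa h).1, (hwa h).2])

/-- The full fractional gradient of `χ v` is controlled by the nonlocal gradient of `v` on `Ω`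
and by `v` on `outer δ Ω`, up to convolution with an integrable kernel. -/
lemma exists_localization (hn : 1 ≤ n) (hs0 : 0 < s) (hs1 : s < 1) (hδ : 0 < δ)
    (hw : IsCutoff δ w) {χ : Vec n → ℝ} (hχ : ContDiff ℝ ∞ χ) (hχc : HasCompactSupport χ)
    (hχ0 : ∀ x, x ∉ Ω → χ x = 0) (hχ1 : ∀ x, |χ x| ≤ 1) :
    ∃ (A : ℝ≥0) (K : Vec n → ℝ≥0∞), Measurable K ∧ ∫⁻ z, K z ≠ ⊤ ∧
      ∀ v : Vec n → Vec n, IsTest Set.univ v → ∀ i j x,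
        ‖kdiff (riesz s j) (fun y => χ y * v y i) x‖ₑ ≤
          A * (Ω.indicator (fun y => ‖smoothGrad s δ w v y‖ₑ) x +
            (outer δ Ω).indicator (fun y => ‖v y‖ₑ) x +
            ∫⁻ z, K z * (outer δ Ω).indicator (fun y => ‖v y‖ₑ) (x - z)) := by
  obtain ⟨a₀, b₀, ha, hb, hb1, hwa, hwb⟩ := hw.plateau
  obtain ⟨L, hL⟩ := exists_bddLip hχ hχc
  have hL0 := hL.nonneg hn
  have hc := cConst_pos hn hs0 hs1
  have hwm := hw.measurable
  set κ₁ : Fin n → Vec n → ℝ := fun j h => vecKernel s w h j with hκ₁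
  set κ₂ : Fin n → Vec n → ℝ := fun j h => (a₀ - w h) * riesz s j h with hκ₂
  have hl₁ := fun j => isLevyKernel_vecKernel hn hs1 hw (s := s) j
  have hi₂ : ∀ j, Integrable (κ₂ j) := fun j => integrable_sub_mul_riesz hs0 hδ hw hb hwa hwb j
  have hm₂ : ∀ j, Measurable (κ₂ j) := fun j => by simp only [hκ₂]; fun_prop
  set K : Vec n → ℝ≥0∞ := fun h => ∑ j, (ENNReal.ofReal (L * (min 1 ‖h‖ * |κ₁ j h|)) + ‖κ₂ j h‖ₑ)
    with hK
  have hmK₁ : ∀ j, Measurable (fun h => ENNReal.ofReal (L * (min 1 ‖h‖ * |κ₁ j h|))) := fun j => by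
    have := (hl₁ j).meas
    exact ((((measurable_const.min measurable_norm).mul this.norm)).const_mul L).ennreal_ofReal
  have hKm : Measurable K :=
    Finset.measurable_sum _ fun j _ => (hmK₁ j).add (hm₂ j).enorm
  have hKt : ∫⁻ z, K z ≠ ⊤ := by
    have e : ∫⁻ z, K z = ∑ j, ∫⁻ h, (ENNReal.ofReal (L * (min 1 ‖h‖ * |κ₁ j h|)) + ‖κ₂ j h‖ₑ) :=
      lintegral_finsetSum _ fun j _ => (hmK₁ j).add (hm₂ j).enorm
    rw [e]
    refine ENNReal.sum_ne_top.2 fun j _ => ?_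
    rw [lintegral_add_left (hmK₁ j)]
    exact ENNReal.add_ne_top.2 ⟨((hl₁ j).int.const_mul L).lintegral_lt_top.ne, (hi₂ j).2.ne⟩
  set M : ℝ≥0∞ := ENNReal.ofReal a₀⁻¹ * (1 + ENNReal.ofReal (cConst n s)⁻¹ + ∫⁻ z, K z) with hM
  have hMt : M ≠ ⊤ := by finiteness
  refine ⟨M.toNNReal, K, hKm, hKt, fun v hv i j x => ?_⟩
  rw [ENNReal.coe_toNNReal hMt]
  obtain ⟨hvs, hvc⟩ := hv.comp i
  obtain ⟨L', hL'⟩ := exists_bddLip hvs hvc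
  have hfs : ContDiff ℝ ∞ fun y => χ y * v y i := hχ.mul hvs
  obtain ⟨L'', hL''⟩ := exists_bddLip hfs hχc.mul_right
  set vt : Vec n → ℝ≥0∞ := (outer δ Ω).indicator (fun y => ‖v y‖ₑ) with hvt
  have hcomp : ∀ y, ‖v y i‖ₑ ≤ ‖v y‖ₑ := fun y => by
    rw [enorm_le_iff_norm_le]; exact PiLp.norm_apply_le (v y) i
  have hχv : ∀ y, ‖χ y * v y i‖ₑ ≤ vt y := fun y => by
    by_cases hy : y ∈ Ω
    · rw [hvt, Set.indicator_of_mem (subset_outer hδ hy), enorm_mul]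
      calc _ ≤ 1 * ‖v y‖ₑ := by
            gcongr
            · rw [← enorm_one (G := ℝ), enorm_le_iff_norm_le]; simpa using hχ1 y
            · exact hcomp y
        _ = _ := one_mul _
    · simp [hχ0 y hy]
  -- splitting of the Riesz kernel
  have hint₁ := hL''.integrable hfs.continuous.measurable (hl₁ j) x
  have hint₂ : Integrable fun h => (χ x * v x i - χ (x - h) * v (x - h) i) * κ₂ j h := by
    obtain ⟨B, hB⟩ := hfs.continuous.bounded_above_of_compact_support hχc.mul_right
    refine ((hi₂ j).norm.const_mul (2 * B)).mono' (Measurable.aestronglyMeasurable ?_)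
      (ae_of_all _ fun h => ?_)
    · have h1 := hfs.continuous.measurable
      have h2 := hm₂ j
      exact (measurable_const.sub (h1.comp (measurable_const.sub measurable_id))).mul h2
    · rw [norm_mul]
      refine mul_le_mul_of_nonneg_right ((norm_sub_le _ _).trans ?_) (norm_nonneg _)
      linarith [hB x, hB (x - h)]
  have hsplit : a₀ * kdiff (riesz s j) (fun y => χ y * v y i) x =
      (∫ h, (χ x * v x i - χ (x - h) * v (x - h) i) * κ₁ j h) +
      ∫ h, (χ x * v x i - χ (x - h) * v (x - h) i) * κ₂ j h := by
    rw [← integral_add hint₁ hint₂, kdiff, ← integral_const_mul]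
    congr 1; ext h
    simp only [hκ₂, vecKernel, riesz, PiLp.smul_apply, smul_eq_mul]
    ring
  have hint₃ := hL'.integrable hvs.continuous.measurable (hl₁ j) x
  have hint₄ : Integrable fun h => (χ x - χ (x - h)) * v (x - h) i * κ₁ j h := by
    have : (fun h => (χ x - χ (x - h)) * v (x - h) i * κ₁ j h) = fun h =>
        (χ x * v x i - χ (x - h) * v (x - h) i) * κ₁ j h -
          χ x * ((v x i - v (x - h) i) * κ₁ j h) := by
      ext h; ring
    rw [this]; exact hint₁.sub (hint₃.const_mul _)
  have hsplit₁ : ∫ h, (χ x * v x i - χ (x - h) * v (x - h) i) * κ₁ j h =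
      χ x * kdiff (κ₁ j) (fun y => v y i) x +
        ∫ h, (χ x - χ (x - h)) * v (x - h) i * κ₁ j h := by
    rw [kdiff, ← integral_const_mul, ← integral_add (hint₃.const_mul _) hint₄]
    congr 1; ext h; ring
  have e1 : ‖χ x * kdiff (κ₁ j) (fun y => v y i) x‖ₑ ≤ ENNReal.ofReal (cConst n s)⁻¹ *
      Ω.indicator (fun y => ‖smoothGrad s δ w v y‖ₑ) x := by
    by_cases hx : x ∈ Ω
    · rw [Set.indicator_of_mem hx, ← ofReal_norm, ← ofReal_norm,
        ← ENNReal.ofReal_mul (by positivity)]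
      refine ENNReal.ofReal_le_ofReal ?_
      have h1 := PiLp.norm_apply_le (smoothGrad s δ w v x) (i, j)
      rw [smoothGrad_apply hn hs1 hw hv, norm_mul, Real.norm_of_nonneg hc.le] at h1
      rw [norm_mul, inv_mul_eq_div, le_div_iff₀ hc]
      calc _ ≤ 1 * ‖kdiff (κ₁ j) (fun y => v y i) x‖ * cConst n s := by
            gcongr; exact hχ1 x
        _ ≤ _ := by rw [one_mul, mul_comm]; exact h1
    · simp [hχ0 x hx]
  have e2 : ‖∫ h, (χ x - χ (x - h)) * v (x - h) i * κ₁ j h‖ₑ ≤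
      ∫⁻ h, ENNReal.ofReal (L * (min 1 ‖h‖ * |κ₁ j h|)) * vt (x - h) := by
    refine (enorm_integral_le_lintegral_enorm _).trans (lintegral_mono fun h => ?_)
    by_cases hh : δ ≤ ‖h‖
    · simp [hκ₁, vecKernel_eq_zero hw hh]
    push Not at hh
    by_cases hm : x - h ∈ outer δ Ω
    · rw [hvt, Set.indicator_of_mem hm, enorm_mul, enorm_mul, mul_right_comm, ← enorm_mul]
      refine mul_le_mul' ?_ (hcomp _)
      rw [← ofReal_norm]
      exact ENNReal.ofReal_le_ofReal (hL.norm_mul_le (κ₁ j) x h)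
    · have hx : x ∉ Ω := fun hx => hm (sub_mem_outer hx hh)
      have hxh : x - h ∉ Ω := fun hx => hm (subset_outer hδ hx)
      simp [hχ0 _ hx, hχ0 _ hxh]
  have e3 : ‖∫ h, (χ x * v x i - χ (x - h) * v (x - h) i) * κ₂ j h‖ₑ ≤
      (∫⁻ h, K h) * vt x + ∫⁻ h, ‖κ₂ j h‖ₑ * vt (x - h) := by
    have hvtm : Measurable vt :=
      hv.smooth.continuous.measurable.enorm.indicator
        (Metric.isOpen_ball.add_left).measurableSet
    rw [← lintegral_mul_const _ hKm]
    rw [← lintegral_add_left (by fun_prop)]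
    refine (enorm_integral_le_lintegral_enorm _).trans (lintegral_mono fun h => ?_)
    have hKj : ‖κ₂ j h‖ₑ ≤ K h := by
      rw [hK]
      exact le_add_self.trans (Finset.single_le_sum
        (f := fun j => ENNReal.ofReal (L * (min 1 ‖h‖ * |κ₁ j h|)) + ‖κ₂ j h‖ₑ)
        (fun _ _ => zero_le) (Finset.mem_univ j))
    calc _ = ‖χ x * v x i - χ (x - h) * v (x - h) i‖ₑ * ‖κ₂ j h‖ₑ := enorm_mul _ _
      _ ≤ (vt x + vt (x - h)) * ‖κ₂ j h‖ₑ := by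
          gcongr
          exact (enorm_sub_le).trans (add_le_add (hχv x) (hχv _))
      _ = ‖κ₂ j h‖ₑ * vt x + ‖κ₂ j h‖ₑ * vt (x - h) := by ring
      _ ≤ _ := by gcongr
  have e4 : (∫⁻ h, ENNReal.ofReal (L * (min 1 ‖h‖ * |κ₁ j h|)) * vt (x - h)) +
      ∫⁻ h, ‖κ₂ j h‖ₑ * vt (x - h) ≤ ∫⁻ h, K h * vt (x - h) := by
    have hvtm : Measurable vt :=
      hv.smooth.continuous.measurable.enorm.indicator
        (Metric.isOpen_ball.add_left).measurableSet
    rw [← lintegral_add_left (by have := hmK₁ j; fun_prop)]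
    refine lintegral_mono fun h => ?_
    rw [← add_mul]
    gcongr
    exact Finset.single_le_sum
        (f := fun j => ENNReal.ofReal (L * (min 1 ‖h‖ * |κ₁ j h|)) + ‖κ₂ j h‖ₑ)
        (fun _ _ => zero_le) (Finset.mem_univ j)
  have key : kdiff (riesz s j) (fun y => χ y * v y i) x = a₀⁻¹ *
      (χ x * kdiff (κ₁ j) (fun y => v y i) x +
        (∫ h, (χ x - χ (x - h)) * v (x - h) i * κ₁ j h) +
      ∫ h, (χ x * v x i - χ (x - h) * v (x - h) i) * κ₂ j h) := by
    rw [← hsplit₁, ← hsplit, inv_mul_cancel_left₀ ha.ne']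
  set D := Ω.indicator (fun y => ‖smoothGrad s δ w v y‖ₑ) x with hD
  set J := ∫⁻ h, K h * vt (x - h) with hJ
  calc _ ≤ ENNReal.ofReal a₀⁻¹ * ((ENNReal.ofReal (cConst n s)⁻¹ * D +
        ∫⁻ h, ENNReal.ofReal (L * (min 1 ‖h‖ * |κ₁ j h|)) * vt (x - h)) +
        ((∫⁻ h, K h) * vt x + ∫⁻ h, ‖κ₂ j h‖ₑ * vt (x - h))) := by
        rw [key, enorm_mul, Real.enorm_of_nonneg (by positivity)]
        gcongr
        exact (enorm_add_le _ _).trans (add_le_add ((enorm_add_le _ _).trans (add_le_add e1 e2)) e3)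
    _ = ENNReal.ofReal a₀⁻¹ * ((ENNReal.ofReal (cConst n s)⁻¹ * D + (∫⁻ h, K h) * vt x) +
        ((∫⁻ h, ENNReal.ofReal (L * (min 1 ‖h‖ * |κ₁ j h|)) * vt (x - h)) +
          ∫⁻ h, ‖κ₂ j h‖ₑ * vt (x - h))) := by ring
    _ ≤ ENNReal.ofReal a₀⁻¹ * ((ENNReal.ofReal (cConst n s)⁻¹ * D + (∫⁻ h, K h) * vt x) + J) := by
        gcongr
    _ ≤ ENNReal.ofReal a₀⁻¹ * ((1 + ENNReal.ofReal (cConst n s)⁻¹ + ∫⁻ z, K z) * D +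
          (1 + ENNReal.ofReal (cConst n s)⁻¹ + ∫⁻ z, K z) * vt x +
          (1 + ENNReal.ofReal (cConst n s)⁻¹ + ∫⁻ z, K z) * J) := by
        gcongr
        · exact le_add_right le_add_self
        · exact le_add_self
        · exact le_mul_of_one_le_left zero_le (le_add_right le_self_add)
    _ = _ := by rw [hM]; ring

/-! ### Approximation by potentials -/

/-- Sequences converging in `Lᵖ` of a finite measure are eventually bounded in `L¹` and in `Lᵖ`. -/
lemma eventually_lintegral_le {F : Type*} [NormedAddCommGroup F] (hp : 1 < p)
    {μ : Measure (Vec n)} [IsFiniteMeasure μ] {f : ℕ → Vec n → F} {g : Vec n → F}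
    (hf : ∀ k, AEStronglyMeasurable (f k) μ) (hg : MemLp g (ENNReal.ofReal p) μ)
    (h : Tendsto (fun k => eLpNorm (f k - g) (ENNReal.ofReal p) μ) atTop (𝓝 0)) :
    ∃ N : ℝ≥0, ∀ᶠ k in atTop, ∫⁻ x, ‖f k x‖ₑ ∂μ ≤ N ∧ ∫⁻ x, ‖f k x‖ₑ ^ p ∂μ ≤ N := by
  have hp0 : 0 < p := by linarith
  set B : ℝ≥0∞ := (1 + eLpNorm g (ENNReal.ofReal p) μ) ^ p with hB
  have hBt : B ≠ ⊤ := ENNReal.rpow_ne_top_of_nonneg hp0.le (by have := hg.2.ne; finiteness)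
  have hB1 : 1 ≤ B := ENNReal.one_le_rpow le_self_add hp0
  have hμ : μ Set.univ ≠ ⊤ := measure_ne_top _ _
  refine ⟨(μ Set.univ + B).toNNReal, ?_⟩
  filter_upwards [h.eventually_le_const one_pos] with k hk
  rw [ENNReal.coe_toNNReal (by finiteness)]
  have h1 : eLpNorm (f k) (ENNReal.ofReal p) μ ≤ 1 + eLpNorm g (ENNReal.ofReal p) μ := by
    have := eLpNorm_add_le ((hf k).sub hg.1) hg.1 (one_le_ofReal hp)
    rw [sub_add_cancel] at this
    exact this.trans (by gcongr)
  have h2 : ∫⁻ x, ‖f k x‖ₑ ^ p ∂μ ≤ B := by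
    have e := eLpNorm_eq_lintegral_rpow_enorm_toReal (f := f k) (μ := μ)
      (p := ENNReal.ofReal p) (by simpa using hp0) ENNReal.ofReal_ne_top
    rw [ENNReal.toReal_ofReal hp0.le] at e
    calc _ = eLpNorm (f k) (ENNReal.ofReal p) μ ^ p := by
          rw [e, ← ENNReal.rpow_mul, one_div_mul_cancel hp0.ne', ENNReal.rpow_one]
      _ ≤ B := ENNReal.rpow_le_rpow h1 hp0.le
  refine ⟨?_, h2.trans le_add_self⟩
  calc _ ≤ ∫⁻ x, (1 + ‖f k x‖ₑ ^ p) ∂μ := by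
        refine lintegral_mono fun x => ?_
        rcases le_total ‖f k x‖ₑ 1 with h | h
        · exact h.trans le_self_add
        · refine le_trans ?_ le_add_self
          nth_rewrite 1 [← ENNReal.rpow_one ‖f k x‖ₑ]
          exact ENNReal.rpow_le_rpow_of_exponent_le h hp.le
    _ ≤ _ := by
        rw [lintegral_add_left measurable_const, lintegral_const, one_mul]
        gcongr

/-- Functions of `MemH` are, on `shrunk δ Ω`, limits almost everywhere of functions dominated by
Riesz potentials of densities that are bounded in `L¹` and in `Lᵖ`. -/
lemma MemH.exists_approximation (hn : 1 ≤ n) (hs0 : 0 < s) (hs1 : s < 1) (hp : 1 < p) (hδ : 0 < δ)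
    (hw : IsCutoff δ w) (hΩo : IsOpen Ω) (hΩb : Bornology.IsBounded Ω) {u : Vec n → Vec n}
    (hu : MemH s p δ w Ω u) :
    ∃ (C N : ℝ≥0) (f : ℕ → Fin n → Vec n → ℝ) (G : ℕ → Vec n → ℝ≥0∞),
      (∀ k i, Measurable (f k i)) ∧ (∀ k, Measurable (G k)) ∧ (∀ k, ∫⁻ x, G k x ≤ N) ∧
      (∀ k, ∫⁻ x, G k x ^ p ≤ N) ∧ (∀ k i x, ‖f k i x‖ₑ ≤ C * potential s (G k) x) ∧
      ∀ᵐ x ∂(volume.restrict (shrunk δ Ω)), ∀ i, Tendsto (fun k => f k i x) atTop (𝓝 (u x i)) := by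
  have hp0 : 0 < p := by linarith
  have := isFiniteMeasure_restrict hΩb
  have := isFiniteMeasure_restrict (isBounded_outer (δ := δ) hΩb)
  obtain ⟨hu1, hu2, v, hv, hv1, hv2⟩ := hu
  obtain ⟨χ, hχ, hχc, hχ0, hχ1, hχb⟩ := exists_cutoff hδ hΩo hΩb
  obtain ⟨A, K, hK, hKt, hloc⟩ := exists_localization hn hs0 hs1 hδ hw hχ hχc hχ0 hχb
  obtain ⟨C, hC⟩ := exists_abs_le_rieszPotential hn hs0 hs1
  obtain ⟨N₁, hN₁⟩ := eventually_lintegral_le hp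
    (fun k => (hv k).smooth.continuous.aestronglyMeasurable) hu1 hv1
  obtain ⟨N₂, hN₂⟩ := eventually_lintegral_le hp
    (fun k => (measurable_smoothGrad hn hs1 hw (hv k)).aestronglyMeasurable) hu2 hv2
  obtain ⟨k₀, hk₀⟩ := eventually_atTop.1 (hN₁.and hN₂)
  obtain ⟨ns, hns, hlim⟩ := (tendstoInMeasure_of_tendsto_eLpNorm (by simpa using by linarith)
    (fun k => (hv k).smooth.continuous.aestronglyMeasurable) hu1.1 hv1).exists_seq_tendsto_ae
  set m : ℕ → ℕ := fun k => ns (k + k₀) with hm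
  have hmk : ∀ k, k₀ ≤ m k := fun k => (Nat.le_add_left k₀ k).trans hns.le_apply
  set g₁ : ℕ → Vec n → ℝ≥0∞ := fun k => Ω.indicator (fun y => ‖smoothGrad s δ w (v (m k)) y‖ₑ)
    with hg₁
  set g₂ : ℕ → Vec n → ℝ≥0∞ := fun k => (outer δ Ω).indicator (fun y => ‖v (m k) y‖ₑ) with hg₂
  have mg₁ : ∀ k, Measurable (g₁ k) := fun k =>
    (measurable_smoothGrad hn hs1 hw (hv _)).enorm.indicator hΩo.measurableSet
  have mg₂ : ∀ k, Measurable (g₂ k) := fun k =>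
    (hv _).smooth.continuous.measurable.enorm.indicator (isOpen_outer hΩo).measurableSet
  set g₃ : ℕ → Vec n → ℝ≥0∞ := fun k x => ∫⁻ z, K z * g₂ k (x - z) with hg₃
  have mg₃ : ∀ k, Measurable (g₃ k) := fun k => by
    have := mg₂ k
    exact Measurable.lintegral_prod_right' (f := fun z : Vec n × Vec n =>
          K z.2 * g₂ k (z.1 - z.2)) (by fun_prop)
  set IK := ∫⁻ z, K z with hIK
  have ig : ∀ {B : Set (Vec n)} {g : Vec n → ℝ≥0∞}, MeasurableSet B →
      ∫⁻ x, B.indicator g x = ∫⁻ x in B, g x := fun hB => lintegral_indicator hB _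
  have igp : ∀ {B : Set (Vec n)} {g : Vec n → ℝ≥0∞}, MeasurableSet B →
      ∫⁻ x, B.indicator g x ^ p = ∫⁻ x in B, g x ^ p := fun {B g} hB => by
    rw [← lintegral_indicator hB]
    congr 1; ext x
    by_cases hx : x ∈ B <;> simp [hx, hp0]
  have b1 : ∀ k, ∫⁻ x, g₁ k x ≤ N₂ := fun k => by
    rw [hg₁, ig hΩo.measurableSet]; exact (hk₀ _ (hmk k)).2.1
  have b1p : ∀ k, ∫⁻ x, g₁ k x ^ p ≤ N₂ := fun k => by
    rw [hg₁, igp hΩo.measurableSet]; exact (hk₀ _ (hmk k)).2.2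
  have b2 : ∀ k, ∫⁻ x, g₂ k x ≤ N₁ := fun k => by
    rw [hg₂, ig (isOpen_outer hΩo).measurableSet]; exact (hk₀ _ (hmk k)).1.1
  have b2p : ∀ k, ∫⁻ x, g₂ k x ^ p ≤ N₁ := fun k => by
    rw [hg₂, igp (isOpen_outer hΩo).measurableSet]; exact (hk₀ _ (hmk k)).1.2
  have b3 : ∀ k, ∫⁻ x, g₃ k x ≤ IK * N₁ := fun k => by
    rw [hg₃, lintegral_lintegral_mul_sub K _ hK (mg₂ k)]; gcongr; exact b2 k
  have b3p : ∀ k, ∫⁻ x, g₃ k x ^ p ≤ IK ^ p * N₁ := fun k =>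
    (lintegral_rpow_lintegral_mul_sub_le hp K _ hK (mg₂ k)).trans (by gcongr; exact b2p k)
  have h2p : (2 : ℝ≥0∞) ^ (p - 1) ≠ ⊤ := ENNReal.rpow_ne_top_of_nonneg (by linarith) (by simp)
  have hIKp : IK ^ p ≠ ⊤ := ENNReal.rpow_ne_top_of_nonneg hp0.le hKt
  set N : ℝ≥0∞ := (N₂ + N₁ + IK * N₁) +
    2 ^ (p - 1) * (2 ^ (p - 1) * (N₂ + N₁) + IK ^ p * N₁) with hN
  have hNt : N ≠ ⊤ := by finiteness
  refine ⟨C * n * A, N.toNNReal, fun k i y => χ y * v (m k) y i,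
    fun k x => g₁ k x + g₂ k x + g₃ k x, fun k i => ?_, fun k => ?_, fun k => ?_, fun k => ?_,
    fun k i x => ?_, ?_⟩
  · exact (hχ.continuous.mul ((hv (m k)).comp i).1.continuous).measurable
  · have := mg₁ k; have := mg₂ k; have := mg₃ k
    fun_prop
  · rw [ENNReal.coe_toNNReal hNt, lintegral_add_right _ (mg₃ k), lintegral_add_right _ (mg₂ k)]
    exact (add_le_add (add_le_add (b1 k) (b2 k)) (b3 k)).trans le_self_add
  · rw [ENNReal.coe_toNNReal hNt]
    have := mg₁ k; have := mg₂ k; have := mg₃ k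
    calc _ ≤ ∫⁻ x, 2 ^ (p - 1) * (2 ^ (p - 1) * (g₁ k x ^ p + g₂ k x ^ p) + g₃ k x ^ p) := by
          refine lintegral_mono fun x => ?_
          refine (ENNReal.rpow_add_le_mul_rpow_add_rpow _ _ hp.le).trans ?_
          gcongr
          exact ENNReal.rpow_add_le_mul_rpow_add_rpow _ _ hp.le
      _ = 2 ^ (p - 1) * (2 ^ (p - 1) * ((∫⁻ x, g₁ k x ^ p) + ∫⁻ x, g₂ k x ^ p) +
            ∫⁻ x, g₃ k x ^ p) := by
          rw [lintegral_const_mul' _ _ h2p, lintegral_add_right _ (by fun_prop),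
            lintegral_const_mul' _ _ h2p, lintegral_add_right _ (by fun_prop)]
      _ ≤ 2 ^ (p - 1) * (2 ^ (p - 1) * (N₂ + N₁) + IK ^ p * N₁) := by
          gcongr
          · exact b1p k
          · exact b2p k
          · exact b3p k
      _ ≤ _ := le_add_self
  · refine (hC _ (hχ.mul ((hv (m k)).comp i).1) hχc.mul_right x).trans ?_
    calc _ ≤ C * ∑ j : Fin n, A * potential s (fun x => g₁ k x + g₂ k x + g₃ k x) x := by
          gcongr with j
          rw [potential, ← lintegral_const_mul' _ _ ENNReal.coe_ne_top]
          refine lintegral_mono fun z => ?_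
          rw [mul_left_comm]
          gcongr
          exact hloc _ (hv (m k)) i j (x - z)
      _ = _ := by
          rw [Finset.sum_const, Finset.card_univ, Fintype.card_fin, nsmul_eq_mul]
          push_cast; ring
  · have h1 : ∀ᵐ x ∂(volume.restrict (shrunk δ Ω)), Tendsto (fun k => v (ns k) x) atTop (𝓝 (u x)) :=
      ae_restrict_of_ae_restrict_of_subset (shrunk_subset.trans (subset_outer hδ)) hlim
    filter_upwards [h1, ae_restrict_mem (isOpen_shrunk hΩo).measurableSet] with x hx hxs i
    simp only [hχ1 x hxs, one_mul]
    have h2 := hx.comp (tendsto_add_atTop_nat k₀)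
    exact ((EuclideanSpace.proj (𝕜 := ℝ) i).continuous.tendsto _).comp h2

/-! ### Embeddings of the nonlocal Sobolev space -/

lemma norm_le_sum_abs (y : Vec n) : ‖y‖ ≤ ∑ i, |y i| := by
  have h : y = ∑ i, y i • EuclideanSpace.single i (1 : ℝ) := by
    ext j; simp [Pi.single_apply]
  calc ‖y‖ = ‖∑ i, y i • EuclideanSpace.single i (1 : ℝ)‖ := by rw [← h]
    _ ≤ ∑ i, ‖y i • EuclideanSpace.single i (1 : ℝ)‖ := norm_sum_le _ _
    _ = _ := by simp [norm_smul]

/-- Fatou's lemma along an approximating sequence. -/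
lemma lintegral_le_of_tendsto {A : Set (Vec n)} {f : ℕ → Vec n → ℝ} {g : Vec n → ℝ}
    (hf : ∀ k, Measurable (f k)) {Φ : ℝ → ℝ≥0∞} (hΦ : Continuous Φ) {N : ℝ≥0∞}
    (hlim : ∀ᵐ x ∂(volume.restrict A), Tendsto (fun k => f k x) atTop (𝓝 (g x)))
    (hN : ∀ k, ∫⁻ x in A, Φ (f k x) ≤ N) : ∫⁻ x in A, Φ (g x) ≤ N := by
  calc _ = ∫⁻ x in A, liminf (fun k => Φ (f k x)) atTop := by
        refine lintegral_congr_ae ?_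
        filter_upwards [hlim] with x hx
        exact (((hΦ.tendsto _).comp hx).liminf_eq).symm
    _ ≤ liminf (fun k => ∫⁻ x in A, Φ (f k x)) atTop :=
        lintegral_liminf_le fun k => hΦ.measurable.comp (hf k)
    _ ≤ N := liminf_le_of_le (by isBoundedDefault) fun b hb => by
        obtain ⟨k, hk⟩ := hb.exists
        exact hk.trans (hN k)

/-- The Sobolev embedding. -/
lemma MemH.memLp_of_subcritical (hn : 1 ≤ n) (hs0 : 0 < s) (hs1 : s < 1) (hp : 1 < p) (hδ : 0 < δ)
    (hsp : s * p < n)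
    (hw : IsCutoff δ w) (hΩo : IsOpen Ω) (hΩb : Bornology.IsBounded Ω) {u : Vec n → Vec n}
    (hu : MemH s p δ w Ω u) :
    MemLp u (ENNReal.ofReal (n * p / (n - s * p))) (volume.restrict (shrunk δ Ω)) := by
  have hn0 : (0 : ℝ) < n := by exact_mod_cast hn
  have hr : 0 < n * p / (n - s * p) := div_pos (mul_pos hn0 (by linarith)) (by linarith)
  obtain ⟨C, N, f, G, hf, hG, h1, h2, h3, h4⟩ :=
    hu.exists_approximation hn hs0 hs1 hp hδ hw hΩo hΩb
  obtain ⟨N', hN'⟩ := exists_lintegral_le_of_subcritical hn hs0 hs1 hp hsp C N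
    (A := shrunk δ Ω) (hΩb.subset shrunk_subset).measure_lt_top.ne
  refine MemLp.of_eval_piLp fun i => ?_
  have hm : AEStronglyMeasurable u (volume.restrict (shrunk δ Ω)) :=
    (hu.1.1).mono_measure (Measure.restrict_mono (shrunk_subset.trans (subset_outer hδ)) le_rfl)
  have hmi : AEStronglyMeasurable (fun x => u x i) (volume.restrict (shrunk δ Ω)) :=
    (EuclideanSpace.proj (𝕜 := ℝ) i).continuous.comp_aestronglyMeasurable hm
  refine ⟨hmi, ?_⟩
  rw [eLpNorm_lt_top_iff_lintegral_rpow_enorm_lt_top (by simpa using hr) ENNReal.ofReal_ne_top,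
    ENNReal.toReal_ofReal hr.le]
  refine lt_of_le_of_lt ?_ (ENNReal.coe_lt_top (r := N'))
  exact lintegral_le_of_tendsto (f := fun k => f k i) (fun k => hf k i)
    (Φ := fun t => ‖t‖ₑ ^ (n * p / (n - s * p)))
    ((ENNReal.continuous_rpow_const).comp continuous_enorm)
    (h4.mono fun x hx => hx i) fun k => hN' (G k) (hG k) (h1 k) (h2 k) _ (h3 k i)

/-- The Trudinger–Moser embedding, below the critical exponent and hence with any constant `k`. -/
lemma MemH.lintegral_exp_lt_top (hn : 1 ≤ n) (hs0 : 0 < s) (hs1 : s < 1) (hp : 1 < p) (hδ : 0 < δ)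
    (hsp : s * p = n)
    (hw : IsCutoff δ w) (hΩo : IsOpen Ω) (hΩb : Bornology.IsBounded Ω) {u : Vec n → Vec n}
    (hu : MemH s p δ w Ω u) {k r : ℝ} (hk : 0 ≤ k) (hr : 0 < r) (hrp : r < p / (p - 1)) :
    ∫⁻ x in shrunk δ Ω, ENNReal.ofReal (Real.exp (k * ‖u x‖ ^ r)) < ⊤ := by
  have hn0 : (0 : ℝ) < n := by exact_mod_cast hn
  have : Nonempty (Fin n) := ⟨⟨0, hn⟩⟩
  obtain ⟨C, N, f, G, hf, hG, h1, h2, h3, h4⟩ :=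
    hu.exists_approximation hn hs0 hs1 hp hδ hw hΩo hΩb
  obtain ⟨N', hN'⟩ := exists_lintegral_le_of_critical hn hs0 hs1 hp hsp C N
    (A := shrunk δ Ω) (hΩb.subset shrunk_subset).measure_lt_top.ne
    (k := k * n ^ r) (by positivity) hr hrp
  have hm : AEStronglyMeasurable u (volume.restrict (shrunk δ Ω)) :=
    (hu.1.1).mono_measure (Measure.restrict_mono (shrunk_subset.trans (subset_outer hδ)) le_rfl)
  set Φ : ℝ → ℝ≥0∞ := fun t => ENNReal.ofReal (Real.exp (k * n ^ r * |t| ^ r)) with hΦ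
  have hΦc : Continuous Φ := by
    refine ENNReal.continuous_ofReal.comp (Real.continuous_exp.comp (continuous_const.mul ?_))
    exact (Real.continuous_rpow_const hr.le).comp continuous_abs
  calc _ ≤ ∫⁻ x in shrunk δ Ω, ∑ i, Φ (u x i) := by
        refine lintegral_mono fun x => ?_
        obtain ⟨i, -, hi⟩ := Finset.exists_max_image Finset.univ (fun i => |u x i|)
          Finset.univ_nonempty
        refine le_trans ?_ (Finset.single_le_sum (f := fun i => Φ (u x i))
          (fun _ _ => zero_le) (Finset.mem_univ i))
        refine ENNReal.ofReal_le_ofReal (Real.exp_le_exp.2 ?_)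
        rw [mul_assoc, ← Real.mul_rpow (by positivity) (abs_nonneg _)]
        gcongr
        refine (norm_le_sum_abs _).trans ((Finset.sum_le_card_nsmul _ _ _ hi).trans ?_)
        simp
    _ = ∑ i, ∫⁻ x in shrunk δ Ω, Φ (u x i) := lintegral_finsetSum' _ fun i _ =>
        hΦc.measurable.comp_aemeasurable
          ((EuclideanSpace.proj (𝕜 := ℝ) i).continuous.measurable.comp_aemeasurable hm.aemeasurable)
    _ ≤ ∑ _i : Fin n, (N' : ℝ≥0∞) := by
        gcongr with i
        exact lintegral_le_of_tendsto (f := fun k => f k i) (fun k => hf k i) hΦc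
          (h4.mono fun x hx => hx i) fun k => hN' (G k) (hG k) (h1 k) (h2 k) _ (h3 k i)
    _ < ⊤ := by simp [ENNReal.mul_lt_top_iff]

/-- The Morrey embedding, with boundedness as its conclusion. -/
lemma MemH.exists_norm_le_of_supercritical (hn : 1 ≤ n) (hs0 : 0 < s) (hs1 : s < 1) (hp : 1 < p)
    (hδ : 0 < δ) (hsp : (n : ℝ) < s * p)
    (hw : IsCutoff δ w) (hΩo : IsOpen Ω) (hΩb : Bornology.IsBounded Ω) {u : Vec n → Vec n}
    (hu : MemH s p δ w Ω u) : ∃ B : ℝ, ∀ᵐ x ∂(volume.restrict (shrunk δ Ω)), ‖u x‖ ≤ B := by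
  obtain ⟨C, N, f, G, hf, hG, h1, h2, h3, h4⟩ :=
    hu.exists_approximation hn hs0 hs1 hp hδ hw hΩo hΩb
  obtain ⟨N', hN'⟩ := exists_enorm_le_of_supercritical hn hs1 hp hsp C N
  refine ⟨n * N', ?_⟩
  filter_upwards [h4] with x hx
  have : ∀ i, |u x i| ≤ N' := fun i => by
    refine le_of_tendsto (hx i).abs (Eventually.of_forall fun k => ?_)
    have := hN' (G k) (hG k) (h1 k) (h2 k) _ (h3 k i) x
    rwa [enorm_le_coe] at this
  calc _ ≤ ∑ i, |u x i| := norm_le_sum_abs _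
    _ ≤ ∑ _i : Fin n, (N' : ℝ) := Finset.sum_le_sum fun i _ => this i
    _ = _ := by simp

end NonlocalEL

namespace NonlocalEL

variable {n : ℕ} {s p δ : ℝ} {w : Vec n → ℝ} {Ω : Set (Vec n)}

/-! ### Superposition with Carathéodory functions -/

/-- Carathéodory functions preserve measurability under superposition. -/
lemma aemeasurable_superposition {X E : Type*} [MeasurableSpace X] [TopologicalSpace E]
    {μ : Measure X} {f : X → E → ℝ}
    (hf : ∀ e, AEMeasurable (fun x => f x e) μ) (hc : ∀ᵐ x ∂μ, Continuous (f x)) {z : X → E}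
    (hz : AEStronglyMeasurable z μ) : AEMeasurable (fun x => f x (z x)) μ := by
  obtain ⟨z', hz', hzz'⟩ := hz
  refine AEMeasurable.congr ?_ (f := fun x => f x (z' x)) (by
    filter_upwards [hzz'] with x hx; rw [hx])
  refine aemeasurable_of_tendsto_metrizable_ae atTop (f := fun k x => f x (hz'.approx k x))
    (fun k => ?_) ?_
  · have e : (fun x => f x (hz'.approx k x)) = fun x => ∑ e ∈ (hz'.approx k).range,
        ((hz'.approx k) ⁻¹' {e}).indicator (fun x => f x e) x := by
      funext x
      rw [Finset.sum_eq_single (hz'.approx k x)]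
      · rw [Set.indicator_of_mem (by simp)]
      · intro e _ he
        rw [Set.indicator_of_notMem]
        simpa using Ne.symm he
      · intro h
        exact absurd (SimpleFunc.mem_range_self _ x) h
    rw [e]
    exact Finset.aemeasurable_fun_sum _ fun e _ =>
      (hf e).indicator ((hz'.approx k).measurableSet_preimage _)
  · filter_upwards [hc] with x hx
    exact (hx.tendsto _).comp (hz'.tendsto_approx x)

/-- The derivative of `W(x, ·, ·)` at `z` in the direction `ζ`. -/
noncomputable def dirDeriv (W : Vec n → Vec n → Mat n → ℝ) (x : Vec n) (z ζ : Vec n × Mat n) : ℝ :=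
  inner ℝ (dY W x z.1 z.2) ζ.1 + inner ℝ (dF W x z.1 z.2) ζ.2

lemma hasDerivAt_dirDeriv {W : Vec n → Vec n → Mat n → ℝ} {x : Vec n}
    (hW : ContDiff ℝ 1 (fun z : Vec n × Mat n => W x z.1 z.2)) (z ζ : Vec n × Mat n) (t : ℝ) :
    HasDerivAt (fun t : ℝ => W x (z + t • ζ).1 (z + t • ζ).2) (dirDeriv W x (z + t • ζ) ζ) t := by
  set f : Vec n × Mat n → ℝ := fun z => W x z.1 z.2 with hf
  set q := z + t • ζ with hq
  have hd : HasFDerivAt f (fderiv ℝ f q) q := (hW.differentiable (by simp) q).hasFDerivAt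
  have h1 : HasFDerivAt (fun y => W x y q.2) ((fderiv ℝ f q).comp (.inl ℝ (Vec n) (Mat n))) q.1 :=
    HasFDerivAt.comp (g := f) (f := fun y => (y, q.2)) q.1 hd
      (hasFDerivAt_prodMk_left (𝕜 := ℝ) q.1 q.2)
  have h2 : HasFDerivAt (fun F => W x q.1 F) ((fderiv ℝ f q).comp (.inr ℝ (Vec n) (Mat n))) q.2 :=
    HasFDerivAt.comp (g := f) (f := fun F => (q.1, F)) q.2 hd
      (hasFDerivAt_prodMk_right (𝕜 := ℝ) q.1 q.2)
  have e : dirDeriv W x q ζ = fderiv ℝ f q ζ := by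
    rw [dirDeriv, dY, dF, gradient, gradient, h1.fderiv, h2.fderiv,
      InnerProductSpace.toDual_symm_apply, InnerProductSpace.toDual_symm_apply,
      ContinuousLinearMap.comp_apply, ContinuousLinearMap.comp_apply, ← map_add]
    simp
  rw [e]
  have hl : HasDerivAt (fun t : ℝ => z + t • ζ) ζ t := by
    simpa using ((hasDerivAt_id t).smul_const ζ).const_add z
  exact HasFDerivAt.comp_hasDerivAt (l := f) t hd hl

lemma abs_dirDeriv_le (W : Vec n → Vec n → Mat n → ℝ) (x : Vec n) (z ζ : Vec n × Mat n) :
    |dirDeriv W x z ζ| ≤ (|W x z.1 z.2| + ‖dY W x z.1 z.2‖ + ‖dF W x z.1 z.2‖) *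
      (‖ζ.1‖ + ‖ζ.2‖) := by
  have h1 := abs_real_inner_le_norm (dY W x z.1 z.2) ζ.1
  have h2 := abs_real_inner_le_norm (dF W x z.1 z.2) ζ.2
  have h3 := abs_add_le (inner ℝ (dY W x z.1 z.2) ζ.1) (inner ℝ (dF W x z.1 z.2) ζ.2)
  have := abs_nonneg (W x z.1 z.2)
  rw [dirDeriv]
  nlinarith [norm_nonneg (dY W x z.1 z.2), norm_nonneg (dF W x z.1 z.2), norm_nonneg ζ.1,
    norm_nonneg ζ.2, mul_nonneg this (norm_nonneg ζ.1), mul_nonneg this (norm_nonneg ζ.2),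
    mul_nonneg (norm_nonneg (dY W x z.1 z.2)) (norm_nonneg ζ.2),
    mul_nonneg (norm_nonneg (dF W x z.1 z.2)) (norm_nonneg ζ.1)]

section Superposition

variable {W : Vec n → Vec n → Mat n → ℝ} {μ : Measure (Vec n)}

lemma aemeasurable_comp_pair (hWm : ∀ y F, AEMeasurable (fun x => W x y F) μ)
    (hW : ∀ᵐ x ∂μ, ContDiff ℝ 1 (fun z : Vec n × Mat n => W x z.1 z.2))
    {z : Vec n → Vec n × Mat n} (hz : AEStronglyMeasurable z μ) :
    AEMeasurable (fun x => W x (z x).1 (z x).2) μ :=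
  aemeasurable_superposition (f := fun x z => W x z.1 z.2) (fun e => hWm e.1 e.2)
    (hW.mono fun _ hx => hx.continuous) hz

/-- Directional derivatives are limits of difference quotients, hence measurable. -/
lemma aemeasurable_dirDeriv (hWm : ∀ y F, AEMeasurable (fun x => W x y F) μ)
    (hW : ∀ᵐ x ∂μ, ContDiff ℝ 1 (fun z : Vec n × Mat n => W x z.1 z.2))
    {z ζ : Vec n → Vec n × Mat n} (hz : AEStronglyMeasurable z μ)
    (hζ : AEStronglyMeasurable ζ μ) :
    AEMeasurable (fun x => dirDeriv W x (z x) (ζ x)) μ := by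
  set t : ℕ → ℝ := fun k => 1 / ((k : ℝ) + 1) with ht
  have ht0 : Tendsto t atTop (𝓝[≠] 0) := by
    refine tendsto_nhdsWithin_iff.2 ⟨tendsto_one_div_add_atTop_nhds_zero_nat, ?_⟩
    exact Eventually.of_forall fun k => (Nat.one_div_pos_of_nat (α := ℝ)).ne'
  refine aemeasurable_of_tendsto_metrizable_ae atTop (f := fun k x =>
    (t k)⁻¹ • (W x (z x + t k • ζ x).1 (z x + t k • ζ x).2 - W x (z x).1 (z x).2))
    (fun k => ?_) ?_
  · exact ((aemeasurable_comp_pair hWm hW (hz.add (hζ.const_smul (t k)))).sub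
      (aemeasurable_comp_pair hWm hW hz)).const_mul (t k)⁻¹
  · filter_upwards [hW] with x hx
    have h := (hasDerivAt_iff_tendsto_slope_zero.1 (hasDerivAt_dirDeriv hx (z x) (ζ x) 0)).comp ht0
    simpa [Function.comp_def] using h

end Superposition

/-! ### Domination along a line of competitors -/

lemma add_rpow_le_two_rpow_mul {a b r : ℝ} (ha : 0 ≤ a) (hb : 0 ≤ b) (hr : 0 ≤ r) :
    (a + b) ^ r ≤ 2 ^ r * (a ^ r + b ^ r) := by
  have h1 : a + b ≤ 2 * max a b := by linarith [le_max_left a b, le_max_right a b]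
  calc (a + b) ^ r ≤ (2 * max a b) ^ r := by gcongr
    _ = 2 ^ r * (max a b) ^ r := Real.mul_rpow (by norm_num) (le_max_of_le_left ha)
    _ ≤ _ := by
      gcongr
      rcases le_total a b with h | h
      · rw [max_eq_right h]; linarith [Real.rpow_nonneg ha r]
      · rw [max_eq_left h]; linarith [Real.rpow_nonneg hb r]

lemma MemLp.integrable_norm_rpow_ofReal {F : Type*} [NormedAddCommGroup F] {μ : Measure (Vec n)}
    {f : Vec n → F} {r : ℝ} (hr : 0 < r) (hf : MemLp f (ENNReal.ofReal r) μ) :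
    Integrable (fun x => ‖f x‖ ^ r) μ := by
  have := hf.integrable_norm_rpow (by simpa using hr) ENNReal.ofReal_ne_top
  rwa [ENNReal.toReal_ofReal hr.le] at this

/-- Powers of `‖y + t η‖` are dominated uniformly in `|t| ≤ 1` if `η` is bounded by `B`. -/
lemma norm_add_smul_rpow_le {F : Type*} [NormedAddCommGroup F] [NormedSpace ℝ F] {y η : F} {B r t : ℝ}
    (hη : ‖η‖ ≤ B) (ht : |t| ≤ 1) (hr : 0 ≤ r) :
    ‖y + t • η‖ ^ r ≤ 2 ^ r * (‖y‖ ^ r + B ^ r) := by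
  have hB : 0 ≤ B := (norm_nonneg _).trans hη
  refine le_trans (Real.rpow_le_rpow (norm_nonneg _) ?_ hr)
    (add_rpow_le_two_rpow_mul (norm_nonneg y) hB hr)
  refine (norm_add_le _ _).trans ?_
  rw [norm_smul, Real.norm_eq_abs]
  nlinarith [norm_nonneg η, abs_nonneg t]

/-- The growth conditions, together with the embeddings, give an integrable bound of `W`, `D_y W`
and `D_F W` along `u + t φ`, `|t| ≤ 1`. Off `shrunk δ Ω` the integrability is that of `u₀`. -/
lemma exists_dominating (hn : 1 ≤ n) (hs0 : 0 < s) (hs1 : s < 1) (hp : 1 < p) (hδ : 0 < δ)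
    (hw : IsCutoff δ w) (hΩo : IsOpen Ω) (hΩb : Bornology.IsBounded Ω)
    {W : Vec n → Vec n → Mat n → ℝ} {u₀ u : Vec n → Vec n} {c : ℝ} {a : Vec n → ℝ} (hc : 0 < c)
    (ha : IntegrableOn a Ω) (hW : GrowthCondition s p δ Ω W u₀ c a)
    (hu : MemH s p δ w Ω u) (huu : MemH0 s p δ w Ω (u - u₀)) {φ : Vec n → Vec n}
    {Φ : Vec n → Mat n} {B : ℝ} (hφB : ∀ x, ‖φ x‖ ≤ B) (hΦB : ∀ x, ‖Φ x‖ ≤ B)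
    (hφ : ∀ x, x ∉ shrunk δ Ω → φ x = 0) :
    ∃ g : Vec n → ℝ, IntegrableOn g Ω ∧ ∀ᵐ x ∂(volume.restrict Ω), ∀ t : ℝ, |t| ≤ 1 →
      |W x (u x + t • φ x) (nonlocalGrad s δ w Ω u x + t • Φ x)| +
        ‖dY W x (u x + t • φ x) (nonlocalGrad s δ w Ω u x + t • Φ x)‖ +
        ‖dF W x (u x + t • φ x) (nonlocalGrad s δ w Ω u x + t • Φ x)‖ ≤ g x := by
  have hp0 : 0 < p := by linarith
  have := isFiniteMeasure_restrict hΩb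
  have hSo := (isOpen_shrunk (δ := δ) hΩo).measurableSet
  have hSΩ : shrunk δ Ω ⊆ Ω := shrunk_subset
  have hcompl : Ω \ shrunk δ Ω ⊆ outer δ Ω := Set.sdiff_subset.trans (subset_outer hδ)
  have hun : shrunk δ Ω ∪ Ω \ shrunk δ Ω = Ω := Set.union_sdiff_cancel hSΩ
  have hB : 0 ≤ B := (norm_nonneg _).trans (hφB 0)
  set U := nonlocalGrad s δ w Ω u with hU
  -- outside the inner domain, `u` has the prescribed values
  have hoff : ∀ᵐ x ∂(volume.restrict Ω), x ∉ shrunk δ Ω → u x = u₀ x := by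
    filter_upwards [ae_restrict_of_ae_restrict_of_subset (subset_outer hδ) (huu.ae_eq_zero hp)]
      with x hx hxs
    exact sub_eq_zero.1 (hx hxs)
  have hoff' : ∀ᵐ x ∂(volume.restrict (Ω \ shrunk δ Ω)), u x = u₀ x := by
    filter_upwards [ae_restrict_of_ae_restrict_of_subset Set.sdiff_subset hoff,
      ae_restrict_mem (hΩo.measurableSet.diff hSo)] with x hx hxs
    exact hx hxs.2
  have hUp : IntegrableOn (fun x => c * (2 ^ p * (‖U x‖ ^ p + B ^ p))) Ω :=
    (((MemLp.integrable_norm_rpow_ofReal hp0 hu.2.1).add (integrable_const _)).const_mul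
      _).const_mul _
  -- it suffices to dominate the part of the bound that depends on `y`
  have main : ∀ b : ℝ≥0 → ℝ, GrowthBound Ω W (fun x Y Z => a x + b Y + c * (Z : ℝ) ^ p) →
      (∃ g : Vec n → ℝ, IntegrableOn g Ω ∧ ∀ᵐ x ∂(volume.restrict Ω), ∀ t : ℝ, |t| ≤ 1 →
        b ‖u x + t • φ x‖₊ ≤ g x) →
      ∃ g : Vec n → ℝ, IntegrableOn g Ω ∧ ∀ᵐ x ∂(volume.restrict Ω), ∀ t : ℝ, |t| ≤ 1 →
        |W x (u x + t • φ x) (U x + t • Φ x)| + ‖dY W x (u x + t • φ x) (U x + t • Φ x)‖ +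
          ‖dF W x (u x + t • φ x) (U x + t • Φ x)‖ ≤ g x := by
    rintro b hb ⟨g, hg, hbg⟩
    refine ⟨fun x => a x + g x + c * (2 ^ p * (‖U x‖ ^ p + B ^ p)), (ha.add hg).add hUp, ?_⟩
    filter_upwards [hb, hbg] with x hx hx' t ht
    refine (hx _ _).trans ?_
    have h1 := hx' t ht
    have h2 := mul_le_mul_of_nonneg_left
      (norm_add_smul_rpow_le (y := U x) (hΦB x) ht hp0.le) hc.le
    simp only [coe_nnnorm]
    linarith
  have mainPow : ∀ r : ℝ, 0 < r → IntegrableOn (fun x => ‖u x‖ ^ r) Ω →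
      GrowthBound Ω W (fun x Y Z => a x + c * ((Y : ℝ) ^ r + (Z : ℝ) ^ p)) →
      ∃ g : Vec n → ℝ, IntegrableOn g Ω ∧ ∀ᵐ x ∂(volume.restrict Ω), ∀ t : ℝ, |t| ≤ 1 →
        |W x (u x + t • φ x) (U x + t • Φ x)| + ‖dY W x (u x + t • φ x) (U x + t • Φ x)‖ +
          ‖dF W x (u x + t • φ x) (U x + t • Φ x)‖ ≤ g x := by
    intro r hr hur hG
    refine main (fun Y => c * (Y : ℝ) ^ r) (hG.mono fun x hx y F => (hx y F).trans_eq (by ring))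
      ⟨fun x => c * (2 ^ r * (‖u x‖ ^ r + B ^ r)),
        ((hur.add (integrable_const _)).const_mul _).const_mul _, ae_of_all _ fun x t ht => ?_⟩
    exact mul_le_mul_of_nonneg_left (norm_add_smul_rpow_le (y := u x) (hφB x) ht hr.le) hc.le
  have hm : AEStronglyMeasurable u (volume.restrict Ω) :=
    hu.1.1.mono_measure (Measure.restrict_mono (subset_outer hδ) le_rfl)
  rcases hW with hG | ⟨hsp, r, hr1, hr, hu₀, hG⟩ | ⟨hsp, r, hr1, hr, hu₀, hG⟩ |
    ⟨hsp, hu₀, f, hf, hG⟩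
  · exact mainPow p hp0 (MemLp.integrable_norm_rpow_ofReal hp0
      (hu.1.mono_measure (Measure.restrict_mono (subset_outer hδ) le_rfl))) hG
  · have hr0 : 0 < r := by linarith
    refine mainPow r hr0 ?_ hG
    rw [← hun]
    refine IntegrableOn.union ?_ ?_
    · have := isFiniteMeasure_restrict (hΩb.subset hSΩ)
      exact MemLp.integrable_norm_rpow_ofReal hr0
        ((hu.memLp_of_subcritical hn hs0 hs1 hp hδ hsp hw hΩo hΩb).mono_exponent
          (ENNReal.ofReal_le_ofReal hr))
    · refine (MemLp.integrable_norm_rpow_ofReal hr0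
        (hu₀.mono_measure (Measure.restrict_mono hcompl le_rfl))).congr ?_
      filter_upwards [hoff'] with x hx
      rw [hx]
  · have hr0 : 0 < r := by linarith
    refine main (fun Y => Real.exp ((Y : ℝ) ^ r)) hG ?_
    set g : Vec n → ℝ := (shrunk δ Ω).indicator
      (fun x => Real.exp (2 ^ r * ‖u x‖ ^ r) * Real.exp (2 ^ r * B ^ r)) +
        fun x => (Ω \ shrunk δ Ω).indicator (fun x => Real.exp (‖u₀ x‖ ^ r)) x with hg
    have h1 : IntegrableOn (fun x => Real.exp (2 ^ r * ‖u x‖ ^ r)) (shrunk δ Ω) := by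
      have hmS : AEStronglyMeasurable u (volume.restrict (shrunk δ Ω)) :=
        hm.mono_measure (Measure.restrict_mono hSΩ le_rfl)
      refine ⟨(Real.measurable_exp.comp_aemeasurable
        ((hmS.norm.aemeasurable.pow_const r).const_mul _)).aestronglyMeasurable, ?_⟩
      rw [hasFiniteIntegral_iff_ofReal (ae_of_all _ fun x => (Real.exp_pos _).le)]
      exact hu.lintegral_exp_lt_top hn hs0 hs1 hp hδ hsp hw hΩo hΩb (by positivity) hr0 hr
    refine ⟨g, ?_, ?_⟩
    · refine Integrable.add ?_ ?_
      · exact (IntegrableOn.integrable_indicator (h1.mul_const _) hSo).integrableOn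
      · exact ((hu₀.mono_set hcompl).integrable_indicator
          (hΩo.measurableSet.diff hSo)).integrableOn
    · filter_upwards [hoff, ae_restrict_mem hΩo.measurableSet] with x hx hxΩ t ht
      by_cases hxs : x ∈ shrunk δ Ω
      · have : g x = Real.exp (2 ^ r * ‖u x‖ ^ r) * Real.exp (2 ^ r * B ^ r) := by
          simp [hg, hxs]
        rw [this, ← Real.exp_add, ← mul_add]
        exact Real.exp_le_exp.2 (norm_add_smul_rpow_le (hφB x) ht hr0.le)
      · have : g x = Real.exp (‖u₀ x‖ ^ r) := by
          simp [hg, hxs, hxΩ]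
        rw [this, hφ x hxs, hx hxs]
        simp
  · refine main (fun Y => (f Y : ℝ)) hG ?_
    obtain ⟨B₁, hB₁⟩ := hu.exists_norm_le_of_supercritical hn hs0 hs1 hp hδ hsp hw hΩo hΩb
    have hB₁' : ∀ᵐ x ∂(volume.restrict Ω), x ∈ shrunk δ Ω → ‖u x‖ ≤ B₁ := by
      rw [ae_restrict_iff' hSo] at hB₁
      exact ae_restrict_of_ae hB₁
    obtain ⟨B₂, hB₂⟩ : ∃ B₂ : ℝ, ∀ᵐ x ∂(volume.restrict (outer δ Ω)), ‖u₀ x‖ ≤ B₂ := by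
      have h := hu₀.2.ne
      rw [eLpNorm_exponent_top] at h
      refine ⟨(eLpNormEssSup u₀ (volume.restrict (outer δ Ω))).toReal, ?_⟩
      filter_upwards [enorm_ae_le_eLpNormEssSup u₀ (volume.restrict (outer δ Ω))] with x hx
      rw [← toReal_enorm]
      exact ENNReal.toReal_mono h hx
    set R : ℝ := max B₁ B₂ + B with hR
    obtain ⟨M, hM⟩ := (hf (Metric.closedBall 0 R) Metric.isBounded_closedBall).subset_closedBall 0
    refine ⟨fun _ => M, integrable_const _, ?_⟩
    filter_upwards [hB₁', hoff, ae_restrict_of_ae_restrict_of_subset (subset_outer hδ) hB₂]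
      with x h1 h2 h3 t ht
    have h4 : ‖u x‖ ≤ max B₁ B₂ := by
      by_cases hxs : x ∈ shrunk δ Ω
      · exact (h1 hxs).trans (le_max_left _ _)
      · rw [h2 hxs]; exact h3.trans (le_max_right _ _)
    have h5 : ‖u x + t • φ x‖ ≤ R := by
      refine (norm_add_le _ _).trans (add_le_add h4 ?_)
      rw [norm_smul, Real.norm_eq_abs]
      nlinarith [hφB x, norm_nonneg (φ x), abs_nonneg t]
    have h6 := hM ⟨‖u x + t • φ x‖₊, by simpa [NNReal.dist_eq] using h5, rfl⟩
    simpa [NNReal.dist_eq] using h6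

/-! ### The Euler–Lagrange equation in weak form -/

/-- The weak Euler–Lagrange equation: the derivative of the energy along `u + t φ` vanishes at
`t = 0`, and may be computed under the integral sign. -/
lemma integral_dirDeriv_eq_zero (hn : 1 ≤ n) (hs1 : s < 1) (hp : 1 < p)
    (hw : IsCutoff δ w) (hΩo : IsOpen Ω) (hΩb : Bornology.IsBounded Ω)
    {W : Vec n → Vec n → Mat n → ℝ} {u₀ u φ : Vec n → Vec n}
    (hWm : ∀ y F, AEMeasurable (fun x => W x y F) (volume.restrict Ω))
    (hW : ∀ᵐ x ∂(volume.restrict Ω), ContDiff ℝ 1 (fun z : Vec n × Mat n => W x z.1 z.2))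
    (hum : AEStronglyMeasurable u (volume.restrict Ω))
    (hu : MemH s p δ w Ω u) (hmin : IsMinimizer s p δ w Ω W u₀ u) (hφ : IsTest (shrunk δ Ω) φ)
    {B : ℝ} (hφB : ∀ x, ‖φ x‖ ≤ B) (hΦB : ∀ x, ‖smoothGrad s δ w φ x‖ ≤ B)
    {g : Vec n → ℝ} (hg : IntegrableOn g Ω) (hdom : ∀ᵐ x ∂(volume.restrict Ω), ∀ t : ℝ, |t| ≤ 1 →
      |W x (u x + t • φ x) (nonlocalGrad s δ w Ω u x + t • smoothGrad s δ w φ x)| +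
        ‖dY W x (u x + t • φ x) (nonlocalGrad s δ w Ω u x + t • smoothGrad s δ w φ x)‖ +
        ‖dF W x (u x + t • φ x) (nonlocalGrad s δ w Ω u x + t • smoothGrad s δ w φ x)‖ ≤ g x) :
    IntegrableOn (fun x => dirDeriv W x (u x, nonlocalGrad s δ w Ω u x)
        (φ x, smoothGrad s δ w φ x)) Ω ∧
      ∫ x in Ω, dirDeriv W x (u x, nonlocalGrad s δ w Ω u x)
        (φ x, smoothGrad s δ w φ x) = 0 := by
  set U := nonlocalGrad s δ w Ω u with hU
  set z : Vec n → Vec n × Mat n := fun x => (u x, U x) with hz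
  set ζ : Vec n → Vec n × Mat n := fun x => (φ x, smoothGrad s δ w φ x) with hζ
  have hzm : AEStronglyMeasurable z (volume.restrict Ω) := hum.prodMk hu.2.1.1
  have hζm : AEStronglyMeasurable ζ (volume.restrict Ω) :=
    hφ.smooth.continuous.aestronglyMeasurable.prodMk
      (measurable_smoothGrad hn hs1 hw hφ.univ).aestronglyMeasurable
  set Fn : ℝ → Vec n → ℝ := fun t x => W x (z x + t • ζ x).1 (z x + t • ζ x).2 with hFn
  have hball : Metric.ball (0 : ℝ) 1 ∈ 𝓝 (0 : ℝ) := Metric.ball_mem_nhds _ one_pos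
  have hFm : ∀ t, AEStronglyMeasurable (Fn t) (volume.restrict Ω) := fun t =>
    (aemeasurable_comp_pair hWm hW (hzm.add (hζm.const_smul t))).aestronglyMeasurable
  have hF0 : Integrable (Fn 0) (volume.restrict Ω) := by
    refine hg.mono' (hFm 0) ?_
    filter_upwards [hdom] with x hx
    have h := hx 0 (by simp)
    have h1 := norm_nonneg (dY W x (u x + (0 : ℝ) • φ x) (U x + (0 : ℝ) • smoothGrad s δ w φ x))
    have h2 := norm_nonneg (dF W x (u x + (0 : ℝ) • φ x) (U x + (0 : ℝ) • smoothGrad s δ w φ x))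
    calc ‖Fn 0 x‖ = |W x (u x + (0 : ℝ) • φ x) (U x + (0 : ℝ) • smoothGrad s δ w φ x)| := rfl
      _ ≤ g x := by linarith
  have hF'm : AEStronglyMeasurable (fun x => dirDeriv W x (z x + (0 : ℝ) • ζ x) (ζ x))
      (volume.restrict Ω) :=
    (aemeasurable_dirDeriv hWm hW (hzm.add (hζm.const_smul (0 : ℝ))) hζm).aestronglyMeasurable
  have hF'b : ∀ᵐ x ∂(volume.restrict Ω), ∀ t ∈ Metric.ball (0 : ℝ) 1,
      ‖dirDeriv W x (z x + t • ζ x) (ζ x)‖ ≤ g x * (B + B) := by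
    filter_upwards [hdom] with x hx t ht
    have h := hx t (by simpa using (mem_ball_zero_iff.1 ht).le)
    have h0 := (norm_nonneg (φ x)).trans (hφB x)
    exact (abs_dirDeriv_le W x (z x + t • ζ x) (ζ x)).trans
      (mul_le_mul h (add_le_add (hφB x) (hΦB x)) (add_nonneg (norm_nonneg _) (norm_nonneg _))
        ((add_nonneg (add_nonneg (abs_nonneg _) (norm_nonneg _)) (norm_nonneg _)).trans h))
  obtain ⟨hint, hder⟩ := hasDerivAt_integral_of_dominated_loc_of_deriv_le
    (μ := volume.restrict Ω) (F := Fn) (F' := fun t x => dirDeriv W x (z x + t • ζ x) (ζ x))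
    (x₀ := (0 : ℝ)) (bound := fun x => g x * (B + B)) hball (Eventually.of_forall hFm) hF0 hF'm
    hF'b (hg.mul_const _)
    (by filter_upwards [hW] with x hx t _; exact hasDerivAt_dirDeriv hx (z x) (ζ x) t)
  simp only [zero_smul, add_zero] at hint hder
  refine ⟨hint, ?_⟩
  -- the energy of the competitors
  have hen : ∀ t : ℝ, energy s δ w Ω W (u + t • φ) = ∫ x in Ω, Fn t x := by
    intro t
    have h1 := hu.nonlocalGrad_add hn hs1 hw hΩo hΩb hp
      ((hφ.smul t).memH0 hn hs1 hw hΩo hΩb).1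
    have h2 := (hφ.smul t).univ.nonlocalGrad_ae_eq hn hs1 hw hΩo hΩb
    refine integral_congr_ae ?_
    filter_upwards [h1, h2] with x hx hx'
    have e : nonlocalGrad s δ w Ω (u + t • φ) x = U x + t • smoothGrad s δ w φ x := by
      rw [hx, Pi.add_apply, hx', smoothGrad_smul hn hs1 hw hφ.univ, Pi.smul_apply]
    rw [e]
    rfl
  have hloc : IsLocalMin (fun t => ∫ x in Ω, Fn t x) 0 := by
    refine Eventually.of_forall fun t => ?_
    have h0 := hen 0
    rw [zero_smul, add_zero] at h0
    change (∫ x in Ω, Fn 0 x) ≤ ∫ x in Ω, Fn t x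
    rw [← h0, ← hen t]
    refine hmin.2 _ ?_
    have e : u + t • φ - u₀ = (u - u₀) + t • φ := by abel
    rw [MemHAffine, e]
    exact MemH0.add hn hs1 hw hΩo hΩb hp hmin.1 ((hφ.smul t).memH0 hn hs1 hw hΩo hΩb)
  exact hloc.hasDerivAt_eq_zero hder

end NonlocalEL

namespace NonlocalEL

variable {n : ℕ} {s p δ : ℝ} {w : Vec n → ℝ} {Ω : Set (Vec n)}

/-! ### The strong form of the equation -/

/-- Where `G` is continuously differentiable up to null sets, its differences absorb the singularity
of the kernel; away from the singularity `G ∈ L¹` suffices. -/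
lemma integrable_prod_of_hasFDerivAt {κ G g : Vec n → ℝ} (hκ : IsLevyKernel κ)
    (hGm : Measurable G) (hG : Integrable G) {U K : Set (Vec n)} (hU : IsOpen U)
    (hGg : ∀ᵐ x ∂(volume.restrict U), G x = g x) {g' : Vec n → Vec n →L[ℝ] ℝ}
    (hg' : ContinuousOn g' U) (hgd : ∀ x ∈ U, HasFDerivAt g (g' x) x) (hK : IsCompact K)
    (hKU : K ⊆ U) :
    Integrable (fun q : Vec n × Vec n =>
      K.indicator 1 q.1 * ((G q.1 - G (q.1 - q.2)) * κ q.2)) (volume.prod volume) := by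
  obtain ⟨ρ₀, hρ₀, hρU⟩ := hK.exists_cthickening_subset_open hU hKU
  set ρ := min ρ₀ 1 with hρ
  have hρ0 : 0 < ρ := lt_min hρ₀ one_pos
  have hρ1 : ρ ≤ 1 := min_le_right _ _
  have hcU : Metric.cthickening ρ K ⊆ U :=
    (Metric.cthickening_mono (min_le_left _ _) K).trans hρU
  obtain ⟨M, hM⟩ := hK.cthickening.exists_bound_of_continuousOn (hg'.mono hcU)
  have hdiff : ∀ x ∈ K, ∀ h : Vec n, ‖h‖ ≤ ρ → |g x - g (x - h)| ≤ M * ‖h‖ := by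
    intro x hx h hh
    have hsub : Metric.closedBall x ρ ⊆ Metric.cthickening ρ K :=
      Metric.closedBall_subset_cthickening hx ρ
    have := (convex_closedBall x ρ).norm_image_sub_le_of_norm_hasFDerivWithin_le
      (f := g) (f' := g') (C := M) (x := x - h) (y := x)
      (fun y hy => (hgd y (hcU (hsub hy))).hasFDerivWithinAt) (fun y hy => hM y (hsub hy))
      (by simpa [dist_eq_norm] using hh) (Metric.mem_closedBall_self hρ0.le)
    simpa using this
  have hM' : K.Nonempty → 0 ≤ M := fun ⟨x, hx⟩ =>
    (norm_nonneg _).trans (hM x (Metric.self_subset_cthickening K hx))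
  rcases K.eq_empty_or_nonempty with rfl | hKne
  · simp
  have hM0 := hM' hKne
  have hKm := hK.measurableSet
  have hκm := hκ.meas
  -- the kernel away from the origin
  set κ₁ : Vec n → ℝ := (Metric.closedBall 0 ρ)ᶜ.indicator fun h => |κ h| with hκ₁
  have hκ₁i : Integrable κ₁ := by
    refine (hκ.int.const_mul ρ⁻¹).mono' (Measurable.aestronglyMeasurable
      (hκm.norm.indicator Metric.isClosed_closedBall.measurableSet.compl)) (ae_of_all _ fun h => ?_)
    by_cases hh : h ∈ (Metric.closedBall (0 : Vec n) ρ)ᶜ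
    · rw [hκ₁, Set.indicator_of_mem hh, Real.norm_of_nonneg (abs_nonneg _), ← mul_assoc,
        inv_mul_eq_div]
      refine le_mul_of_one_le_left (abs_nonneg _) ((one_le_div hρ0).2 (le_min hρ1 ?_))
      have : ρ < ‖h‖ := by simpa using hh
      exact this.le
    · rw [hκ₁, Set.indicator_of_notMem hh, norm_zero]; positivity
  have hone : Integrable (K.indicator (1 : Vec n → ℝ)) :=
    (integrable_indicator_iff hKm).2 (by
      have : IntegrableOn (fun _ : Vec n => (1 : ℝ)) K := integrableOn_const hK.measure_lt_top.ne
      exact this)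
  have i1 := (hone.mul_prod (hκ.int.const_mul M))
  have i2 := hG.norm.mul_prod hκ₁i
  have i3 : Integrable (fun q : Vec n × Vec n => κ₁ q.2 * ‖G (q.1 - q.2)‖)
      (volume.prod volume) :=
    hκ₁i.convolution_integrand (ContinuousLinearMap.mul ℝ ℝ) hG.norm
  have hae : ∀ᵐ x : Vec n, x ∈ U → G x = g x := (ae_restrict_iff' hU.measurableSet).1 hGg
  have hae1 : ∀ᵐ q : Vec n × Vec n ∂(volume.prod volume), q.1 ∈ U → G q.1 = g q.1 :=
    Measure.quasiMeasurePreserving_fst.ae hae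
  have hae2 : ∀ᵐ q : Vec n × Vec n ∂(volume.prod volume),
      q.1 - q.2 ∈ U → G (q.1 - q.2) = g (q.1 - q.2) :=
    (quasiMeasurePreserving_sub_of_right_invariant volume volume).ae hae
  have hind : Measurable (K.indicator (1 : Vec n → ℝ)) := measurable_one.indicator hKm
  refine (i1.add (i2.add i3)).mono' (Measurable.aestronglyMeasurable (by fun_prop)) ?_
  filter_upwards [hae1, hae2] with q h1 h2
  have hκ₁0 : ∀ h, 0 ≤ κ₁ h := fun h => Set.indicator_nonneg (fun _ _ => abs_nonneg _) h
  by_cases hq : q.1 ∈ K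
  · simp only [Set.indicator_of_mem hq, Pi.one_apply, one_mul, Pi.add_apply]
    rw [norm_mul, Real.norm_eq_abs, Real.norm_eq_abs]
    by_cases hh : ‖q.2‖ ≤ ρ
    · have hmem : q.1 - q.2 ∈ U := hcU (Metric.closedBall_subset_cthickening hq ρ
        (by simpa [dist_eq_norm] using hh))
      rw [h1 (hKU hq), h2 hmem, min_eq_right (hh.trans hρ1), ← mul_assoc]
      have h3 := mul_le_mul_of_nonneg_right (hdiff _ hq _ hh) (abs_nonneg (κ q.2))
      have h4 := mul_nonneg (norm_nonneg (g q.1)) (hκ₁0 q.2)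
      have h5 := mul_nonneg (hκ₁0 q.2) (norm_nonneg (g (q.1 - q.2)))
      linarith
    · have e : κ₁ q.2 = |κ q.2| := by
        rw [hκ₁, Set.indicator_of_mem]
        simpa using hh
      rw [e]
      have h3 := mul_le_mul_of_nonneg_right (abs_sub (G q.1) (G (q.1 - q.2))) (abs_nonneg (κ q.2))
      have h4 : 0 ≤ M * (min 1 ‖q.2‖ * |κ q.2|) := by positivity
      rw [Real.norm_eq_abs, Real.norm_eq_abs]
      linarith
  · simp only [Set.indicator_of_notMem hq, zero_mul, norm_zero, Pi.add_apply, zero_add]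
    have := hκ₁0 q.2
    positivity

/-- A weak nonlocal equation whose flux `G` is continuously differentiable in `U` holds almost
everywhere in `U`. -/
lemma ae_eq_sum_kdiff_of_weak {ι : Type*} [Fintype ι] {κ G g : ι → Vec n → ℝ} {f : Vec n → ℝ}
    (hκ : ∀ b, IsLevyKernel (κ b)) (hGm : ∀ b, Measurable (G b)) (hG : ∀ b, Integrable (G b))
    (hf : Integrable f) {U : Set (Vec n)} (hU : IsOpen U) (hUb : Bornology.IsBounded U)
    (hGg : ∀ b, ∀ᵐ x ∂(volume.restrict U), G b x = g b x) {g' : ι → Vec n → Vec n →L[ℝ] ℝ}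
    (hg' : ∀ b, ContinuousOn (g' b) U) (hgd : ∀ b, ∀ x ∈ U, HasFDerivAt (g b) (g' b x) x) (c : ℝ)
    (hweak : ∀ η : Vec n → ℝ, ContDiff ℝ ∞ η → HasCompactSupport η → tsupport η ⊆ U →
      (∫ x, f x * η x) + c * ∑ b, ∫ x, G b x * kdiff (κ b) η x = 0) :
    ∀ᵐ x ∂(volume.restrict U), (∀ b, Integrable fun h => (G b x - G b (x - h)) * κ b h) ∧
      f x = c * ∑ b, kdiff (κ b) (G b) x := by
  have hprod := fun (b : ι) {K : Set (Vec n)} (hK : IsCompact K) (hKU : K ⊆ U) =>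
    integrable_prod_of_hasFDerivAt (hκ b) (hGm b) (hG b) hU (hGg b) (hg' b) (hgd b) hK hKU
  have hloc : ∀ b, ∀ {K : Set (Vec n)}, IsCompact K → K ⊆ U → IntegrableOn (kdiff (κ b) (G b)) K := by
    intro b K hK hKU
    rw [← integrable_indicator_iff hK.measurableSet]
    refine (hprod b hK hKU).integral_prod_left.congr (ae_of_all _ fun x => ?_)
    simp only [integral_const_mul]
    by_cases hx : x ∈ K <;> simp [hx, kdiff]
  have hinth : ∀ᵐ x ∂(volume.restrict U), ∀ b, Integrable fun h => (G b x - G b (x - h)) * κ b h := by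
    obtain ⟨F, hFc, hFU, hFe, -⟩ := hU.exists_iUnion_isClosed
    rw [← hFe, ae_restrict_iUnion_iff]
    intro k
    have hk : IsCompact (F k) := Metric.isCompact_of_isClosed_isBounded (hFc k) (hUb.subset (hFU k))
    rw [ae_all_iff]
    intro b
    filter_upwards [ae_restrict_of_ae (hprod b hk (hFU k)).prod_right_ae,
      ae_restrict_mem (hFc k).measurableSet] with x hx hxk
    simpa [hxk] using hx
  set r : Vec n → ℝ := fun x => f x - c * ∑ b, kdiff (κ b) (G b) x with hr
  have hrl : LocallyIntegrableOn r U := by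
    rw [locallyIntegrableOn_iff hU.isLocallyClosed]
    intro K hKU hK
    exact hf.integrableOn.sub ((integrable_finsetSum _ fun b _ => hloc b hK hKU).const_mul c)
  have hr0 : ∀ᵐ x, x ∈ U → r x = 0 := by
    refine hU.ae_eq_zero_of_integral_contDiff_smul_eq_zero hrl fun η hη hηc hηU => ?_
    obtain ⟨L, hL⟩ := exists_bddLip hη hηc
    obtain ⟨B, hB⟩ := hη.continuous.bounded_above_of_compact_support hηc
    have hηm := hη.continuous.measurable
    have hbd : ∀ {ψ : Vec n → ℝ}, Integrable ψ → Integrable fun x => η x * ψ x := fun hψ =>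
      hψ.bdd_mul hη.continuous.aestronglyMeasurable (ae_of_all _ hB)
    have h2 : ∀ b, Integrable (fun q : Vec n × Vec n =>
        η q.1 * ((G b q.1 - G b (q.1 - q.2)) * κ b q.2)) (volume.prod volume) := by
      intro b
      have h := (hprod b hηc hηU).bdd_mul (f := fun q : Vec n × Vec n => η q.1)
        (Measurable.aestronglyMeasurable (by fun_prop)) (ae_of_all _ fun q => hB q.1)
      refine h.congr (ae_of_all _ fun q => ?_)
      by_cases hq : q.1 ∈ tsupport η
      · simp [hq]
      · simp [image_eq_zero_of_notMem_tsupport hq]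
    have hibp : ∀ b, ∫ x, G b x * kdiff (κ b) η x = -∫ x, η x * kdiff (κ b) (G b) x := by
      intro b
      refine integral_mul_kdiff (hκ b).odd (hbd (hG b)) (fun h => ?_) (fun h => ?_)
        (hL.integrable_prod hηm (hκ b) (hG b)) (h2 b)
      · refine ((hG b).bdd_mul (f := fun x => η (x - h)) (c := B)
          (Measurable.aestronglyMeasurable (by fun_prop)) (ae_of_all _ fun x => hB _)).congr
          (ae_of_all _ fun x => mul_comm _ _)
      · exact hbd ((hG b).comp_sub_right h)
    have hik : ∀ b, Integrable fun x => η x * kdiff (κ b) (G b) x := by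
      intro b
      refine (h2 b).integral_prod_left.congr (ae_of_all _ fun x => ?_)
      simp only [integral_const_mul, kdiff]
    have e : ∀ x, η x • r x = f x * η x - c * ∑ b, η x * kdiff (κ b) (G b) x := fun x => by
      rw [hr, smul_eq_mul, mul_sub, ← Finset.mul_sum]; ring
    simp_rw [e]
    rw [integral_sub ((hbd hf).congr (ae_of_all _ fun x => mul_comm _ _))
      ((integrable_finsetSum _ fun b _ => hik b).const_mul c), integral_const_mul,
      integral_finsetSum _ fun b _ => hik b]
    have := hweak η hη hηc hηU
    simp_rw [hibp] at this
    rw [Finset.sum_neg_distrib] at this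
    linarith
  rw [← ae_restrict_iff' hU.measurableSet] at hr0
  filter_upwards [hinth, hr0] with x h1 h2
  exact ⟨h1, sub_eq_zero.1 h2⟩

/-- A ball around an inner point that misses the frontier cannot leave `Ω`, being connected. -/
lemma ball_subset_of_mem_shrunk (hΩo : IsOpen Ω) {x : Vec n} (hx : x ∈ shrunk δ Ω) :
    Metric.ball x δ ⊆ Ω := by
  by_contra hne
  obtain ⟨y, hy, hyΩ⟩ := Set.not_subset.1 hne
  have hfar : ∀ z ∈ Metric.ball x δ, z ∉ frontier Ω := by
    intro z hz hzf
    have h1 := Metric.infDist_le_dist_of_mem (x := x) hzf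
    have h2 : dist z x < δ := hz
    rw [dist_comm] at h2
    linarith [hx.2]
  have hcov : ∀ z ∈ Metric.ball x δ, z ∈ Ω ∨ z ∈ (closure Ω)ᶜ := by
    intro z hz
    by_contra! h
    exact hfar z hz (by rw [hΩo.frontier_eq]; exact ⟨by simpa using h.2, h.1⟩)
  obtain ⟨z, -, hz1, hz2⟩ := (convex_ball x δ).isPreconnected Ω (closure Ω)ᶜ hΩo
    isClosed_closure.isOpen_compl hcov
    ⟨x, Metric.mem_ball_self (dist_nonneg.trans_lt hy), hx.1⟩
    ⟨y, hy, (hcov y hy).resolve_left hyΩ⟩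
  exact hz2 (subset_closure hz1)

lemma IsTest.single_smul {U : Set (Vec n)} {η : Vec n → ℝ} (hη : ContDiff ℝ ∞ η)
    (hηc : HasCompactSupport η) (hηU : tsupport η ⊆ U) (i : Fin n) :
    IsTest U fun x => η x • EuclideanSpace.single i (1 : ℝ) :=
  ⟨hη.smul contDiff_const, hηc.smul_right,
    (closure_mono (Function.support_smul_subset_left η fun _ => EuclideanSpace.single i (1 : ℝ))).trans
      hηU⟩

/-- A weak equation `∫ (P · φ + A · D φ) = 0` with `A` continuously differentiable up to the
boundary of `shrunk δ Ω` gives `P = div A` almost everywhere there. -/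
lemma IsC1Closure.ae_eq_nonlocalMatDiv (hn : 1 ≤ n) (hs1 : s < 1)
    (hw : IsCutoff δ w) (hΩo : IsOpen Ω) (hΩb : Bornology.IsBounded Ω) {P : Vec n → Vec n}
    {A : Vec n → Mat n} (hP : IntegrableOn P Ω) (hA : IntegrableOn A Ω)
    (hC1 : IsC1Closure (shrunk δ Ω) A)
    (hweak : ∀ φ : Vec n → Vec n, IsTest (shrunk δ Ω) φ →
      ∫ x in Ω, (inner ℝ (P x) (φ x) + inner ℝ (A x) (smoothGrad s δ w φ x)) = 0) :
    ∀ᵐ x ∂(volume.restrict (shrunk δ Ω)),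
      (∀ i, IntegrableOn (divIntegrand s w (fun z => row (A z) i) x) (Metric.ball x δ)) ∧
        P x = nonlocalMatDiv s δ w A x := by
  obtain ⟨g, g', hAg, hgc, hg'c, hgd⟩ := hC1
  have hSo := isOpen_shrunk (δ := δ) hΩo
  have hAi : ∀ ij, Integrable (Ω.indicator fun x => A x ij) := fun ij =>
    (integrable_indicator_iff hΩo.measurableSet).2 (hA.eval_piLp ij)
  have hPi : ∀ i, Integrable (Ω.indicator fun x => P x i) := fun i =>
    (integrable_indicator_iff hΩo.measurableSet).2 (hP.eval_piLp i)
  -- measurable representatives, extended by zero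
  set G : Fin n × Fin n → Vec n → ℝ := fun ij => (hAi ij).1.mk _ with hG
  have hGm : ∀ ij, Measurable (G ij) := fun ij => (hAi ij).1.stronglyMeasurable_mk.measurable
  have hGe : ∀ ij, (Ω.indicator fun x => A x ij) =ᵐ[volume] G ij := fun ij => (hAi ij).1.ae_eq_mk
  have hGi : ∀ ij, Integrable (G ij) := fun ij => (hAi ij).congr (hGe ij)
  have hGA : ∀ ij, ∀ᵐ x ∂(volume.restrict Ω), G ij x = A x ij := fun ij => by
    filter_upwards [ae_restrict_of_ae (hGe ij), ae_restrict_mem hΩo.measurableSet] with x hx hxΩ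
    rw [← hx, Set.indicator_of_mem hxΩ]
  have hGAS : ∀ ij, ∀ᵐ x ∂(volume.restrict (shrunk δ Ω)), G ij x = A x ij := fun ij =>
    ae_restrict_of_ae_restrict_of_subset shrunk_subset (hGA ij)
  set κ : Fin n → Vec n → ℝ := fun j h => vecKernel s w h j with hκd
  have hκ : ∀ j, IsLevyKernel (κ j) := fun j => isLevyKernel_vecKernel hn hs1 hw j
  have hκ0 : ∀ j h, δ ≤ ‖h‖ → κ j h = 0 := fun j h hh => by
    simp [hκd, vecKernel_eq_zero hw hh]
  have hstrong : ∀ i, ∀ᵐ x ∂(volume.restrict (shrunk δ Ω)),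
      (∀ j, Integrable fun h => (G (i, j) x - G (i, j) (x - h)) * κ j h) ∧
        Ω.indicator (fun x => P x i) x = cConst n s * ∑ j, kdiff (κ j) (G (i, j)) x := by
    intro i
    refine ae_eq_sum_kdiff_of_weak hκ (fun j => hGm (i, j)) (fun j => hGi (i, j)) (hPi i) hSo
      (hΩb.subset shrunk_subset) (g := fun j x => g x (i, j))
      (g' := fun j x => (EuclideanSpace.proj (𝕜 := ℝ) (i, j) : Mat n →L[ℝ] ℝ).comp (g' x))
      (fun j => ?_) (fun j => ?_) (fun j x hx => ?_) (cConst n s) ?_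
    · filter_upwards [hGAS (i, j), hAg] with x h1 h2
      rw [h1, h2]
    · exact continuousOn_const.clm_comp (hg'c.mono subset_closure)
    · exact (EuclideanSpace.proj (𝕜 := ℝ) (i, j) : Mat n →L[ℝ] ℝ).hasFDerivAt.comp x (hgd x hx)
    · intro η hη hηc hηU
      have hφ := IsTest.single_smul hη hηc hηU i
      have h := hweak _ hφ
      obtain ⟨L, hL⟩ := exists_bddLip hη hηc
      obtain ⟨B, hB⟩ := hη.continuous.bounded_above_of_compact_support hηc
      have hηm := hη.continuous.measurable
      have e : ∀ x, inner ℝ (P x) (η x • EuclideanSpace.single i (1 : ℝ)) +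
          inner ℝ (A x) (smoothGrad s δ w (fun x => η x • EuclideanSpace.single i (1 : ℝ)) x) =
          P x i * η x + cConst n s * ∑ j, A x (i, j) * kdiff (κ j) η x := by
        intro x
        congr 1
        · rw [inner_smul_right, EuclideanSpace.inner_single_right]; simp [mul_comm]
        · rw [PiLp.inner_apply, Fintype.sum_prod_type, Finset.sum_eq_single i]
          · rw [Finset.mul_sum]
            refine Finset.sum_congr rfl fun j _ => ?_
            rw [smoothGrad_apply hn hs1 hw hφ.univ]
            simp [hκd]; ring
          · intro k _ hk
            refine Finset.sum_eq_zero fun j _ => ?_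
            rw [smoothGrad_apply hn hs1 hw hφ.univ]
            simp [hk, kdiff]
          · simp
      simp_rw [e] at h
      have iP : IntegrableOn (fun x => P x i * η x) Ω :=
        (hP.eval_piLp i).mul_bdd hη.continuous.aestronglyMeasurable (ae_of_all _ hB)
      have iA : ∀ j, IntegrableOn (fun x => A x (i, j) * kdiff (κ j) η x) Ω := fun j =>
        (hA.eval_piLp (i, j)).mul_bdd
          (stronglyMeasurable_kdiff hηm (hκ j).meas).aestronglyMeasurable
          (ae_of_all _ fun x => hL.abs_kdiff_le (hκ j) x)
      rw [integral_add iP ((integrable_finsetSum _ fun j _ => iA j).const_mul _),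
        integral_const_mul, integral_finsetSum _ fun j _ => iA j] at h
      rw [← h]
      congr 1
      · rw [← integral_indicator hΩo.measurableSet]
        congr 1; ext x
        by_cases hx : x ∈ Ω <;> simp [hx]
      · congr 1
        refine Finset.sum_congr rfl fun j _ => ?_
        rw [← integral_indicator hΩo.measurableSet]
        refine integral_congr_ae ?_
        filter_upwards [hGe (i, j)] with x hx
        rw [← hx]
        by_cases hxΩ : x ∈ Ω <;> simp [hxΩ]
  filter_upwards [ae_all_iff.2 hstrong, ae_all_iff.2 hGAS, ae_restrict_mem hSo.measurableSet]
    with x hx hGx hxS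
  have hball := ball_subset_of_mem_shrunk hΩo hxS
  have hGy : ∀ᵐ y ∂(volume.restrict (Metric.ball x δ)), ∀ ij, G ij y = A y ij :=
    ae_restrict_of_ae_restrict_of_subset hball (ae_all_iff.2 hGA)
  have hdiv : ∀ i, (fun y => ∑ j, (G (i, j) x - G (i, j) y) * κ j (x - y))
      =ᵐ[volume.restrict (Metric.ball x δ)] divIntegrand s w (fun z => row (A z) i) x := by
    intro i
    filter_upwards [hGy] with y hy
    rw [divIntegrand_eq]
    simp only [row, hGx, hy, hκd]
  have hterm : ∀ i j, Integrable fun y => (G (i, j) x - G (i, j) y) * κ j (x - y) := by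
    intro i j
    have := ((hx i).1 j).comp_sub_left x
    simpa using this
  refine ⟨fun i => ?_, ?_⟩
  · exact (integrable_finsetSum _ fun j _ => (hterm i j).integrableOn).congr (hdiv i)
  · ext i
    have h1 := (hx i).2
    rw [Set.indicator_of_mem hxS.1] at h1
    rw [h1, nonlocalMatDiv]
    simp only [nonlocalDiv]
    rw [← integral_congr_ae (hdiv i), integral_finsetSum _ fun j _ => (hterm i j).integrableOn]
    congr 1
    exact Finset.sum_congr rfl fun j _ => (integral_ball_eq_kdiff (hκ0 j) x).symm

end NonlocalEL

theorem theorem5p2 (n : ℕ) (hn : 1 ≤ n) (s p δ : ℝ) (hs0 : 0 < s) (hs1 : s < 1) (hp : 1 < p)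
    (hδ : 0 < δ) (w : NonlocalEL.Vec n → ℝ) (hw : NonlocalEL.IsCutoff δ w)
    (Ω : Set (NonlocalEL.Vec n)) (hΩo : IsOpen Ω) (hΩb : Bornology.IsBounded Ω)
    (hΩne : (NonlocalEL.shrunk δ Ω).Nonempty)
    (u₀ : NonlocalEL.Vec n → NonlocalEL.Vec n) (hu₀ : NonlocalEL.MemH s p δ w Ω u₀)
    (W : NonlocalEL.Vec n → NonlocalEL.Vec n → NonlocalEL.Mat n → ℝ)
    (hWmeas : ∀ y F, AEMeasurable (fun x => W x y F) (volume.restrict Ω))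
    (hWC1 : ∀ᵐ x ∂(volume.restrict Ω),
      ContDiff ℝ 1 (fun z : NonlocalEL.Vec n × NonlocalEL.Mat n => W x z.1 z.2))
    (hgrowth : ∃ (c : ℝ) (a : NonlocalEL.Vec n → ℝ), 0 < c ∧ IntegrableOn a Ω ∧
      NonlocalEL.GrowthCondition s p δ Ω W u₀ c a)
    (u : NonlocalEL.Vec n → NonlocalEL.Vec n)
    (hu : NonlocalEL.IsMinimizer s p δ w Ω W u₀ u) :
    (∀ φ : NonlocalEL.Vec n → NonlocalEL.Vec n, NonlocalEL.IsTest (NonlocalEL.shrunk δ Ω) φ →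
      IntegrableOn (fun x =>
          inner ℝ (NonlocalEL.dY W x (u x) (NonlocalEL.nonlocalGrad s δ w Ω u x)) (φ x) +
          inner ℝ (NonlocalEL.dF W x (u x) (NonlocalEL.nonlocalGrad s δ w Ω u x))
            (NonlocalEL.smoothGrad s δ w φ x)) Ω ∧
      ∫ x in Ω,
          (inner ℝ (NonlocalEL.dY W x (u x) (NonlocalEL.nonlocalGrad s δ w Ω u x)) (φ x) +
          inner ℝ (NonlocalEL.dF W x (u x) (NonlocalEL.nonlocalGrad s δ w Ω u x))
            (NonlocalEL.smoothGrad s δ w φ x)) = 0) ∧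
    (NonlocalEL.IsC1Closure (NonlocalEL.shrunk δ Ω)
        (fun x => NonlocalEL.dF W x (u x) (NonlocalEL.nonlocalGrad s δ w Ω u x)) →
      ∀ᵐ x ∂(volume.restrict (NonlocalEL.shrunk δ Ω)),
        (∀ i, IntegrableOn (NonlocalEL.divIntegrand s w
          (fun z => NonlocalEL.row
            (NonlocalEL.dF W z (u z) (NonlocalEL.nonlocalGrad s δ w Ω u z)) i) x)
          (Metric.ball x δ)) ∧
        NonlocalEL.dY W x (u x) (NonlocalEL.nonlocalGrad s δ w Ω u x) =
          NonlocalEL.nonlocalMatDiv s δ w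
            (fun z => NonlocalEL.dF W z (u z) (NonlocalEL.nonlocalGrad s δ w Ω u z)) x) := by
  obtain ⟨c, a, hc, ha, hG⟩ := hgrowth
  have huu : NonlocalEL.MemH0 s p δ w Ω (u - u₀) := hu.1
  have huH : NonlocalEL.MemH s p δ w Ω u := by
    have := huu.1.add hn hs1 hw hΩo hΩb hp hu₀
    rwa [sub_add_cancel] at this
  have hum : AEStronglyMeasurable u (volume.restrict Ω) :=
    huH.1.1.mono_measure (Measure.restrict_mono (NonlocalEL.subset_outer hδ) le_rfl)
  have hzm := hum.prodMk huH.2.1.1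
  have weak : ∀ φ, NonlocalEL.IsTest (NonlocalEL.shrunk δ Ω) φ →
      IntegrableOn (fun x => NonlocalEL.dirDeriv W x (u x, NonlocalEL.nonlocalGrad s δ w Ω u x)
        (φ x, NonlocalEL.smoothGrad s δ w φ x)) Ω ∧
      ∫ x in Ω, NonlocalEL.dirDeriv W x (u x, NonlocalEL.nonlocalGrad s δ w Ω u x)
        (φ x, NonlocalEL.smoothGrad s δ w φ x) = 0 := fun φ hφ => by
    obtain ⟨B₁, hB₁⟩ := hφ.smooth.continuous.bounded_above_of_compact_support hφ.compact
    obtain ⟨B₂, hB₂⟩ := NonlocalEL.exists_norm_smoothGrad_le hn hs1 hw hφ.univ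
    have h1 : ∀ x, ‖φ x‖ ≤ max B₁ B₂ := fun x => (hB₁ x).trans (le_max_left _ _)
    have h2 : ∀ x, ‖NonlocalEL.smoothGrad s δ w φ x‖ ≤ max B₁ B₂ :=
      fun x => (hB₂ x).trans (le_max_right _ _)
    obtain ⟨g, hg, hdom⟩ := NonlocalEL.exists_dominating hn hs0 hs1 hp hδ hw hΩo hΩb hc ha
      hG huH huu h1 h2 fun x hx => image_eq_zero_of_notMem_tsupport fun hx' => hx (hφ.support hx')
    exact NonlocalEL.integral_dirDeriv_eq_zero hn hs1 hp hw hΩo hΩb hWmeas hWC1 hum huH hu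
      hφ h1 h2 hg hdom
  refine ⟨weak, fun hC1 => ?_⟩
  -- the partial gradients of `W` along `(u, D u)` are integrable
  obtain ⟨g, hg, hdom⟩ := NonlocalEL.exists_dominating hn hs0 hs1 hp hδ hw hΩo hΩb hc ha hG
    huH huu (φ := fun _ => 0) (Φ := fun _ => 0) (B := 0) (by simp) (by simp) (by simp)
  have hdom0 : ∀ᵐ x ∂(volume.restrict Ω),
      ‖NonlocalEL.dY W x (u x) (NonlocalEL.nonlocalGrad s δ w Ω u x)‖ ≤ g x ∧
      ‖NonlocalEL.dF W x (u x) (NonlocalEL.nonlocalGrad s δ w Ω u x)‖ ≤ g x := by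
    filter_upwards [hdom] with x hx
    have h := hx 0 (by simp)
    simp only [smul_zero, add_zero] at h
    have h0 := abs_nonneg (W x (u x) (NonlocalEL.nonlocalGrad s δ w Ω u x))
    have h1 := norm_nonneg (NonlocalEL.dY W x (u x) (NonlocalEL.nonlocalGrad s δ w Ω u x))
    have h2 := norm_nonneg (NonlocalEL.dF W x (u x) (NonlocalEL.nonlocalGrad s δ w Ω u x))
    constructor <;> linarith
  have hPi : IntegrableOn (fun x => NonlocalEL.dY W x (u x)
      (NonlocalEL.nonlocalGrad s δ w Ω u x)) Ω := by
    refine Integrable.of_eval_piLp fun i => hg.mono' ?_ ?_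
    · have := (NonlocalEL.aemeasurable_dirDeriv hWmeas hWC1 hzm
        (ζ := fun _ => (EuclideanSpace.single i 1, 0)) aestronglyMeasurable_const).aestronglyMeasurable
      simpa [NonlocalEL.dirDeriv, EuclideanSpace.inner_single_right] using this
    · filter_upwards [hdom0] with x hx
      exact (PiLp.norm_apply_le _ i).trans hx.1
  have hAi : IntegrableOn (fun x => NonlocalEL.dF W x (u x)
      (NonlocalEL.nonlocalGrad s δ w Ω u x)) Ω := by
    refine Integrable.of_eval_piLp fun ij => hg.mono' ?_ ?_
    · have := (NonlocalEL.aemeasurable_dirDeriv hWmeas hWC1 hzm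
        (ζ := fun _ => (0, EuclideanSpace.single ij 1)) aestronglyMeasurable_const).aestronglyMeasurable
      simpa [NonlocalEL.dirDeriv, EuclideanSpace.inner_single_right] using this
    · filter_upwards [hdom0] with x hx
      exact (PiLp.norm_apply_le _ ij).trans hx.2
  exact hC1.ae_eq_nonlocalMatDiv hn hs1 hw hΩo hΩb hPi hAi fun φ hφ => (weak φ hφ).2
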